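/- **Setting.** Let $\Pi$ be a finite policy space, $\mathcal M$ a measurable space of models and $\mathcal O$ an observation space with a $\sigma$-finite reference measure. Each $M\in\mathcal M$ and $\pi\in\Pi$ determine an observation distribution $M(\cdot|\pi)$, given by a (jointly measurable) density $M(o|\pi)$, and a value $V_M(\pi)\in[0,1]$. Let $\Phi$ be a finite family of pairwise disjoint subsets (infosets) of $\mathcal M\times\Pi$; each $\phi\in\Phi$ contains a single policy $\pi_\phi$. Put $\Psi=\bigcup_{\phi}\phi$. Write $\mathbb E^{\pi,M}[g]=\mathbb E_{o\sim M(\cdot|\pi)}[g(o)]$, and for $\nu\in\Delta(\Psi)$ let $\nu(\phi|\pi,o)\propto\int_{\phi}M(o|\pi)\,d\nu(M,\pi^\star)$ be the posterior. **Assumption (average estimation error).** Let $H,N\ge 1$, $B>0$ and let $\ell_h(\phi;\cdot):\mathcal O\to[-B,B]^N$ ($h=1,\dots,H$, $\phi\in\Phi$) be measurable with $\mathbb E^{\pi,M}[\ell_h(\phi;o)]=0$ for all $\phi$, all models $M$ occurring in $\phi$, and all $\pi\in\Pi$. The environment commits to some $\phi^\star\in\Phi$ and plays models $M_1,\dots,M_T$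 with $(M_t,\pi_{\phi^\star})\in\phi^\star$ such that $\mathbb E^{\pi,M_t}[\ell_h(\phi;o)]=\mathbb E^{\pi,M_{t'}}[\ell_h(\phi;o)]$ for all $\pi,\phi,h,t,t'$. **Divergence.** Put $\overline D_{\mathsf{av}}^\pi(\phi\|M)=\max_{j\in[N]}\frac1{B^2H}\sum_{h=1}^H(\mathbb E^{\pi,M}[\ell_h(\phi;o)_j])^2$, $$D^\pi(\nu\|\rho)=\mathbb E_{M\sim\nu}\mathbb E_{o\sim M(\cdot|\pi)}\Big[\mathrm{KL}(\nu(\cdot|\pi,o),\rho)+\mathbb E_{\phi\sim\rho}[\overline D_{\mathsf{av}}^\pi(\phi\|M)]\Big],$$ $$\mathsf{AIR}_\eta(p,\nu;\rho)=\mathbb E_{\pi\sim p}\mathbb E_{(M,\pi^\star)\sim\nu}\Big[V_M(\pi^\star)-V_M(\pi)-\tfrac1\eta D^\pi(\nu\|\rho)\Big],$$ $$\mathsf{dig}\text{-}\mathsf{dec}_\eta=\max_{\rho\in\Delta(\Phi)}\min_{p\in\Delta(\Pi)}\max_{\nu\in\Delta(\Psi)}\mathsf{AIR}_\eta(p,\nu;\rho).$$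 **Algorithm** (parameters $\eta>0$, $\delta\in(0,1]$). Let $T=K\tau$ with $\tau$ a positive even integer such that $\frac12T^{1/3}\le\tau\le2T^{1/3}$; let $\iota=\log(12NKH/\delta)$, $\beta=7\tau N\iota$, $\gamma=\frac1{2\beta}$, and let $\rho_1$ be uniform on $\Phi$. In epoch $k=1,\dots,K$, comprising the rounds $\mathcal I_k=\{(k-1)\tau+1,\dots,k\tau\}$: * let $p_k,\nu_k$ solve $\min_{p\in\Delta(\Pi)}\max_{\nu\in\Delta(\Psi)}\mathsf{AIR}_\eta(p,\nu;\rho_k)$, that is, $\nu_k$ maximizes $\mathsf{AIR}_\eta(p_k,\cdot;\rho_k)$ and $p_k$ minimizes $\max_\nu\mathsf{AIR}_\eta(\cdot,\nu;\rho_k)$; * draw $\pi_k\sim p_k$, play it in all rounds of $\mathcal I_k$, and observe $o_t\sim M_t(\cdot|\pi_k)$, $t\in\mathcal I_k$; * with $\mathcal I_k^-,\mathcal I_k^+$ the first and second half of $\mathcal I_k$, set $$L_k(\phi)=\sum_{j=1}^N\frac{\tau}{B^2H}\sum_{h=1}^H\Big(\frac1{|\mathcal I_k^-|}\sum_{t\in\mathcal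 I_k^-}\ell_h(\phi;o_t)_j\Big)\Big(\frac1{|\mathcal I_k^+|}\sum_{t\in\mathcal I_k^+}\ell_h(\phi;o_t)_j\Big);$$ * set $$\rho_{k+1}=\arg\min_{\rho\in\Delta(\Phi)}\Big\{\langle\rho,L_k+(4\gamma+2\beta^{-1})L_k^2\rangle+\sum_{t\in\mathcal I_k}\mathrm{KL}\big(\rho,\nu_k(\cdot|\pi_k,o_t)\big)+\tfrac1\gamma\mathrm{KL}(\rho,\rho_k)\Big\}.$$ The models $(M_t)_{t\in\mathcal I_k}$ may be chosen (possibly at random) on the basis of everything that happened in earlier epochs; given the past, $\pi_k$ is drawn independently of them, and the observations of the epoch are then drawn independently from $M_t(\cdot|\pi_k)$. It is assumed that the posteriors used are well defined: almost surely, for all $k$, $t\in\mathcal I_k$ and all $\pi$ with $p_k(\pi)>0$, the density $\int M(o|\pi)\,d\nu_k(M,\pi^\star)$ is nonzero for $M_t(\cdot|\pi)$-almost every $o$. **Quantities.** For $t\in\mathcal I_k$ write $p_t,\nu_t,\rho_t$ for $p_k,\nu_k,\rho_k$. Define $$\mathbf{Est}=\sum_{t=1}^T\mathbb E_{\pi\sim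 p_t}\Big[D^\pi(\delta_{M_t,\pi_{\phi^\star}}\|\rho_t)-\mathrm{Breg}_{D^\pi(\cdot\|\rho_t)}(\delta_{M_t,\pi_{\phi^\star}},\nu_t)\Big],$$ where $\mathrm{Breg}_F(x,y)=F(x)-F(y)-F'(y;x-y)$ with $F'(y;\cdot)$ the one-sided directional derivative, and $\mathrm{Reg}=\sum_{k=1}^K\sum_{t\in\mathcal I_k}(V_{M_t}(\pi_{\phi^\star})-V_{M_t}(\pi_k))$. **Theorem.** There is an absolute constant $C$ such that, in every such situation: 1. $\mathbf{Est}$ is integrable and $\mathbb E[\mathbf{Est}]\le C\,N\log|\Phi|\;T^{1/3}\,\log(12NKH/\delta)$; that is, $\mathbb E[\mathbf{Est}]\lesssim N\log|\Phi|\,T^{1/3}$ up to the logarithmic factor $\iota$. 2. $\mathrm{Reg}$ is integrable and $\mathbb E[\mathrm{Reg}]\le T\cdot\mathsf{dig}\text{-}\mathsf{dec}_\eta+\frac1\eta\mathbb E[\mathbf{Est}]$. 3. If $d>0$, $\eta=\sqrt{N\log|\Phi|/d}\;T^{-1/3}$ and $\mathsf{dig}\text{-}\mathsf{dec}_\eta\le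 d\,\eta$ (the form of the bound for on-policy bilinear classes and $Q$-type Bellman-eluder dimension), then $\mathbb E[\mathrm{Reg}]\le C\sqrt{d\,N\log|\Phi|}\;T^{2/3}\,\iota$. 4. If $d>0$, $\eta=(N\log|\Phi|)^{2/3}d^{-1/3}T^{-4/9}$ and $\mathsf{dig}\text{-}\mathsf{dec}_\eta\le\sqrt{d\,\eta}$ (the form of the bound for off-policy bilinear classes and $V$-type Bellman-eluder dimension), then $\mathbb E[\mathrm{Reg}]\le C\,(d\,N\log|\Phi|)^{1/3}\,T^{7/9}\,\iota$. -/

import Mathlib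

open MeasureTheory ProbabilityTheory
open scoped ENNReal

noncomputable section

namespace DigDec

variable {Mdl Pol Obs Φ Ω : Type*}

/-- Decision making with structured observations. Every model `M` and policy `π` determine a
distribution `M(· | π)` on the observation space, given by its density `dens M π` with respect to a
reference measure (the counting measure in the discrete case), and a value `V M π ∈ [0, 1]`. -/
structure DMSO (Mdl Pol Obs : Type*) [MeasurableSpace Mdl] [MeasurableSpace Pol]
    [MeasurableSpace Obs] where
  ref : Measure Obs
  sigmaFinite_ref : SigmaFinite ref
  dens : Mdl → Pol → Obs → ℝ≥0∞
  measurable_dens : Measurable fun x : (Mdl × Pol) × Obs => dens x.1.1 x.1.2 x.2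
  lintegral_dens : ∀ M π, ∫⁻ o, dens M π o ∂ref = 1
  V : Mdl → Pol → ℝ
  measurable_V : Measurable fun x : Mdl × Pol => V x.1 x.2
  V_mem : ∀ M π, V M π ∈ Set.Icc (0 : ℝ) 1

/-- A family of information sets, indexed by `Φ`: pairwise disjoint sets of pairs
(model, policy), each of which contains a single policy `policy φ`. -/
structure InfoSets (Mdl Pol Φ : Type*) [MeasurableSpace Mdl] [MeasurableSpace Pol] where
  set : Φ → Set (Mdl × Pol)
  measurableSet_set : ∀ φ, MeasurableSet (set φ)
  disjoint : Pairwise fun φ φ' => Disjoint (set φ) (set φ')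
  policy : Φ → Pol
  snd_eq : ∀ φ, ∀ x ∈ set φ, x.2 = policy φ

/-- The union `Ψ` of all information sets. -/
def InfoSets.union [MeasurableSpace Mdl] [MeasurableSpace Pol] (I : InfoSets Mdl Pol Φ) :
    Set (Mdl × Pol) := ⋃ φ, I.set φ

/-- `Δ(Ψ)`: probability measures on (model, policy) pairs that are carried by `Ψ`. -/
def InfoSets.worlds [MeasurableSpace Mdl] [MeasurableSpace Pol] (I : InfoSets Mdl Pol Φ) :
    Set (Measure (Mdl × Pol)) := {ν | IsProbabilityMeasure ν ∧ ν (I.union)ᶜ = 0}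

/-- Kullback-Leibler divergence of two distributions on a finite set, `⊤` without absolute
continuity. -/
def kl [Fintype Φ] (a b : Φ → ℝ) : ℝ≥0∞ :=
  open Classical in
  if ∀ φ, b φ = 0 → a φ = 0 then ENNReal.ofReal (∑ φ, a φ * Real.log (a φ / b φ)) else ⊤

section Model

variable [MeasurableSpace Mdl] [MeasurableSpace Pol] [MeasurableSpace Obs]

/-- The observation distribution `M(· | π)`. -/
def DMSO.law (P : DMSO Mdl Pol Obs) (M : Mdl) (π : Pol) : Measure Obs :=
  P.ref.withDensity (P.dens M π)

/-- The density of the observation `o` under `π` when the world is drawn from `ν`. -/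
def DMSO.evidence (P : DMSO Mdl Pol Obs) (ν : Measure (Mdl × Pol)) (π : Pol) (o : Obs) : ℝ≥0∞ :=
  ∫⁻ x, P.dens x.1 π o ∂ν

/-- The posterior probability `ν(φ | π, o)`, by Bayes' rule. -/
def posterior (P : DMSO Mdl Pol Obs) (I : InfoSets Mdl Pol Φ) (ν : Measure (Mdl × Pol)) (π : Pol)
    (o : Obs) (φ : Φ) : ℝ :=
  ((∫⁻ x in I.set φ, P.dens x.1 π o ∂ν) / P.evidence ν π o).toReal

/-- The averaged estimation error
`max_j (1 / (B² H)) ∑_h (E^{π, M}[ℓ_h(φ; o)_j])²`. -/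
def avgError {H N : ℕ} (P : DMSO Mdl Pol Obs) (ℓ : Fin H → Φ → Obs → Fin N → ℝ) (B : ℝ)
    (π : Pol) (φ : Φ) (M : Mdl) : ℝ :=
  ⨆ j : Fin N, 1 / (B ^ 2 * H) * ∑ h : Fin H, (∫ o, ℓ h φ o j ∂(P.law M π)) ^ 2

/-- The divergence
`D^π(ν ‖ ρ) = E_{M ∼ ν} E_{o ∼ M(· | π)} [KL(ν(· | π, o), ρ) + E_{φ ∼ ρ} Dbar^π(φ ‖ M)]`. -/
def divergence [Fintype Φ] (P : DMSO Mdl Pol Obs) (I : InfoSets Mdl Pol Φ)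
    (Dbar : Pol → Φ → Mdl → ℝ) (π : Pol) (ν : Measure (Mdl × Pol)) (ρ : Φ → ℝ) : ℝ≥0∞ :=
  ∫⁻ x, ∫⁻ o, (kl (posterior P I ν π o) ρ + ENNReal.ofReal (∑ φ, ρ φ * Dbar π φ x.1))
    ∂(P.law x.1 π) ∂ν

/-- The objective
`AIR(p, ν; ρ) = E_{π ∼ p} E_{(M, π') ∼ ν} [V_M(π') - V_M(π) - D^π(ν ‖ ρ) / η]`. -/
def air [Fintype Pol] [Fintype Φ] (P : DMSO Mdl Pol Obs) (I : InfoSets Mdl Pol Φ)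
    (Dbar : Pol → Φ → Mdl → ℝ) (η : ℝ) (p : Pol → ℝ) (ν : Measure (Mdl × Pol)) (ρ : Φ → ℝ) :
    EReal :=
  ((∑ π, p π * ∫ x, (P.V x.1 x.2 - P.V x.1 π) ∂ν : ℝ) : EReal) -
    ((ENNReal.ofReal (1 / η) * ∑ π, ENNReal.ofReal (p π) * divergence P I Dbar π ν ρ : ℝ≥0∞) :
      EReal)

/-- `(p, ν)` solves `min_p max_ν AIR(p, ν; ρ)`: `ν` is a best response to `p`, and `p` minimizes
the value of the best response. -/
structure IsMinimaxSolution [Fintype Pol] [Fintype Φ] (P : DMSO Mdl Pol Obs)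
    (I : InfoSets Mdl Pol Φ) (Dbar : Pol → Φ → Mdl → ℝ) (η : ℝ) (p : Pol → ℝ)
    (ν : Measure (Mdl × Pol)) (ρ : Φ → ℝ) : Prop where
  p_mem : p ∈ stdSimplex ℝ Pol
  ν_mem : ν ∈ I.worlds
  best_response : ∀ ν' ∈ I.worlds, air P I Dbar η p ν' ρ ≤ air P I Dbar η p ν ρ
  minimal : ∀ p' ∈ stdSimplex ℝ Pol,
    ⨆ ν' ∈ I.worlds, air P I Dbar η p ν' ρ ≤ ⨆ ν' ∈ I.worlds, air P I Dbar η p' ν' ρ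

/-- The dual information gain decision-estimation coefficient
`max_ρ min_p max_ν AIR(p, ν; ρ)`. -/
def digDec [Fintype Pol] [Fintype Φ] (P : DMSO Mdl Pol Obs) (I : InfoSets Mdl Pol Φ)
    (Dbar : Pol → Φ → Mdl → ℝ) (η : ℝ) : EReal :=
  ⨆ ρ ∈ stdSimplex ℝ Φ, ⨅ p ∈ stdSimplex ℝ Pol, ⨆ ν ∈ I.worlds, air P I Dbar η p ν ρ

/-- The Bregman divergence `F x - F y - ⟨∇F(y), x - y⟩` of a convex function of measures, the last
term being the one-sided derivative of `F` at `y` in the direction of `x`. -/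
def bregman {X : Type*} [MeasurableSpace X] (F : Measure X → ℝ≥0∞) (x y : Measure X) : ℝ :=
  (F x).toReal - (F y).toReal -
    derivWithin (fun s : ℝ => (F (ENNReal.ofReal (1 - s) • y + ENNReal.ofReal s • x)).toReal)
      (Set.Ici 0) 0

/-- The average-estimation-error condition on `ℓ_h : Φ × Obs → [-B, B]^N`: the mean of
`ℓ_h(φ; ·)` vanishes under every model of `φ` and every policy. -/
structure IsEstimationFunction {H N : ℕ} (P : DMSO Mdl Pol Obs) (I : InfoSets Mdl Pol Φ)
    (ℓ : Fin H → Φ → Obs → Fin N → ℝ) (B : ℝ) : Prop where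
  measurable : ∀ h φ j, Measurable fun o => ℓ h φ o j
  mem_Icc : ∀ h φ o j, ℓ h φ o j ∈ Set.Icc (-B) B
  mean_zero : ∀ φ, ∀ x ∈ I.set φ, ∀ π h j, ∫ o, ℓ h φ o j ∂(P.law x.1 π) = 0

end Model

/-! Rounds `t` and epochs `k` are counted from `0`. -/

/-- The rounds of epoch `k`. -/
def epoch (τ k : ℕ) : Finset ℕ := Finset.Ico (k * τ) ((k + 1) * τ)

/-- The first half of epoch `k`. -/
def epochFst (τ k : ℕ) : Finset ℕ := Finset.Ico (k * τ) (k * τ + τ / 2)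

/-- The second half of epoch `k`. -/
def epochSnd (τ k : ℕ) : Finset ℕ := Finset.Ico (k * τ + τ / 2) ((k + 1) * τ)

/-- The split-sample loss estimator
`L_k(φ) = ∑_j (τ / (B² H)) ∑_h (mean over the first half) (mean over the second half)`. -/
def lossEst {H N : ℕ} (ℓ : Fin H → Φ → Obs → Fin N → ℝ) (B : ℝ) (τ k : ℕ) (o : ℕ → Obs)
    (φ : Φ) : ℝ :=
  ∑ j : Fin N, (τ : ℝ) / (B ^ 2 * H) * ∑ h : Fin H,
    ((1 / ((epochFst τ k).card : ℝ)) * ∑ t ∈ epochFst τ k, ℓ h φ (o t) j) *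
    ((1 / ((epochSnd τ k).card : ℝ)) * ∑ t ∈ epochSnd τ k, ℓ h φ (o t) j)

/-- `ι = log(12 N K H / δ)`. -/
def iota (N K H : ℕ) (δ : ℝ) : ℝ := Real.log (12 * N * K * H / δ)

/-- `β = 7 τ N ι`. -/
def beta (τ N : ℕ) (ι : ℝ) : ℝ := 7 * τ * N * ι

/-- `γ = 1 / (2 β)`. -/
def gamma (τ N : ℕ) (ι : ℝ) : ℝ := 1 / (2 * beta τ N ι)

/-- The mirror-descent objective
`⟨ρ, L + (4γ + 2/β) L²⟩ + F(ρ) + KL(ρ, ρ_k) / γ`. -/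
def mdObjective [Fintype Φ] (β γ : ℝ) (L : Φ → ℝ) (F : (Φ → ℝ) → ℝ≥0∞) (ρk ρ : Φ → ℝ) : EReal :=
  ((∑ φ, ρ φ * (L φ + (4 * γ + 2 * β⁻¹) * L φ ^ 2) : ℝ) : EReal) +
    ((F ρ + ENNReal.ofReal (1 / γ) * kl ρ ρk : ℝ≥0∞) : EReal)

/-- Everything that happens in a run: in round `t` the environment plays `model t` and `obs t` is
observed; in epoch `k` the learner holds `ρ k`, computes `p k` and `ν k`, and plays `policy k`. -/
structure Run (Ω Mdl Pol Obs Φ : Type*) [MeasurableSpace Mdl] [MeasurableSpace Pol] where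
  model : ℕ → Ω → Mdl
  obs : ℕ → Ω → Obs
  policy : ℕ → Ω → Pol
  p : ℕ → Ω → Pol → ℝ
  ν : ℕ → Ω → Measure (Mdl × Pol)
  ρ : ℕ → Ω → Φ → ℝ

section Run

variable [MeasurableSpace Mdl] [MeasurableSpace Pol] [MeasurableSpace Obs]

/-- What the learner has seen before epoch `k`: the policies and observations of earlier epochs. -/
@[reducible] def Run.learnerHist (R : Run Ω Mdl Pol Obs Φ) (τ k : ℕ) : MeasurableSpace Ω :=
  (⨆ j ∈ Set.Iio k, MeasurableSpace.comap (R.policy j) inferInstance) ⊔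
    (⨆ t ∈ Set.Iio (k * τ), MeasurableSpace.comap (R.obs t) inferInstance)

/-- Everything that is settled when the policy of epoch `k` is drawn: the policies and
observations of earlier epochs, and the models up to and including epoch `k`. -/
@[reducible] def Run.envHist (R : Run Ω Mdl Pol Obs Φ) (τ k : ℕ) : MeasurableSpace Ω :=
  R.learnerHist τ k ⊔
    (⨆ t ∈ Set.Iio ((k + 1) * τ), MeasurableSpace.comap (R.model t) inferInstance)

/-- Everything that is settled when the observation of round `t` of epoch `k` is drawn. -/
@[reducible] def Run.roundHist (R : Run Ω Mdl Pol Obs Φ) (τ k t : ℕ) : MeasurableSpace Ω :=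
  R.envHist τ k ⊔ MeasurableSpace.comap (R.policy k) inferInstance ⊔
    (⨆ s ∈ Set.Iio t, MeasurableSpace.comap (R.obs s) inferInstance)

/-- The environment: it is restricted to the information set `φs`, it keeps the means of the
estimation functions constant over the rounds, and `o_t ∼ M_t(· | π_k)` in the rounds of
epoch `k`. -/
structure IsEnvironment {H N : ℕ} [MeasurableSpace Ω] (μ : Measure Ω) (P : DMSO Mdl Pol Obs)
    (I : InfoSets Mdl Pol Φ) (ℓ : Fin H → Φ → Obs → Fin N → ℝ) (τ K : ℕ) (φs : Φ)
    (R : Run Ω Mdl Pol Obs Φ) : Prop where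
  measurable_model : ∀ t, Measurable (R.model t)
  measurable_obs : ∀ t, Measurable (R.obs t)
  model_mem : ∀ᵐ ω ∂μ, ∀ t < K * τ, (R.model t ω, I.policy φs) ∈ I.set φs
  mean_eq : ∀ᵐ ω ∂μ, ∀ t < K * τ, ∀ t' < K * τ, ∀ π φ h j,
    ∫ o, ℓ h φ o j ∂(P.law (R.model t ω) π) = ∫ o, ℓ h φ o j ∂(P.law (R.model t' ω) π)
  obs_law : ∀ k < K, ∀ t ∈ epoch τ k, ∀ S : Set Obs, MeasurableSet S →
    μ⟦R.obs t ⁻¹' S | R.roundHist τ k t⟧ =ᵐ[μ]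
      fun ω => (P.law (R.model t ω) (R.policy k ω)).real S

/-- The learner: the batched framework with the split-sample mirror-descent update. Given the past,
and independently of the models of epoch `k`, the policy of epoch `k` is drawn from `p k`. -/
structure IsLearner {H N : ℕ} [Fintype Pol] [Fintype Φ] [MeasurableSpace Ω] (μ : Measure Ω)
    (P : DMSO Mdl Pol Obs) (I : InfoSets Mdl Pol Φ) (ℓ : Fin H → Φ → Obs → Fin N → ℝ) (B η δ : ℝ)
    (τ K : ℕ) (R : Run Ω Mdl Pol Obs Φ) : Prop where
  measurable_policy : ∀ k, Measurable (R.policy k)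
  measurable_p : ∀ k < K, Measurable[R.learnerHist τ k] (R.p k)
  measurable_ν : ∀ k < K, Measurable[R.learnerHist τ k] (R.ν k)
  measurable_ρ : ∀ k ≤ K, Measurable[R.learnerHist τ k] (R.ρ k)
  ρ_zero : ∀ᵐ ω ∂μ, ∀ φ, R.ρ 0 ω φ = 1 / (Fintype.card Φ : ℝ)
  minimax : ∀ᵐ ω ∂μ, ∀ k < K,
    IsMinimaxSolution P I (avgError P ℓ B) η (R.p k ω) (R.ν k ω) (R.ρ k ω)
  policy_law : ∀ k < K, ∀ π,
    μ⟦R.policy k ⁻¹' {π} | R.envHist τ k⟧ =ᵐ[μ] fun ω => R.p k ω π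
  ρ_succ_mem : ∀ᵐ ω ∂μ, ∀ k < K, R.ρ (k + 1) ω ∈ stdSimplex ℝ Φ
  ρ_succ : ∀ᵐ ω ∂μ, ∀ k < K,
    IsMinOn
      (mdObjective (beta τ N (iota N K H δ)) (gamma τ N (iota N K H δ))
        (lossEst ℓ B τ k fun t => R.obs t ω)
        (fun ρ => ∑ t ∈ epoch τ k, kl ρ (posterior P I (R.ν k ω) (R.policy k ω) (R.obs t ω)))
        (R.ρ k ω))
      (stdSimplex ℝ Φ) (R.ρ (k + 1) ω)

/-- Bayes' rule does not divide by zero on the observations of the run: whatever policy is drawn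
from `p k`, the environment's observations have positive density under the world
distribution `ν k` almost surely. -/
def PosteriorDefined [MeasurableSpace Ω] (μ : Measure Ω) (P : DMSO Mdl Pol Obs) (τ K : ℕ)
    (R : Run Ω Mdl Pol Obs Φ) : Prop :=
  ∀ᵐ ω ∂μ, ∀ k < K, ∀ t ∈ epoch τ k, ∀ π, 0 < R.p k ω π →
    ∀ᵐ o ∂(P.law (R.model t ω) π), P.evidence (R.ν k ω) π o ≠ 0

/-- The estimation term
`Est = ∑_t E_{π ∼ p_t} [D^π(δ ‖ ρ_t) - Breg_{D^π(· ‖ ρ_t)}(δ, ν_t)]`, where `δ` is the unit mass at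
`(M_t, π_φs)`. -/
def est {H N : ℕ} [Fintype Pol] [Fintype Φ] (P : DMSO Mdl Pol Obs) (I : InfoSets Mdl Pol Φ)
    (ℓ : Fin H → Φ → Obs → Fin N → ℝ) (B : ℝ) (τ K : ℕ) (φs : Φ) (R : Run Ω Mdl Pol Obs Φ)
    (ω : Ω) : ℝ :=
  ∑ k ∈ Finset.range K, ∑ t ∈ epoch τ k, ∑ π, R.p k ω π *
    ((divergence P I (avgError P ℓ B) π (Measure.dirac (R.model t ω, I.policy φs))
        (R.ρ k ω)).toReal -
      bregman (fun ν => divergence P I (avgError P ℓ B) π ν (R.ρ k ω))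
        (Measure.dirac (R.model t ω, I.policy φs)) (R.ν k ω))

/-- The regret against the policy of `φs`. -/
def regret (P : DMSO Mdl Pol Obs) (I : InfoSets Mdl Pol Φ) (τ K : ℕ) (φs : Φ)
    (R : Run Ω Mdl Pol Obs Φ) (ω : Ω) : ℝ :=
  ∑ k ∈ Finset.range K, ∑ t ∈ epoch τ k,
    (P.V (R.model t ω) (I.policy φs) - P.V (R.model t ω) (R.policy k ω))

end Run

end DigDec

end

/-! Fix a round and let `x` be the world consisting of `M_t` and the policy of `φs`. Mixing `x` into
a prior `ν` with weight `s` mixes, by Bayes' rule, the point mass at `φs` into every posterior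
(`posterior_mixWorld`). The compensation identity for relative entropy (`kl_mix`), integrated over
the observation, turns this into an exact expansion of the divergence along `(1 - s) ν + s δ_x`
(`divergence_mixWorld`): it is affine in `s`, minus `s` times the expected log loss of the mixed
posterior at `φs` (`surprise`), minus a remainder (`posteriorGap`) which is `o(s)` when the log loss
under `ν` is finite.

Two things follow. The Bregman divergence in Est equals the expected log loss of the posterior
(`bregman_divergence`), so a round contributes `-log ρ_k(φs)`, plus the average error under `ρ_k`,
minus that log loss. And since `ν_k` maximizes AIR, the first-order condition in the direction of
`δ_x` (`IsMinimaxSolution.surprise_le`) bounds the value gap at `x`, minus `1/η` times this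
contribution, by `AIR(p_k, ν_k; ρ_k)`, hence by dig-dec. Summation over the rounds gives the regret
bound.

For the bound on Est, optimality of `ρ_{k+1}` is tested in the direction of the point mass at `φs`
(`mirrorDescent_step`): `(τ + 2β)(-log ρ_{k+1}(φs)) ≤ L_k(φs) + (4/β) L_k(φs)² + ∑_t -log ν_k(φs |
π_k, o_t) + 2β (-log ρ_k(φs)) - ⟨ρ_k, L_k⟩`. In expectation the posterior terms are the log losses
in Est. As `L_k` multiplies sample means over disjoint halves of the epoch, it is conditionally
unbiased for `τ` times a sum of squared means (`integral_mul_lossEst`), so `⟨ρ_k, L_k⟩` pays for the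
average errors. At `φs` all means vanish: `L_k(φs)` has mean zero, and orthogonality of martingale
differences gives second moment at most `4N²` (`integral_lossEst_sq_le`), independent of `τ`. An
epoch thus costs `τ + 2β` times a telescoping difference plus `16N²/β`
(`IsValidRun.sum_integral_roundEst_le`). The total, `(τ + 2β) log|Φ| + 16KN²/β`, has the claimed
order for `τ` of order `T^{1/3}` and `|Φ| ≥ 2`.

Log losses are unbounded, so integrability has to be carried along. The first-order condition bounds
the expected posterior loss of an epoch by `-log ρ_k(φs)` plus a constant, and the mirror-descent
inequality then bounds `-log ρ_{k+1}(φs)` by an integrable function (`IsValidRun.hasFiniteLoss`). -/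

noncomputable section

namespace DigDec

/-! ### Relative entropy on a finite set -/

section RelativeEntropy

/-- `-log x` as an extended nonnegative number, `⊤` for `x ≤ 0`. -/
def negLog (x : ℝ) : ℝ≥0∞ := if x ≤ 0 then ⊤ else ENNReal.ofReal (-Real.log x)

lemma negLog_of_pos {x : ℝ} (hx : 0 < x) : negLog x = ENNReal.ofReal (-Real.log x) := by
  simp [negLog, not_le.2 hx]

lemma negLog_of_nonpos {x : ℝ} (hx : x ≤ 0) : negLog x = ⊤ := by simp [negLog, hx]

lemma negLog_lt_top_iff {x : ℝ} : negLog x < ⊤ ↔ 0 < x := by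
  rcases le_or_gt x 0 with h | h
  · simp [negLog_of_nonpos h, h]
  · simp [negLog_of_pos h, h]

lemma antitone_negLog : Antitone negLog := by
  intro x y hxy
  rcases le_or_gt x 0 with h | h
  · simp [negLog_of_nonpos h]
  · rw [negLog_of_pos h, negLog_of_pos (h.trans_le hxy)]
    exact ENNReal.ofReal_le_ofReal (neg_le_neg (Real.log_le_log h hxy))

lemma toReal_negLog {x : ℝ} (h0 : 0 < x) (h1 : x ≤ 1) : (negLog x).toReal = -Real.log x := by
  rw [negLog_of_pos h0, ENNReal.toReal_ofReal]
  have := Real.log_nonpos h0.le h1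
  linarith

/-- The value `⊤` on `x ≤ 0` is the limit of `-log x` as `x` decreases to `0`. Continuity everywhere
allows limits of log losses to be taken without knowing that the limiting posterior is positive. -/
lemma continuous_negLog : Continuous negLog := by
  rw [continuous_iff_continuousAt]
  intro x
  rcases lt_trichotomy x 0 with h | h | h
  · have : negLog =ᶠ[nhds x] fun _ => ⊤ := by
      filter_upwards [gt_mem_nhds h] with y hy using negLog_of_nonpos hy.le
    exact (continuousAt_congr this).2 continuousAt_const
  · subst h
    rw [ContinuousAt, negLog_of_nonpos le_rfl, ENNReal.tendsto_nhds_top_iff_nnreal]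
    intro r
    have : Set.Iio (Real.exp (-(r + 1))) ∈ nhds (0 : ℝ) := Iio_mem_nhds (Real.exp_pos _)
    filter_upwards [this] with y hy
    rcases le_or_gt y 0 with h | h
    · simp [negLog_of_nonpos h]
    · rw [negLog_of_pos h, ← ENNReal.ofReal_coe_nnreal]
      have h1 : Real.log y < -(r + 1) := (Real.log_lt_iff_lt_exp h).2 hy
      have h2 := r.2
      exact (ENNReal.ofReal_lt_ofReal_iff (by have := r.coe_nonneg; linarith)).2 (by linarith)
  · have : negLog =ᶠ[nhds x] fun y => ENNReal.ofReal (-Real.log y) := by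
      filter_upwards [lt_mem_nhds h] with y hy using negLog_of_pos hy
    refine (continuousAt_congr this).2 ?_
    exact ENNReal.continuous_ofReal.continuousAt.comp (Real.continuousAt_log h.ne').neg

lemma measurable_negLog : Measurable negLog := continuous_negLog.measurable

variable {Φ : Type*}

/-- The mixture `(1 - t) a + t δ_φs`. -/
def mix (φs : Φ) (t : ℝ) (a : Φ → ℝ) (φ : Φ) : ℝ :=
  open Classical in (1 - t) * a φ + if φ = φs then t else 0

lemma mix_self (φs : Φ) (t : ℝ) (a : Φ → ℝ) : mix φs t a φs = (1 - t) * a φs + t := by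
  simp [mix]

lemma mix_eq_zero_iff {φs : Φ} {t : ℝ} {a : Φ → ℝ} (ha : ∀ φ, 0 ≤ a φ) (h0 : 0 ≤ t) (h1 : t < 1)
    {φ : Φ} : mix φs t a φ = 0 ↔ a φ = 0 ∧ (φ = φs → t = 0) := by
  classical
  have h2 : 0 ≤ (1 - t) * a φ := mul_nonneg (by linarith) (ha φ)
  have h3 : (1 - t) * a φ = 0 ↔ a φ = 0 := by
    rw [mul_eq_zero]
    exact ⟨fun h => h.resolve_left (by linarith), Or.inr⟩
  unfold mix
  split_ifs with h
  · rw [add_eq_zero_iff_of_nonneg h2 h0, h3]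
    simp [h]
  · simp [h3, h]

/-- The point mass at `φs`. -/
def pointMass (φs : Φ) : Φ → ℝ := open Classical in fun φ => if φ = φs then 1 else 0

lemma pointMass_self (φs : Φ) : pointMass φs φs = 1 := by simp [pointMass]

variable [Fintype Φ]

lemma sum_pointMass_mul (φs : Φ) (f : Φ → ℝ) : ∑ φ, pointMass φs φ * f φ = f φs := by
  classical
  simp [pointMass]

lemma pointMass_mem (φs : Φ) : pointMass φs ∈ stdSimplex ℝ Φ := by
  classical
  exact ⟨fun φ => by unfold pointMass; split_ifs <;> norm_num, by simp [pointMass]⟩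

lemma mix_mem {φs : Φ} {t : ℝ} {a : Φ → ℝ} (ha : a ∈ stdSimplex ℝ Φ) (h0 : 0 ≤ t) (h1 : t ≤ 1) :
    mix φs t a ∈ stdSimplex ℝ Φ := by
  classical
  refine ⟨fun φ => ?_, ?_⟩
  · have := ha.1 φ
    have : 0 ≤ (1 - t) * a φ := mul_nonneg (by linarith) this
    unfold mix; split_ifs <;> linarith
  · simp [mix, Finset.sum_add_distrib, ← Finset.mul_sum, ha.2]

lemma le_one_of_mem_stdSimplex {a : Φ → ℝ} (ha : a ∈ stdSimplex ℝ Φ) (φ : Φ) : a φ ≤ 1 :=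
  ha.2 ▸ Finset.single_le_sum (f := a) (fun i _ => ha.1 i) (Finset.mem_univ φ)

/-- The finite sum in the relative entropy. -/
def klSum (a b : Φ → ℝ) : ℝ := ∑ φ, a φ * Real.log (a φ / b φ)

lemma sub_le_mul_log_div {x y : ℝ} (hx : 0 ≤ x) (hy : 0 ≤ y) (h : y = 0 → x = 0) :
    x - y ≤ x * Real.log (x / y) := by
  rcases hx.eq_or_lt with rfl | hx
  · simpa using hy
  have hy : 0 < y := lt_of_le_of_ne hy fun h' => hx.ne' (h h'.symm)
  have h1 := Real.one_sub_inv_le_log_of_pos (div_pos hx hy)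
  have h2 : x * (1 - (x / y)⁻¹) = x - y := by field_simp
  nlinarith

/-- Gibbs' inequality without normalization. The general form is needed in `stability`, where the
reference vector is an exponentially tilted, unnormalized distribution. -/
lemma sum_sub_sum_le_klSum {a b : Φ → ℝ} (ha : ∀ φ, 0 ≤ a φ) (hb : ∀ φ, 0 ≤ b φ)
    (hab : ∀ φ, b φ = 0 → a φ = 0) : ∑ φ, a φ - ∑ φ, b φ ≤ klSum a b := by
  rw [← Finset.sum_sub_distrib]
  exact Finset.sum_le_sum fun φ _ => sub_le_mul_log_div (ha φ) (hb φ) (hab φ)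

lemma klSum_nonneg {a b : Φ → ℝ} (ha : a ∈ stdSimplex ℝ Φ) (hb : b ∈ stdSimplex ℝ Φ)
    (hab : ∀ φ, b φ = 0 → a φ = 0) : 0 ≤ klSum a b := by
  have := sum_sub_sum_le_klSum ha.1 hb.1 hab
  rwa [ha.2, hb.2, sub_self] at this

lemma kl_eq_ofReal {a b : Φ → ℝ} (hab : ∀ φ, b φ = 0 → a φ = 0) :
    kl a b = ENNReal.ofReal (klSum a b) := by
  rw [kl, if_pos hab, klSum]

lemma kl_eq_top {a b : Φ → ℝ} (hab : ¬ ∀ φ, b φ = 0 → a φ = 0) : kl a b = ⊤ := by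
  rw [kl, if_neg hab]

lemma kl_ne_top_iff {a b : Φ → ℝ} : kl a b ≠ ⊤ ↔ ∀ φ, b φ = 0 → a φ = 0 := by
  by_cases h : ∀ φ, b φ = 0 → a φ = 0
  · simp only [kl_eq_ofReal h, ne_eq, ENNReal.ofReal_ne_top, not_false_eq_true, true_iff]
    exact h
  · simp only [kl_eq_top h, ne_eq, not_true_eq_false, false_iff]
    exact h

lemma toReal_kl {a b : Φ → ℝ} (ha : a ∈ stdSimplex ℝ Φ) (hb : b ∈ stdSimplex ℝ Φ)
    (hab : ∀ φ, b φ = 0 → a φ = 0) : (kl a b).toReal = klSum a b := by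
  rw [kl_eq_ofReal hab, ENNReal.toReal_ofReal (klSum_nonneg ha hb hab)]

lemma klSum_pointMass (φs : Φ) (b : Φ → ℝ) : klSum (pointMass φs) b = -Real.log (b φs) := by
  rw [klSum, sum_pointMass_mul, pointMass_self, one_div, Real.log_inv]

lemma kl_pointMass {φs : Φ} {b : Φ → ℝ} (hb : 0 ≤ b φs) :
    kl (pointMass φs) b = negLog (b φs) := by
  rcases hb.eq_or_lt with h | h
  · rw [negLog_of_nonpos h.symm.le, kl_eq_top]
    intro h'
    have := h' φs h.symm
    rw [pointMass_self] at this
    exact one_ne_zero this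
  · rw [negLog_of_pos h, kl_eq_ofReal, klSum_pointMass]
    intro φ hφ
    unfold pointMass
    rw [if_neg]
    rintro rfl
    exact h.ne' hφ

lemma measurable_kl : Measurable fun x : (Φ → ℝ) × (Φ → ℝ) => kl x.1 x.2 := by
  unfold kl
  refine Measurable.ite ?_ ?_ measurable_const
  · have : {x : (Φ → ℝ) × (Φ → ℝ) | ∀ φ, x.2 φ = 0 → x.1 φ = 0} =
        ⋂ φ, ({x | x.2 φ = 0}ᶜ ∪ {x | x.1 φ = 0}) := by
      ext x
      simp [imp_iff_not_or]
    rw [this]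
    refine MeasurableSet.iInter fun φ => MeasurableSet.union (MeasurableSet.compl ?_) ?_
    · exact (measurableSet_singleton (0 : ℝ)).preimage (by fun_prop)
    · exact (measurableSet_singleton (0 : ℝ)).preimage (by fun_prop)
  · fun_prop

/-- Compensation identity: the average entropy of `a` and `δ_φs` relative to `b` is the entropy of
their mixture relative to `b` plus the average entropy relative to the mixture. It holds coordinate
by coordinate, because the logarithms of the mixture cancel. -/
lemma klSum_mix {φs : Φ} {t : ℝ} {a b : Φ → ℝ} (ha : ∀ φ, 0 ≤ a φ) (hb : ∀ φ, 0 ≤ b φ)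
    (hab : ∀ φ, b φ = 0 → a φ = 0) (hbs : 0 < b φs) (h0 : 0 ≤ t) (h1 : t < 1) :
    klSum (mix φs t a) b + t * -Real.log (mix φs t a φs) + (1 - t) * klSum a (mix φs t a) =
      (1 - t) * klSum a b + t * -Real.log (b φs) := by
  classical
  have e1 : ∀ f : Φ → ℝ, t * f φs = ∑ φ, (if φ = φs then t else 0) * f φ := fun f => by simp
  rw [e1 fun φ => -Real.log (mix φs t a φ), e1 fun φ => -Real.log (b φ)]
  simp only [klSum, Finset.mul_sum, ← Finset.sum_add_distrib]
  refine Finset.sum_congr rfl fun φ _ => ?_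
  have hg : mix φs t a φ = (1 - t) * a φ + if φ = φs then t else 0 := rfl
  have ht : 0 ≤ if φ = φs then t else 0 := by split_ifs <;> simp [h0]
  have hbp : (if φ = φs then t else 0) ≠ 0 → 0 < b φ := by
    intro h
    by_cases e : φ = φs
    · rwa [e]
    · simp [e] at h
  generalize (if φ = φs then t else 0) = u at *
  generalize mix φs t a φ = g at *
  rcases (ha φ).eq_or_lt with h | h
  · rw [← h] at hg ⊢
    rw [mul_zero, zero_add] at hg
    subst hg
    by_cases hg : g = 0
    · simp [hg]
    · rw [Real.log_div hg (hbp hg).ne']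
      ring
  · have hbp : 0 < b φ := lt_of_le_of_ne (hb φ) fun h' => h.ne' (hab φ h'.symm)
    have hgp : 0 < g := by
      have : 0 < (1 - t) * a φ := mul_pos (by linarith) h
      linarith
    rw [Real.log_div hgp.ne' hbp.ne', Real.log_div h.ne' hgp.ne', Real.log_div h.ne' hbp.ne', hg]
    ring

/-- Without absolute continuity of `a` both sides are `⊤`, as `t < 1` keeps the support of `a` in
the mixture. All terms being nonnegative, the identity can later be integrated with no integrability
conditions, and terms can be dropped. -/
lemma kl_mix {φs : Φ} {t : ℝ} {a b : Φ → ℝ} (ha : a ∈ stdSimplex ℝ Φ) (hb : b ∈ stdSimplex ℝ Φ)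
    (hbs : 0 < b φs) (h0 : 0 ≤ t) (h1 : t < 1) :
    kl (mix φs t a) b + ENNReal.ofReal t * negLog (mix φs t a φs) +
        ENNReal.ofReal (1 - t) * kl a (mix φs t a) =
      ENNReal.ofReal (1 - t) * kl a b + ENNReal.ofReal t * negLog (b φs) := by
  have hm := mix_mem (φs := φs) ha h0 h1.le
  have ham : ∀ φ, mix φs t a φ = 0 → a φ = 0 := fun φ h => ((mix_eq_zero_iff ha.1 h0 h1).1 h).1
  have h1t : ENNReal.ofReal (1 - t) ≠ 0 := by simpa using h1
  by_cases hab : ∀ φ, b φ = 0 → a φ = 0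
  · have hmb : ∀ φ, b φ = 0 → mix φs t a φ = 0 := by
      intro φ h
      refine (mix_eq_zero_iff ha.1 h0 h1).2 ⟨hab φ h, ?_⟩
      rintro rfl
      exact absurd h hbs.ne'
    have e1 : ENNReal.ofReal t * negLog (mix φs t a φs) =
        ENNReal.ofReal (t * -Real.log (mix φs t a φs)) := by
      rcases h0.eq_or_lt with rfl | h0'
      · simp
      · rw [ENNReal.ofReal_mul h0, negLog_of_pos]
        rw [mix_self]
        have := mul_nonneg (by linarith : 0 ≤ 1 - t) (ha.1 φs)
        linarith
    have hl1 : 0 ≤ t * -Real.log (mix φs t a φs) :=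
      mul_nonneg h0 (neg_nonneg.2 (Real.log_nonpos (hm.1 _) (le_one_of_mem_stdSimplex hm _)))
    have hl2 : 0 ≤ t * -Real.log (b φs) :=
      mul_nonneg h0 (neg_nonneg.2 (Real.log_nonpos (hb.1 _) (le_one_of_mem_stdSimplex hb _)))
    have h1t' : 0 ≤ 1 - t := by linarith
    have k1 := klSum_nonneg hm hb hmb
    have k2 := mul_nonneg h1t' (klSum_nonneg ha hm ham)
    have k3 := mul_nonneg h1t' (klSum_nonneg ha hb hab)
    rw [e1, negLog_of_pos hbs, kl_eq_ofReal hmb, kl_eq_ofReal ham, kl_eq_ofReal hab,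
      ← ENNReal.ofReal_mul h1t', ← ENNReal.ofReal_mul h1t', ← ENNReal.ofReal_mul h0,
      ← ENNReal.ofReal_add k1 hl1, ← ENNReal.ofReal_add (add_nonneg k1 hl1) k2,
      ← ENNReal.ofReal_add k3 hl2, klSum_mix ha.1 hb.1 hab hbs h0 h1]
  · have hmb : ¬ ∀ φ, b φ = 0 → mix φs t a φ = 0 := fun h =>
      hab fun φ hφ => ham φ (h φ hφ)
    rw [kl_eq_top hab, kl_eq_top hmb, ENNReal.mul_top h1t, top_add, top_add, top_add]

/-- Away from `φs` the mixture is `(1 - t) a`, so the entropy is `-log (1 - t)` plus one correction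
at `φs`. The elementary bounds for the logarithm finish. -/
lemma klSum_mix_right_le {φs : Φ} {t : ℝ} {a : Φ → ℝ} (ha : a ∈ stdSimplex ℝ Φ)
    (h0 : 0 ≤ t) (h1 : t < 1) :
    klSum a (mix φs t a) ≤ t / (1 - t) * (1 - (1 - t) * a φs / mix φs t a φs) := by
  classical
  have h1t : 0 < 1 - t := by linarith
  have e : ∀ φ, a φ * Real.log (a φ / mix φs t a φ) =
      a φ * -Real.log (1 - t) +
        if φ = φs then a φs * Real.log ((1 - t) * a φs / mix φs t a φs) else 0 := by
    intro φ
    rcases (ha.1 φ).eq_or_lt with h | h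
    · split_ifs with h'
      · subst h'; simp [← h]
      · simp [← h]
    · have hm : 0 < mix φs t a φ := by
        refine lt_of_le_of_ne ((mix_mem ha h0 h1.le).1 φ) fun h' => ?_
        exact h.ne' ((mix_eq_zero_iff ha.1 h0 h1).1 h'.symm).1
      split_ifs with h'
      · subst h'
        rw [mul_div_assoc, Real.log_mul h1t.ne' (div_pos h hm).ne']
        ring
      · have : mix φs t a φ = (1 - t) * a φ := by simp [mix, h']
        rw [this, ← div_div, div_right_comm, div_self h.ne', one_div, Real.log_inv, add_zero]
  have e2 : klSum a (mix φs t a) =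
      -Real.log (1 - t) + a φs * Real.log ((1 - t) * a φs / mix φs t a φs) := by
    simp only [klSum, e, Finset.sum_add_distrib, ← Finset.sum_mul, ha.2, Finset.sum_ite_eq',
      Finset.mem_univ, if_true, one_mul]
  rw [e2]
  have l1 : -Real.log (1 - t) ≤ t / (1 - t) := by
    have := Real.one_sub_inv_le_log_of_pos h1t
    have h : 1 - (1 - t)⁻¹ = -(t / (1 - t)) := by field_simp; ring
    linarith
  rcases (ha.1 φs).eq_or_lt with h | h
  · simp [← h, l1]
  have hg : mix φs t a φs = (1 - t) * a φs + t := mix_self _ _ _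
  set g := mix φs t a φs
  have hgp : 0 < g := by rw [hg]; positivity
  have l2 := Real.log_le_sub_one_of_pos (show 0 < (1 - t) * a φs / g by positivity)
  have l3 := mul_le_mul_of_nonneg_left l2 h.le
  have l4 : a φs * ((1 - t) * a φs / g - 1) = -(t / (1 - t)) * ((1 - t) * a φs / g) := by
    field_simp
    rw [hg]; ring
  have : t / (1 - t) * (1 - (1 - t) * a φs / g) =
    t / (1 - t) + -(t / (1 - t)) * ((1 - t) * a φs / g) := by ring
  rw [this]
  linarith

/-- Second order in `t` as long as `a φs > 0`; in addition the last factor never exceeds `1`, which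
provides domination when `t` depends on the observation. -/
lemma klSum_mix_right_le' {φs : Φ} {t : ℝ} {a : Φ → ℝ} (ha : a ∈ stdSimplex ℝ Φ)
    (h0 : 0 ≤ t) (h1 : t < 1) :
    klSum a (mix φs t a) ≤ t / (1 - t) * (t / mix φs t a φs) := by
  refine (klSum_mix_right_le ha h0 h1).trans_eq ?_
  by_cases h : mix φs t a φs = 0
  · rw [((mix_eq_zero_iff ha.1 h0 h1).1 h).2 rfl]
    simp
  · rw [one_sub_div h, mix_self, add_sub_cancel_left]

end RelativeEntropy

/-! ### Densities and posteriors -/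

section Densities

variable {Mdl Pol Obs Φ : Type*} [MeasurableSpace Mdl] [MeasurableSpace Pol] [MeasurableSpace Obs]
  (P : DMSO Mdl Pol Obs) (I : InfoSets Mdl Pol Φ)

lemma DMSO.measurable_dens_obs (M : Mdl) (π : Pol) : Measurable (P.dens M π) :=
  P.measurable_dens.comp (f := fun o => ((M, π), o)) (by fun_prop)

lemma DMSO.measurable_dens_world (π : Pol) :
    Measurable fun x : (Mdl × Pol) × Obs => P.dens x.1.1 π x.2 :=
  P.measurable_dens.comp (f := fun x : (Mdl × Pol) × Obs => ((x.1.1, π), x.2)) (by fun_prop)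

lemma DMSO.measurable_dens_world' (π : Pol) (o : Obs) :
    Measurable fun x : Mdl × Pol => P.dens x.1 π o :=
  (P.measurable_dens_world π).comp (f := fun x : Mdl × Pol => (x, o)) (by fun_prop)

lemma DMSO.isProbabilityMeasure_law (M : Mdl) (π : Pol) : IsProbabilityMeasure (P.law M π) :=
  ⟨by rw [DMSO.law, withDensity_apply _ MeasurableSet.univ, Measure.restrict_univ,
    P.lintegral_dens]⟩

lemma DMSO.lintegral_law (M : Mdl) (π : Pol) {f : Obs → ℝ≥0∞} (hf : Measurable f) :
    ∫⁻ o, f o ∂(P.law M π) = ∫⁻ o, P.dens M π o * f o ∂P.ref := by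
  rw [DMSO.law, lintegral_withDensity_eq_lintegral_mul _ (P.measurable_dens_obs M π) hf]
  rfl

lemma DMSO.ae_law_iff (M : Mdl) (π : Pol) {p : Obs → Prop} :
    (∀ᵐ o ∂(P.law M π), p o) ↔ ∀ᵐ o ∂P.ref, P.dens M π o ≠ 0 → p o := by
  rw [DMSO.law, ae_withDensity_iff (P.measurable_dens_obs M π)]

lemma DMSO.ae_dens_ne_top (M : Mdl) (π : Pol) : ∀ᵐ o ∂P.ref, P.dens M π o ≠ ⊤ := by
  refine (ae_lt_top (P.measurable_dens_obs M π) ?_).mono fun o h => h.ne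
  rw [P.lintegral_dens]; exact ENNReal.one_ne_top

/-- The joint density of the information set `φ` and the observation `o`. -/
def jointDensity (ν : Measure (Mdl × Pol)) (π : Pol) (φ : Φ) (o : Obs) : ℝ≥0∞ :=
  ∫⁻ x in I.set φ, P.dens x.1 π o ∂ν

lemma posterior_eq (ν : Measure (Mdl × Pol)) (π : Pol) (o : Obs) (φ : Φ) :
    posterior P I ν π o φ = (jointDensity P I ν π φ o / P.evidence ν π o).toReal := rfl

lemma posterior_nonneg (ν : Measure (Mdl × Pol)) (π : Pol) (o : Obs) (φ : Φ) :
    0 ≤ posterior P I ν π o φ := ENNReal.toReal_nonneg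

lemma DMSO.measurable_evidence (ν : Measure (Mdl × Pol)) [SFinite ν] (π : Pol) :
    Measurable (P.evidence ν π) :=
  (P.measurable_dens_world π).lintegral_prod_left'

lemma measurable_jointDensity (ν : Measure (Mdl × Pol)) [SFinite ν] (π : Pol) (φ : Φ) :
    Measurable (jointDensity P I ν π φ) :=
  (P.measurable_dens_world π).lintegral_prod_left'

lemma measurable_posterior (ν : Measure (Mdl × Pol)) [SFinite ν] (π : Pol) :
    Measurable (posterior P I ν π) :=
  measurable_pi_lambda _ fun φ =>
    ((measurable_jointDensity P I ν π φ).div (P.measurable_evidence ν π)).ennreal_toReal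

/-- Tonelli. Rewriting expectations over world and observation as integrals against the reference
measure puts all terms of the entropy identity under one integral. -/
lemma DMSO.lintegral_lintegral_law (ν : Measure (Mdl × Pol)) [SFinite ν] (π : Pol)
    {f : Obs → ℝ≥0∞} (hf : Measurable f) :
    ∫⁻ x, ∫⁻ o, f o ∂(P.law x.1 π) ∂ν = ∫⁻ o, P.evidence ν π o * f o ∂P.ref := by
  have := P.sigmaFinite_ref
  simp_rw [P.lintegral_law _ _ hf]
  rw [lintegral_lintegral_swap]
  · refine lintegral_congr fun o => ?_
    rw [lintegral_mul_const _ (P.measurable_dens_world' π o)]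
    rfl
  · exact ((P.measurable_dens_world π).mul (hf.comp measurable_snd)).aemeasurable

lemma DMSO.ae_evidence_ne_top (ν : Measure (Mdl × Pol)) [IsProbabilityMeasure ν] (π : Pol) :
    ∀ᵐ o ∂P.ref, P.evidence ν π o ≠ ⊤ := by
  refine (ae_lt_top (P.measurable_evidence ν π) ?_).mono fun o h => h.ne
  have h := P.lintegral_lintegral_law ν π (f := fun _ => 1) measurable_const
  simp only [mul_one] at h
  rw [← h]
  have h2 : ∀ x : Mdl × Pol, ∫⁻ _, 1 ∂(P.law x.1 π) = 1 := fun x => by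
    have := P.isProbabilityMeasure_law x.1 π
    simp
  simp [h2]

-- Here it matters that `ν` is carried by the disjoint union of the information sets: this makes
-- posteriors sum to one.
variable {I} in
lemma sum_jointDensity [Fintype Φ] {ν : Measure (Mdl × Pol)} (hν : ν ∈ I.worlds) (π : Pol)
    (o : Obs) : ∑ φ, jointDensity P I ν π φ o = P.evidence ν π o := by
  have h1 : ν.restrict I.union = ν :=
    Measure.restrict_eq_self_of_ae_mem (by rw [ae_iff]; exact hν.2)
  rw [DMSO.evidence, ← h1, InfoSets.union, lintegral_iUnion I.measurableSet_set I.disjoint,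
    tsum_fintype]
  simp only [jointDensity]
  rw [← InfoSets.union, h1]

variable {I} in
lemma jointDensity_le [Fintype Φ] {ν : Measure (Mdl × Pol)} (π : Pol)
    (o : Obs) (φ : Φ) : jointDensity P I ν π φ o ≤ P.evidence ν π o :=
  lintegral_mono' Measure.restrict_le_self le_rfl

variable {P I} in
lemma posterior_mem [Fintype Φ] {ν : Measure (Mdl × Pol)} (hν : ν ∈ I.worlds) {π : Pol}
    {o : Obs} (h0 : P.evidence ν π o ≠ 0) (h1 : P.evidence ν π o ≠ ⊤) :
    posterior P I ν π o ∈ stdSimplex ℝ Φ := by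
  refine ⟨posterior_nonneg P I ν π o, ?_⟩
  simp only [posterior_eq]
  rw [← ENNReal.toReal_sum fun φ _ =>
    (ENNReal.div_lt_top ((jointDensity_le P π o φ).trans_lt h1.lt_top).ne h0).ne]
  simp_rw [div_eq_mul_inv]
  rw [← Finset.sum_mul, sum_jointDensity P hν, ENNReal.mul_inv_cancel h0 h1, ENNReal.toReal_one]

variable {P I} in
lemma evidence_of_posterior_pos {ν : Measure (Mdl × Pol)} {π : Pol} {o : Obs} {φ : Φ}
    [Fintype Φ] (h : 0 < posterior P I ν π o φ) :
    P.evidence ν π o ≠ 0 ∧ P.evidence ν π o ≠ ⊤ := by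
  constructor <;> intro h'
  · have h2 := jointDensity_le (I := I) P (ν := ν) π o φ
    rw [h', nonpos_iff_eq_zero] at h2
    rw [posterior_eq, h', h2] at h
    simp at h
  · rw [posterior_eq, h'] at h
    simp at h

/-- The expected relative entropy between the posterior and `ρ`. -/
def infoGain [Fintype Φ] (π : Pol) (ν : Measure (Mdl × Pol)) (ρ : Φ → ℝ) : ℝ≥0∞ :=
  ∫⁻ o, P.evidence ν π o * kl (posterior P I ν π o) ρ ∂P.ref

/-- The expected `ρ`-average of `Dbar`. -/
def expectedError [Fintype Φ] (Dbar : Pol → Φ → Mdl → ℝ) (π : Pol) (ν : Measure (Mdl × Pol))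
    (ρ : Φ → ℝ) : ℝ≥0∞ :=
  ∫⁻ x, ENNReal.ofReal (∑ φ, ρ φ * Dbar π φ x.1) ∂ν

lemma divergence_eq [Fintype Φ] (Dbar : Pol → Φ → Mdl → ℝ) (hD : ∀ π φ, Measurable (Dbar π φ))
    (π : Pol) (ν : Measure (Mdl × Pol)) [SFinite ν] (ρ : Φ → ℝ) :
    divergence P I Dbar π ν ρ = infoGain P I π ν ρ + expectedError Dbar π ν ρ := by
  have hk : Measurable fun o => kl (posterior P I ν π o) ρ :=
    measurable_kl.comp ((measurable_posterior P I ν π).prodMk measurable_const)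
  have hm : Measurable fun x : Mdl × Pol => ENNReal.ofReal (∑ φ, ρ φ * Dbar π φ x.1) := by
    have : ∀ φ, Measurable fun x : Mdl × Pol => Dbar π φ x.1 := fun φ =>
      (hD π φ).comp measurable_fst
    exact (Finset.measurable_sum _ fun φ _ => (this φ).const_mul _).ennreal_ofReal
  have e : ∀ x : Mdl × Pol, ∫⁻ o, (kl (posterior P I ν π o) ρ +
      ENNReal.ofReal (∑ φ, ρ φ * Dbar π φ x.1)) ∂(P.law x.1 π) =
      ∫⁻ o, kl (posterior P I ν π o) ρ ∂(P.law x.1 π) +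
        ENNReal.ofReal (∑ φ, ρ φ * Dbar π φ x.1) := fun x => by
    have := P.isProbabilityMeasure_law x.1 π
    rw [lintegral_add_right _ measurable_const]
    simp
  rw [divergence]
  simp_rw [e]
  rw [lintegral_add_right _ hm, P.lintegral_lintegral_law ν π hk]
  rfl

end Densities

/-! ### Mixing a point mass into the world distribution -/

section Mixture

variable {Mdl Pol Obs Φ : Type*} [MeasurableSpace Mdl] [MeasurableSpace Pol] [MeasurableSpace Obs]
  {P : DMSO Mdl Pol Obs} {I : InfoSets Mdl Pol Φ}

/-- The mixture `(1 - s) ν + s δ_x`. -/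
def mixWorld (ν : Measure (Mdl × Pol)) (x : Mdl × Pol) (s : ℝ) : Measure (Mdl × Pol) :=
  ENNReal.ofReal (1 - s) • ν + ENNReal.ofReal s • Measure.dirac x

lemma mixWorld_zero (ν : Measure (Mdl × Pol)) (x : Mdl × Pol) : mixWorld ν x 0 = ν := by
  simp [mixWorld]

lemma dirac_mem_worlds {x : Mdl × Pol} {φ : Φ} (hx : x ∈ I.set φ) [Countable Φ] :
    Measure.dirac x ∈ I.worlds := by
  refine ⟨inferInstance, ?_⟩
  rw [InfoSets.union, Measure.dirac_apply' _ (MeasurableSet.iUnion I.measurableSet_set).compl]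
  refine Set.indicator_of_notMem ?_ _
  rw [Set.notMem_compl_iff]
  exact Set.mem_iUnion.2 ⟨φ, hx⟩

lemma mixWorld_mem {ν : Measure (Mdl × Pol)} (hν : ν ∈ I.worlds) {x : Mdl × Pol} {φ : Φ}
    [Fintype Φ] (hx : x ∈ I.set φ) {s : ℝ} (h0 : 0 ≤ s) (h1 : s ≤ 1) :
    mixWorld ν x s ∈ I.worlds := by
  have := hν.1
  refine ⟨⟨?_⟩, ?_⟩
  · simp only [mixWorld, Measure.coe_add, Measure.coe_smul, Pi.add_apply, Pi.smul_apply,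
      measure_univ, smul_eq_mul, mul_one]
    rw [← ENNReal.ofReal_add (by linarith) h0]
    simp
  · simp only [mixWorld, Measure.coe_add, Measure.coe_smul, Pi.add_apply, Pi.smul_apply, hν.2,
      (dirac_mem_worlds hx).2, smul_zero, add_zero]

lemma lintegral_mixWorld (ν : Measure (Mdl × Pol)) (x : Mdl × Pol) (s : ℝ)
    {f : Mdl × Pol → ℝ≥0∞} (hf : Measurable f) :
    ∫⁻ y, f y ∂(mixWorld ν x s) =
      ENNReal.ofReal (1 - s) * ∫⁻ y, f y ∂ν + ENNReal.ofReal s * f x := by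
  rw [mixWorld, lintegral_add_measure, lintegral_smul_measure, lintegral_smul_measure,
    lintegral_dirac' _ hf]
  rfl

lemma evidence_mixWorld (ν : Measure (Mdl × Pol)) (x : Mdl × Pol) (s : ℝ) (π : Pol) (o : Obs) :
    P.evidence (mixWorld ν x s) π o =
      ENNReal.ofReal (1 - s) * P.evidence ν π o + ENNReal.ofReal s * P.dens x.1 π o :=
  lintegral_mixWorld ν x s (P.measurable_dens_world' π o)

lemma jointDensity_eq_indicator (ν : Measure (Mdl × Pol)) (π : Pol) (φ : Φ) (o : Obs) :
    jointDensity P I ν π φ o = ∫⁻ x, (I.set φ).indicator (fun x => P.dens x.1 π o) x ∂ν :=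
  (lintegral_indicator (I.measurableSet_set φ) _).symm

lemma jointDensity_mixWorld (ν : Measure (Mdl × Pol)) {x : Mdl × Pol} {φs : Φ}
    (hx : x ∈ I.set φs) (s : ℝ) (π : Pol) (φ : Φ) (o : Obs) :
    jointDensity P I (mixWorld ν x s) π φ o =
      ENNReal.ofReal (1 - s) * jointDensity P I ν π φ o +
        open Classical in if φ = φs then ENNReal.ofReal s * P.dens x.1 π o else 0 := by
  rw [jointDensity_eq_indicator, jointDensity_eq_indicator,
    lintegral_mixWorld _ _ _ ((P.measurable_dens_world' π o).indicator (I.measurableSet_set φ))]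
  congr 1
  split_ifs with h
  · subst h
    rw [Set.indicator_of_mem hx]
  · rw [Set.indicator_of_notMem, mul_zero]
    exact fun h' => Set.disjoint_left.1 (I.disjoint h) h' hx

/-- The posterior probability that the world is the point mass that has been mixed in. -/
def mixRatio (m q : ℝ≥0∞) (s : ℝ) : ℝ := s * q.toReal / ((1 - s) * m.toReal + s * q.toReal)

section Ratio

variable {m q : ℝ≥0∞} {s : ℝ}

lemma mixRatio_denom_pos (h0 : m ≠ 0) (h1 : m ≠ ⊤) (hs0 : 0 ≤ s) (hs1 : s < 1) :
    0 < (1 - s) * m.toReal + s * q.toReal := by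
  have : 0 < (1 - s) * m.toReal := mul_pos (by linarith) (ENNReal.toReal_pos h0 h1)
  have : 0 ≤ s * q.toReal := by positivity
  linarith

lemma mixRatio_nonneg (hs0 : 0 ≤ s) (hs1 : s < 1) : 0 ≤ mixRatio m q s := by
  have : 0 ≤ 1 - s := by linarith
  unfold mixRatio; positivity

lemma one_sub_mixRatio (h0 : m ≠ 0) (h1 : m ≠ ⊤) (hs0 : 0 ≤ s) (hs1 : s < 1) :
    1 - mixRatio m q s = (1 - s) * m.toReal / ((1 - s) * m.toReal + s * q.toReal) := by
  have := (mixRatio_denom_pos (q := q) h0 h1 hs0 hs1).ne'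
  unfold mixRatio; field_simp; ring

lemma mixRatio_lt_one (h0 : m ≠ 0) (h1 : m ≠ ⊤) (hs0 : 0 ≤ s) (hs1 : s < 1) :
    mixRatio m q s < 1 := by
  have h2 := one_sub_mixRatio (q := q) h0 h1 hs0 hs1
  have h3 := mixRatio_denom_pos (q := q) h0 h1 hs0 hs1
  have : 0 < (1 - s) * m.toReal := mul_pos (by linarith) (ENNReal.toReal_pos h0 h1)
  have : 0 < (1 - s) * m.toReal / ((1 - s) * m.toReal + s * q.toReal) := by positivity
  linarith

lemma add_mul_eq_ofReal (h1 : m ≠ ⊤) (hq : q ≠ ⊤) (hs0 : 0 ≤ s) (hs1 : s < 1) :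
    ENNReal.ofReal (1 - s) * m + ENNReal.ofReal s * q =
      ENNReal.ofReal ((1 - s) * m.toReal + s * q.toReal) := by
  have : 0 ≤ 1 - s := by linarith
  rw [ENNReal.ofReal_add (by positivity) (by positivity), ENNReal.ofReal_mul (by linarith),
    ENNReal.ofReal_mul hs0, ENNReal.ofReal_toReal h1, ENNReal.ofReal_toReal hq]

lemma mul_mixRatio (h0 : m ≠ 0) (h1 : m ≠ ⊤) (hq : q ≠ ⊤) (hs0 : 0 ≤ s) (hs1 : s < 1) :
    (ENNReal.ofReal (1 - s) * m + ENNReal.ofReal s * q) * ENNReal.ofReal (mixRatio m q s) =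
      ENNReal.ofReal s * q := by
  have h2 := mixRatio_denom_pos (q := q) h0 h1 hs0 hs1
  rw [add_mul_eq_ofReal h1 hq hs0 hs1, ← ENNReal.ofReal_mul h2.le, mixRatio,
    mul_div_cancel₀ _ h2.ne', ENNReal.ofReal_mul hs0, ENNReal.ofReal_toReal hq]

lemma mul_one_sub_mixRatio (h0 : m ≠ 0) (h1 : m ≠ ⊤) (hq : q ≠ ⊤) (hs0 : 0 ≤ s) (hs1 : s < 1) :
    (ENNReal.ofReal (1 - s) * m + ENNReal.ofReal s * q) * ENNReal.ofReal (1 - mixRatio m q s) =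
      ENNReal.ofReal (1 - s) * m := by
  have h2 := mixRatio_denom_pos (q := q) h0 h1 hs0 hs1
  rw [add_mul_eq_ofReal h1 hq hs0 hs1, ← ENNReal.ofReal_mul h2.le,
    one_sub_mixRatio h0 h1 hs0 hs1,
    mul_div_cancel₀ _ h2.ne', ENNReal.ofReal_mul (by linarith), ENNReal.ofReal_toReal h1]

end Ratio

/-- Bayes' rule is a projective map: a mixture of priors goes to a mixture of posteriors, with the
weight `s` replaced by the posterior weight of the new component. The posterior of the new component
is the point mass at `φs`. -/
lemma posterior_mixWorld {ν : Measure (Mdl × Pol)} {x : Mdl × Pol} {φs : Φ} [Fintype Φ]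
    (hx : x ∈ I.set φs) {s : ℝ} (hs0 : 0 ≤ s) (hs1 : s < 1) {π : Pol} {o : Obs}
    (h0 : P.evidence ν π o ≠ 0) (h1 : P.evidence ν π o ≠ ⊤) (hq : P.dens x.1 π o ≠ ⊤) :
    posterior P I (mixWorld ν x s) π o =
      mix φs (mixRatio (P.evidence ν π o) (P.dens x.1 π o) s) (posterior P I ν π o) := by
  classical
  ext φ
  have hd := mixRatio_denom_pos (q := P.dens x.1 π o) h0 h1 hs0 hs1
  have hj : jointDensity P I ν π φ o ≠ ⊤ := ((jointDensity_le P π o φ).trans_lt h1.lt_top).ne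
  have hm := (ENNReal.toReal_pos h0 h1).ne'
  unfold mix
  rw [one_sub_mixRatio h0 h1 hs0 hs1]
  simp only [mixRatio, posterior_eq, jointDensity_mixWorld ν hx, evidence_mixWorld,
    ENNReal.toReal_div]
  rw [add_mul_eq_ofReal h1 hq hs0 hs1, ENNReal.toReal_ofReal hd.le, ENNReal.toReal_add
    (ENNReal.mul_ne_top ENNReal.ofReal_ne_top hj)
    (by split_ifs; exacts [ENNReal.mul_ne_top ENNReal.ofReal_ne_top hq, ENNReal.zero_ne_top]),
    ENNReal.toReal_mul, ENNReal.toReal_ofReal (by linarith)]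
  split_ifs
  · rw [ENNReal.toReal_mul, ENNReal.toReal_ofReal hs0]
    field_simp
  · rw [ENNReal.toReal_zero]
    field_simp
    ring

end Mixture

/-! ### Expansion of the information gain when a world is mixed in -/

section BestResponse

variable {Mdl Pol Obs Φ : Type*} [MeasurableSpace Mdl] [MeasurableSpace Pol] [MeasurableSpace Obs]
  {P : DMSO Mdl Pol Obs} {I : InfoSets Mdl Pol Φ}

variable (P I) in
/-- The expected log loss of the posterior probability of `φs` under the model `M`. -/
def surprise (ν : Measure (Mdl × Pol)) (π : Pol) (M : Mdl) (φs : Φ) : ℝ≥0∞ :=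
  ∫⁻ o, negLog (posterior P I ν π o φs) ∂(P.law M π)

variable (P I) in
/-- The expected relative entropy between the posteriors before and after mixing in `x`. -/
def posteriorGap [Fintype Φ] (ν : Measure (Mdl × Pol)) (π : Pol) (x : Mdl × Pol) (s : ℝ) : ℝ≥0∞ :=
  ∫⁻ o, P.evidence ν π o * kl (posterior P I ν π o) (posterior P I (mixWorld ν x s) π o) ∂P.ref

lemma measurable_negLog_posterior (ν : Measure (Mdl × Pol)) [SFinite ν] (π : Pol) (φ : Φ) :
    Measurable fun o => negLog (posterior P I ν π o φ) :=
  measurable_negLog.comp ((measurable_pi_apply φ).comp (measurable_posterior P I ν π))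

variable {ν : Measure (Mdl × Pol)} {x : Mdl × Pol} {φs : Φ} {π : Pol} {ρ : Φ → ℝ} {s : ℝ}

lemma ae_law_regular (hν : ν ∈ I.worlds) (M : Mdl)
    (hev : ∀ᵐ o ∂(P.law M π), P.evidence ν π o ≠ 0) :
    ∀ᵐ o ∂(P.law M π), P.evidence ν π o ≠ 0 ∧ P.evidence ν π o ≠ ⊤ ∧
      P.dens M π o ≠ 0 ∧ P.dens M π o ≠ ⊤ := by
  have := hν.1
  rw [P.ae_law_iff] at hev ⊢
  filter_upwards [hev, P.ae_evidence_ne_top ν π, P.ae_dens_ne_top M π] with o h1 h2 h3 h4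
  exact ⟨h1 h4, h2, h4, h3⟩

lemma tendsto_mixRatio (m q : ℝ≥0∞) (hm : m ≠ 0) (h1 : m ≠ ⊤) :
    Filter.Tendsto (mixRatio m q) (nhdsWithin 0 (Set.Ioi 0)) (nhds 0) := by
  have hmp := (ENNReal.toReal_pos hm h1).ne'
  have : ContinuousAt (mixRatio m q) 0 := by
    unfold mixRatio
    refine ContinuousAt.div (by fun_prop) (by fun_prop) (by simpa using hmp)
  have h := this.tendsto
  rw [show mixRatio m q 0 = 0 by simp [mixRatio]] at h
  exact h.mono_left nhdsWithin_le_nhds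

lemma tendsto_mix_mixRatio (m q : ℝ≥0∞) (hm : m ≠ 0) (h1 : m ≠ ⊤) (a : Φ → ℝ) :
    Filter.Tendsto (fun s => mix φs (mixRatio m q s) a φs) (nhdsWithin 0 (Set.Ioi 0))
      (nhds (a φs)) := by
  simp only [mix_self]
  have := tendsto_mixRatio m q hm h1
  simpa using ((tendsto_const_nhds (x := (1 : ℝ)).sub this).mul_const (a φs)).add this

lemma eventually_mem_Ioo : ∀ᶠ s : ℝ in nhdsWithin 0 (Set.Ioi 0), s ∈ Set.Ioo (0 : ℝ) (1 / 2) :=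
  Ioo_mem_nhdsGT (by norm_num)

variable [Fintype Φ]

/-- This is `kl_mix` with weight `mixRatio`, multiplied by the evidence of the mixture; the products
of evidence and weights are `s` times the density of `x` and `1 - s` times the old evidence. Where
the old evidence vanishes, so does the density, and both sides are zero. -/
lemma infoGain_mixWorld_pointwise (hν : ν ∈ I.worlds) (hx : x ∈ I.set φs)
    (hρ : ρ ∈ stdSimplex ℝ Φ) (hρs : 0 < ρ φs) (hs0 : 0 ≤ s) (hs1 : s < 1) {o : Obs}
    (h0 : P.dens x.1 π o ≠ 0 → P.evidence ν π o ≠ 0) (h1 : P.evidence ν π o ≠ ⊤)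
    (hq : P.dens x.1 π o ≠ ⊤) :
    P.evidence (mixWorld ν x s) π o * kl (posterior P I (mixWorld ν x s) π o) ρ +
        ENNReal.ofReal s *
          (P.dens x.1 π o * negLog (posterior P I (mixWorld ν x s) π o φs)) +
        ENNReal.ofReal (1 - s) * (P.evidence ν π o *
          kl (posterior P I ν π o) (posterior P I (mixWorld ν x s) π o)) =
      ENNReal.ofReal (1 - s) * (P.evidence ν π o * kl (posterior P I ν π o) ρ) +
        ENNReal.ofReal s * (P.dens x.1 π o * negLog (ρ φs)) := by
  by_cases hm : P.evidence ν π o = 0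
  · have hq0 : P.dens x.1 π o = 0 := by
      by_contra h
      exact h0 h hm
    simp [evidence_mixWorld, hm, hq0]
  · have hk := kl_mix (posterior_mem hν hm h1) hρ hρs
      (mixRatio_nonneg (m := P.evidence ν π o) (q := P.dens x.1 π o) hs0 hs1)
      (mixRatio_lt_one hm h1 hs0 hs1)
    rw [posterior_mixWorld hx hs0 hs1 hm h1 hq, evidence_mixWorld]
    have e1 := mul_mixRatio hm h1 hq hs0 hs1
    have e2 := mul_one_sub_mixRatio hm h1 hq hs0 hs1
    generalize ENNReal.ofReal (1 - s) * P.evidence ν π o + ENNReal.ofReal s * P.dens x.1 π o = D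
      at *
    simp only [← mul_assoc]
    rw [← e1, ← e2]
    simp only [mul_assoc]
    rw [← mul_add, ← mul_add, hk, mul_add]

lemma isProbabilityMeasure_mixWorld (hν : ν ∈ I.worlds) (hx : x ∈ I.set φs) (hs0 : 0 ≤ s)
    (hs1 : s ≤ 1) : IsProbabilityMeasure (mixWorld ν x s) :=
  (mixWorld_mem hν hx hs0 hs1).1

lemma infoGain_mixWorld (hν : ν ∈ I.worlds) (hx : x ∈ I.set φs)
    (hρ : ρ ∈ stdSimplex ℝ Φ) (hρs : 0 < ρ φs) (hs0 : 0 ≤ s) (hs1 : s < 1)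
    (hev : ∀ᵐ o ∂(P.law x.1 π), P.evidence ν π o ≠ 0) :
    infoGain P I π (mixWorld ν x s) ρ +
        ENNReal.ofReal s * surprise P I (mixWorld ν x s) π x.1 φs +
        ENNReal.ofReal (1 - s) * posteriorGap P I ν π x s =
      ENNReal.ofReal (1 - s) * infoGain P I π ν ρ + ENNReal.ofReal s * negLog (ρ φs) := by
  have := hν.1
  have := isProbabilityMeasure_mixWorld hν hx hs0 hs1.le
  have m1 := P.measurable_evidence ν π
  have m2 := P.measurable_evidence (mixWorld ν x s) π
  have m3 := measurable_posterior P I ν π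
  have m4 := measurable_posterior P I (mixWorld ν x s) π
  have m5 := P.measurable_dens_obs x.1 π
  have m6 := measurable_negLog_posterior (P := P) (I := I) (mixWorld ν x s) π φs
  have k1 : Measurable fun o => kl (posterior P I (mixWorld ν x s) π o) ρ :=
    measurable_kl.comp (m4.prodMk measurable_const)
  have k2 : Measurable fun o => kl (posterior P I ν π o) ρ :=
    measurable_kl.comp (m3.prodMk measurable_const)
  have k3 : Measurable fun o => kl (posterior P I ν π o) (posterior P I (mixWorld ν x s) π o) :=
    measurable_kl.comp (m3.prodMk m4)
  have e : negLog (ρ φs) = ∫⁻ o, P.dens x.1 π o * negLog (ρ φs) ∂P.ref := by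
    rw [lintegral_mul_const _ m5, P.lintegral_dens, one_mul]
  rw [infoGain, infoGain, surprise, posteriorGap, P.lintegral_law _ _ m6]
  conv_rhs => rw [e]
  have n1 : Measurable fun o => P.evidence (mixWorld ν x s) π o *
      kl (posterior P I (mixWorld ν x s) π o) ρ := m2.mul k1
  have n2 : Measurable fun o => P.dens x.1 π o *
      negLog (posterior P I (mixWorld ν x s) π o φs) := m5.mul m6
  have n3 : Measurable fun o => P.evidence ν π o *
      kl (posterior P I ν π o) (posterior P I (mixWorld ν x s) π o) := m1.mul k3
  have n4 : Measurable fun o => P.evidence ν π o * kl (posterior P I ν π o) ρ := m1.mul k2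
  have n5 : Measurable fun o => P.evidence (mixWorld ν x s) π o *
      kl (posterior P I (mixWorld ν x s) π o) ρ + ENNReal.ofReal s * (P.dens x.1 π o *
      negLog (posterior P I (mixWorld ν x s) π o φs)) := n1.add (n2.const_mul _)
  rw [← lintegral_const_mul _ n2, ← lintegral_const_mul _ n3,
    ← lintegral_const_mul _ n4, ← lintegral_const_mul _ (m5.mul_const _),
    ← lintegral_add_left n1, ← lintegral_add_left n5,
    ← lintegral_add_left (n4.const_mul _)]
  refine lintegral_congr_ae ?_
  filter_upwards [(P.ae_law_iff _ _).1 hev, P.ae_evidence_ne_top ν π, P.ae_dens_ne_top x.1 π]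
    with o h0 h1 h2 using infoGain_mixWorld_pointwise hν hx hρ hρs hs0 hs1 h0 h1 h2

/-- With `r` the posterior weight of `x`, the entropy is at most `r / (1 - r)` times `r` over the
mixed posterior at `φs`. The odds `r / (1 - r)` are the prior odds times the likelihood ratio, so
the first factor changes the measure from the evidence to the law of `x` and releases a factor of
order `s`. -/
lemma posteriorGap_le (hν : ν ∈ I.worlds) (hx : x ∈ I.set φs) (hs0 : 0 ≤ s) (hs1 : s < 1) :
    posteriorGap P I ν π x s ≤ ENNReal.ofReal (s / (1 - s)) *
      ∫⁻ o, ENNReal.ofReal (mixRatio (P.evidence ν π o) (P.dens x.1 π o) s /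
        mix φs (mixRatio (P.evidence ν π o) (P.dens x.1 π o) s) (posterior P I ν π o) φs)
        ∂(P.law x.1 π) := by
  have := hν.1
  have m1 := P.measurable_evidence ν π
  have m3 := measurable_posterior P I ν π
  have m5 := P.measurable_dens_obs x.1 π
  have m6 : Measurable fun o => mixRatio (P.evidence ν π o) (P.dens x.1 π o) s := by
    unfold mixRatio
    exact (m5.ennreal_toReal.const_mul _).div ((m1.ennreal_toReal.const_mul _).add
      (m5.ennreal_toReal.const_mul _))
  have m7 : Measurable fun o => ENNReal.ofReal (mixRatio (P.evidence ν π o) (P.dens x.1 π o) s /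
        mix φs (mixRatio (P.evidence ν π o) (P.dens x.1 π o) s) (posterior P I ν π o) φs) := by
    simp only [mix_self]
    have m8 := (measurable_pi_apply φs).comp m3
    exact (m6.div (((measurable_const.sub m6).mul m8).add m6)).ennreal_ofReal
  have n1 : Measurable fun o => P.dens x.1 π o *
      ENNReal.ofReal (mixRatio (P.evidence ν π o) (P.dens x.1 π o) s /
        mix φs (mixRatio (P.evidence ν π o) (P.dens x.1 π o) s) (posterior P I ν π o) φs) :=
    m5.mul m7
  rw [posteriorGap, P.lintegral_law _ _ m7, ← lintegral_const_mul _ n1]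
  refine lintegral_mono_ae ?_
  filter_upwards [P.ae_evidence_ne_top ν π, P.ae_dens_ne_top x.1 π] with o h1 hq
  by_cases hm : P.evidence ν π o = 0
  · simp [hm]
  have ha := posterior_mem hν hm h1
  rw [posterior_mixWorld hx hs0 hs1 hm h1 hq]
  have r0 := mixRatio_nonneg (m := P.evidence ν π o) (q := P.dens x.1 π o) hs0 hs1
  have r1 := mixRatio_lt_one (q := P.dens x.1 π o) hm h1 hs0 hs1
  have r2 := one_sub_mixRatio (q := P.dens x.1 π o) hm h1 hs0 hs1
  have rd := mixRatio_denom_pos (q := P.dens x.1 π o) hm h1 hs0 hs1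
  have rr : P.evidence ν π o * ENNReal.ofReal (mixRatio (P.evidence ν π o) (P.dens x.1 π o) s /
      (1 - mixRatio (P.evidence ν π o) (P.dens x.1 π o) s)) =
      ENNReal.ofReal (s / (1 - s)) * P.dens x.1 π o := by
    rw [r2]
    nth_rw 1 [← ENNReal.ofReal_toReal h1]
    conv_rhs => rw [← ENNReal.ofReal_toReal hq]
    have hmp := (ENNReal.toReal_pos hm h1).ne'
    have : 1 - s ≠ 0 := by linarith
    have rd' := rd.ne'
    rw [mul_comm (1 - s)] at rd'
    rw [← ENNReal.ofReal_mul ENNReal.toReal_nonneg,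
      ← ENNReal.ofReal_mul (div_nonneg hs0 (by linarith))]
    congr 1
    unfold mixRatio
    field_simp
  have hk : kl (posterior P I ν π o) (mix φs (mixRatio (P.evidence ν π o) (P.dens x.1 π o) s)
      (posterior P I ν π o)) ≤ ENNReal.ofReal
        (mixRatio (P.evidence ν π o) (P.dens x.1 π o) s /
          (1 - mixRatio (P.evidence ν π o) (P.dens x.1 π o) s)) * ENNReal.ofReal
        (mixRatio (P.evidence ν π o) (P.dens x.1 π o) s /
        mix φs (mixRatio (P.evidence ν π o) (P.dens x.1 π o) s) (posterior P I ν π o) φs) := by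
    rw [kl_eq_ofReal fun φ h => ((mix_eq_zero_iff ha.1 r0 r1).1 h).1,
      ← ENNReal.ofReal_mul (div_nonneg r0 (by linarith))]
    exact ENNReal.ofReal_le_ofReal (klSum_mix_right_le' ha r0 r1)
  calc _ ≤ P.evidence ν π o * (_ * _) := by gcongr
    _ = _ := by rw [← mul_assoc, rr, mul_assoc]

lemma tendsto_negLog_posterior_mixWorld (hx : x ∈ I.set φs) {o : Obs}
    (h0 : P.evidence ν π o ≠ 0) (h1 : P.evidence ν π o ≠ ⊤) (hq : P.dens x.1 π o ≠ ⊤) :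
    Filter.Tendsto (fun s => negLog (posterior P I (mixWorld ν x s) π o φs))
      (nhdsWithin 0 (Set.Ioi 0)) (nhds (negLog (posterior P I ν π o φs))) := by
  have h := (continuous_negLog.tendsto _).comp (tendsto_mix_mixRatio (φs := φs) _
    (P.dens x.1 π o) h0 h1 (posterior P I ν π o))
  refine h.congr' ?_
  filter_upwards [eventually_mem_Ioo] with s hs
  rw [posterior_mixWorld hx hs.1.le (by linarith [hs.2]) h0 h1 hq]
  rfl

/-- Fatou's lemma for the log loss along `s → 0`. -/
lemma surprise_le_of_forall (hν : ν ∈ I.worlds) (hx : x ∈ I.set φs)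
    (hev : ∀ᵐ o ∂(P.law x.1 π), P.evidence ν π o ≠ 0) {c : ℝ≥0∞}
    (hc : ∀ s ∈ Set.Ioo (0 : ℝ) 1, surprise P I (mixWorld ν x s) π x.1 φs ≤ c) :
    surprise P I ν π x.1 φs ≤ c := by
  -- Fatou's lemma is applied along the sequence `1 / (n + 2)`, all of whose terms are strictly
  -- between `0` and `1`.
  have hu : Filter.Tendsto (fun n : ℕ => 1 / ((n : ℝ) + 1 + 1)) Filter.atTop
      (nhdsWithin 0 (Set.Ioi 0)) := by
    refine tendsto_nhdsWithin_iff.2 ⟨?_, Filter.Eventually.of_forall fun n => ?_⟩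
    · have := (Filter.tendsto_add_atTop_iff_nat 1).2
        (tendsto_one_div_add_atTop_nhds_zero_nat (𝕜 := ℝ))
      simpa using this
    · exact Set.mem_Ioi.2 (by positivity)
  have hmem : ∀ n : ℕ, 1 / ((n : ℝ) + 1 + 1) ∈ Set.Ioo (0 : ℝ) 1 := fun n =>
    ⟨by positivity, by rw [div_lt_one (by positivity)]; have := n.cast_nonneg (α := ℝ); linarith⟩
  have hlim : ∀ᵐ o ∂(P.law x.1 π), negLog (posterior P I ν π o φs) =
      Filter.liminf (fun n : ℕ => negLog (posterior P I (mixWorld ν x (1 / ((n : ℝ) + 1 + 1)))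
        π o φs)) Filter.atTop := by
    filter_upwards [ae_law_regular hν x.1 hev] with o ho
    exact (((tendsto_negLog_posterior_mixWorld hx ho.1 ho.2.1 ho.2.2.2).comp hu).liminf_eq).symm
  rw [surprise, lintegral_congr_ae hlim]
  refine (lintegral_liminf_le fun n => ?_).trans ?_
  · have := isProbabilityMeasure_mixWorld hν hx (hmem n).1.le (hmem n).2.le
    exact measurable_negLog_posterior _ _ _
  · refine (Filter.liminf_le_liminf (Filter.Eventually.of_forall fun n => hc _ (hmem n))).trans ?_
    simp

/-- Mixing in a world of `φs` only raises the posterior of `φs`, so the log loss at `s = 0`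
dominates all the others. -/
lemma tendsto_surprise (hν : ν ∈ I.worlds) (hx : x ∈ I.set φs)
    (hev : ∀ᵐ o ∂(P.law x.1 π), P.evidence ν π o ≠ 0)
    (hfin : surprise P I ν π x.1 φs ≠ ⊤) :
    Filter.Tendsto (fun s => surprise P I (mixWorld ν x s) π x.1 φs) (nhdsWithin 0 (Set.Ioi 0))
      (nhds (surprise P I ν π x.1 φs)) := by
  refine tendsto_lintegral_filter_of_dominated_convergence
    (fun o => negLog (posterior P I ν π o φs)) ?_ ?_ hfin ?_
  · filter_upwards [eventually_mem_Ioo] with s hs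
    have := isProbabilityMeasure_mixWorld hν hx hs.1.le (by linarith [hs.2])
    exact measurable_negLog_posterior _ _ _
  · filter_upwards [eventually_mem_Ioo] with s hs
    filter_upwards [ae_law_regular hν x.1 hev] with o ho
    have hs1 : s < 1 := by linarith [hs.2]
    rw [posterior_mixWorld hx hs.1.le hs1 ho.1 ho.2.1 ho.2.2.2]
    refine antitone_negLog ?_
    rw [mix_self]
    have h1 := le_one_of_mem_stdSimplex (posterior_mem hν ho.1 ho.2.1) φs
    have h2 := mixRatio_nonneg (m := P.evidence ν π o) (q := P.dens x.1 π o) hs.1.le hs1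
    nlinarith
  · filter_upwards [ae_law_regular hν x.1 hev] with o ho
    exact tendsto_negLog_posterior_mixWorld hx ho.1 ho.2.1 ho.2.2.2

/-- By `posteriorGap_le` the quotient is bounded by twice an integral whose integrand is at most
`1`. Finite log loss makes the posterior of `φs` positive almost surely, and there the integrand
tends to `0`. -/
lemma tendsto_posteriorGap_div (hν : ν ∈ I.worlds) (hx : x ∈ I.set φs)
    (hev : ∀ᵐ o ∂(P.law x.1 π), P.evidence ν π o ≠ 0)
    (hfin : surprise P I ν π x.1 φs ≠ ⊤) :
    Filter.Tendsto (fun s => (posteriorGap P I ν π x s).toReal / s) (nhdsWithin 0 (Set.Ioi 0))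
      (nhds 0) := by
  have := hν.1
  have := P.isProbabilityMeasure_law x.1 π
  set g : ℝ → ℝ≥0∞ := fun s => ∫⁻ o, ENNReal.ofReal (mixRatio (P.evidence ν π o) (P.dens x.1 π o) s /
        mix φs (mixRatio (P.evidence ν π o) (P.dens x.1 π o) s) (posterior P I ν π o) φs)
        ∂(P.law x.1 π) with hg
  have m1 := P.measurable_evidence ν π
  have m3 := measurable_posterior P I ν π
  have m5 := P.measurable_dens_obs x.1 π
  have hlog := ae_lt_top (measurable_negLog_posterior (P := P) (I := I) ν π φs) hfin
  have hle : ∀ s ∈ Set.Ioo (0 : ℝ) (1 / 2), ∀ᵐ o ∂(P.law x.1 π),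
      ENNReal.ofReal (mixRatio (P.evidence ν π o) (P.dens x.1 π o) s /
        mix φs (mixRatio (P.evidence ν π o) (P.dens x.1 π o) s) (posterior P I ν π o) φs) ≤ 1 := by
    intro s hs
    have hs1 : s < 1 := by linarith [hs.2]
    filter_upwards [ae_law_regular hν x.1 hev] with o ho
    rw [ENNReal.ofReal_le_one]
    have h2 := mixRatio_nonneg (m := P.evidence ν π o) (q := P.dens x.1 π o) hs.1.le hs1
    have h3 := mixRatio_lt_one (q := P.dens x.1 π o) ho.1 ho.2.1 hs.1.le hs1
    have h4 := mul_nonneg (sub_nonneg.2 h3.le) (posterior_nonneg P I ν π o φs)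
    refine div_le_one_of_le₀ ?_ ?_ <;> rw [mix_self] <;> linarith
  have hg0 : Filter.Tendsto g (nhdsWithin 0 (Set.Ioi 0)) (nhds 0) := by
    rw [← lintegral_zero (μ := P.law x.1 π)]
    refine tendsto_lintegral_filter_of_dominated_convergence (fun _ => 1) ?_ ?_ (by simp) ?_
    · refine Filter.Eventually.of_forall fun s => ?_
      have m6 : Measurable fun o => mixRatio (P.evidence ν π o) (P.dens x.1 π o) s := by
        unfold mixRatio
        exact (m5.ennreal_toReal.const_mul _).div ((m1.ennreal_toReal.const_mul _).add
          (m5.ennreal_toReal.const_mul _))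
      simp only [mix_self]
      have m8 := (measurable_pi_apply φs).comp m3
      exact (m6.div (((measurable_const.sub m6).mul m8).add m6)).ennreal_ofReal
    · filter_upwards [eventually_mem_Ioo] with s hs using hle s hs
    · filter_upwards [ae_law_regular hν x.1 hev, hlog] with o ho hl
      have hpos := negLog_lt_top_iff.1 hl
      have h := (tendsto_mixRatio _ (P.dens x.1 π o) ho.1 ho.2.1).div
        (tendsto_mix_mixRatio (φs := φs) _ (P.dens x.1 π o) ho.1 ho.2.1 (posterior P I ν π o))
        hpos.ne'
      rw [zero_div] at h
      have h2 := (ENNReal.continuous_ofReal.tendsto _).comp h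
      rw [ENNReal.ofReal_zero] at h2
      exact h2
  have hg1 := (ENNReal.tendsto_toReal ENNReal.zero_ne_top).comp hg0
  have hg2 : Filter.Tendsto (fun s => 2 * (g s).toReal) (nhdsWithin 0 (Set.Ioi 0)) (nhds 0) := by
    simpa using hg1.const_mul 2
  refine squeeze_zero' ?_ ?_ hg2
  · filter_upwards [eventually_mem_Ioo] with s hs
    exact div_nonneg ENNReal.toReal_nonneg hs.1.le
  · filter_upwards [eventually_mem_Ioo] with s hs
    have hs1 : s < 1 := by linarith [hs.2]
    have hgf : g s ≠ ⊤ := by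
      refine ((lintegral_mono_ae (hle s hs)).trans_lt ?_).ne
      simp
    have h := ENNReal.toReal_mono (ENNReal.mul_ne_top ENNReal.ofReal_ne_top hgf)
      (posteriorGap_le (π := π) (P := P) hν hx hs.1.le hs1)
    have h1s : 0 < 1 - s := by linarith
    rw [ENNReal.toReal_mul, ENNReal.toReal_ofReal (div_nonneg hs.1.le h1s.le)] at h
    rw [div_le_iff₀ hs.1]
    refine h.trans ?_
    have h5 : s / (1 - s) ≤ 2 * s := by
      rw [div_le_iff₀ h1s]
      nlinarith [hs.1, hs.2]
    calc _ ≤ 2 * s * (g s).toReal := by gcongr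
      _ = _ := by ring

end BestResponse

/-! ### Averages of the error and divergence at a point mass -/

section Average

variable {Mdl Pol Φ : Type*} [Fintype Φ] {Dbar : Pol → Φ → Mdl → ℝ} {π : Pol} {ρ : Φ → ℝ}
  {φs : Φ}

lemma sum_mul_nonneg (h0 : ∀ φ M, 0 ≤ Dbar π φ M) (hρ : ρ ∈ stdSimplex ℝ Φ) (M : Mdl) :
    0 ≤ ∑ φ, ρ φ * Dbar π φ M :=
  Finset.sum_nonneg fun φ _ => mul_nonneg (hρ.1 φ) (h0 φ M)

lemma sum_mul_le_one (h1 : ∀ φ M, Dbar π φ M ≤ 1) (hρ : ρ ∈ stdSimplex ℝ Φ) (M : Mdl) :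
    ∑ φ, ρ φ * Dbar π φ M ≤ 1 := by
  rw [← hρ.2]
  exact Finset.sum_le_sum fun φ _ => mul_le_of_le_one_right (hρ.1 φ) (h1 φ M)

lemma neg_log_nonneg_of_mem (hρ : ρ ∈ stdSimplex ℝ Φ) (φ : Φ) : 0 ≤ -Real.log (ρ φ) :=
  neg_nonneg.2 (Real.log_nonpos (hρ.1 φ) (le_one_of_mem_stdSimplex hρ φ))

/-- The divergence of the point mass at a world of `φs`. -/
def pointDivergence (Dbar : Pol → Φ → Mdl → ℝ) (φs : Φ) (π : Pol) (M : Mdl) (ρ : Φ → ℝ) : ℝ :=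
  -Real.log (ρ φs) + ∑ φ, ρ φ * Dbar π φ M

lemma pointDivergence_nonneg (h0 : ∀ φ M, 0 ≤ Dbar π φ M) (hρ : ρ ∈ stdSimplex ℝ Φ) (M : Mdl) :
    0 ≤ pointDivergence Dbar φs π M ρ :=
  add_nonneg (neg_log_nonneg_of_mem hρ φs) (sum_mul_nonneg h0 hρ M)

end Average

/-! ### Bregman divergence as log loss, and the first-order condition for the best response -/

section Minimax

variable {Mdl Pol Obs Φ : Type*} [MeasurableSpace Mdl] [MeasurableSpace Pol] [MeasurableSpace Obs]
  {P : DMSO Mdl Pol Obs} {I : InfoSets Mdl Pol Φ} {Dbar : Pol → Φ → Mdl → ℝ}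
  {ν : Measure (Mdl × Pol)} {x : Mdl × Pol} {φs : Φ} {π : Pol} {ρ : Φ → ℝ} {s : ℝ}

lemma evidence_dirac (x : Mdl × Pol) (π : Pol) (o : Obs) :
    P.evidence (Measure.dirac x) π o = P.dens x.1 π o :=
  lintegral_dirac' _ (P.measurable_dens_world' π o)

lemma posterior_dirac (hx : x ∈ I.set φs) {o : Obs} (h0 : P.dens x.1 π o ≠ 0)
    (h1 : P.dens x.1 π o ≠ ⊤) : posterior P I (Measure.dirac x) π o = pointMass φs := by
  ext φ
  rw [posterior_eq, evidence_dirac, jointDensity_eq_indicator,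
    lintegral_dirac' _ ((P.measurable_dens_world' π o).indicator (I.measurableSet_set φ))]
  unfold pointMass
  split_ifs with h
  · subst h
    rw [Set.indicator_of_mem hx, ENNReal.div_self h0 h1, ENNReal.toReal_one]
  · rw [Set.indicator_of_notMem, ENNReal.zero_div, ENNReal.toReal_zero]
    exact fun h' => Set.disjoint_left.1 (I.disjoint h) h' hx

variable [Fintype Φ]

lemma measurable_ofReal_sum_mul (hD : ∀ π φ, Measurable (Dbar π φ)) (ρ : Φ → ℝ) (π : Pol) :
    Measurable fun x : Mdl × Pol => ENNReal.ofReal (∑ φ, ρ φ * Dbar π φ x.1) := by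
  have : ∀ φ, Measurable fun x : Mdl × Pol => Dbar π φ x.1 := fun φ =>
    (hD π φ).comp measurable_fst
  exact (Finset.measurable_sum _ fun φ _ => (this φ).const_mul _).ennreal_ofReal

lemma divergence_dirac (hD : ∀ π φ, Measurable (Dbar π φ)) (h0 : ∀ φ M, 0 ≤ Dbar π φ M)
    (hx : x ∈ I.set φs) (hρ : ρ ∈ stdSimplex ℝ Φ) (hρs : 0 < ρ φs) :
    divergence P I Dbar π (Measure.dirac x) ρ =
      ENNReal.ofReal (pointDivergence Dbar φs π x.1 ρ) := by
  rw [divergence_eq P I Dbar hD, expectedError, lintegral_dirac' _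
    (measurable_ofReal_sum_mul hD ρ π), pointDivergence,
    ENNReal.ofReal_add (neg_log_nonneg_of_mem hρ φs) (sum_mul_nonneg h0 hρ _)]
  congr 1
  have e : infoGain P I π (Measure.dirac x) ρ = ∫⁻ o, P.dens x.1 π o * negLog (ρ φs) ∂P.ref := by
    refine lintegral_congr_ae ?_
    filter_upwards [P.ae_dens_ne_top x.1 π] with o ho
    rw [evidence_dirac]
    by_cases hq : P.dens x.1 π o = 0
    · simp [hq]
    · rw [posterior_dirac hx hq ho, kl_pointMass hρs.le]
  rw [e, lintegral_mul_const _ (P.measurable_dens_obs x.1 π), P.lintegral_dens, one_mul,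
    negLog_of_pos hρs]

/-- The error term is linear in the world distribution, so the whole deviation from affinity comes
from `infoGain_mixWorld`. -/
lemma divergence_mixWorld (hD : ∀ π φ, Measurable (Dbar π φ)) (h0 : ∀ φ M, 0 ≤ Dbar π φ M)
    (hν : ν ∈ I.worlds) (hx : x ∈ I.set φs)
    (hρ : ρ ∈ stdSimplex ℝ Φ) (hρs : 0 < ρ φs) (hs0 : 0 ≤ s) (hs1 : s < 1)
    (hev : ∀ᵐ o ∂(P.law x.1 π), P.evidence ν π o ≠ 0) :
    divergence P I Dbar π (mixWorld ν x s) ρ +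
        ENNReal.ofReal s * surprise P I (mixWorld ν x s) π x.1 φs +
        ENNReal.ofReal (1 - s) * posteriorGap P I ν π x s =
      ENNReal.ofReal (1 - s) * divergence P I Dbar π ν ρ +
        ENNReal.ofReal s * ENNReal.ofReal (pointDivergence Dbar φs π x.1 ρ) := by
  have := hν.1
  have := isProbabilityMeasure_mixWorld hν hx hs0 hs1.le
  have h := infoGain_mixWorld hν hx hρ hρs hs0 hs1 hev
  have e : expectedError Dbar π (mixWorld ν x s) ρ =
      ENNReal.ofReal (1 - s) * expectedError Dbar π ν ρ +
        ENNReal.ofReal s * ENNReal.ofReal (∑ φ, ρ φ * Dbar π φ x.1) :=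
    lintegral_mixWorld _ _ _ (measurable_ofReal_sum_mul hD ρ π)
  rw [divergence_eq P I Dbar hD, divergence_eq P I Dbar hD, pointDivergence,
    ENNReal.ofReal_add (neg_log_nonneg_of_mem hρ φs) (sum_mul_nonneg h0 hρ _), mul_add, mul_add,
    ← negLog_of_pos hρs, add_add_add_comm (ENNReal.ofReal (1 - s) * _), ← h, e]
  ring

lemma toReal_divergence_mixWorld (hD : ∀ π φ, Measurable (Dbar π φ))
    (h0 : ∀ φ M, 0 ≤ Dbar π φ M) (hν : ν ∈ I.worlds) (hx : x ∈ I.set φs)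
    (hρ : ρ ∈ stdSimplex ℝ Φ) (hρs : 0 < ρ φs) (hs0 : 0 ≤ s) (hs1 : s < 1)
    (hev : ∀ᵐ o ∂(P.law x.1 π), P.evidence ν π o ≠ 0)
    (hfin : divergence P I Dbar π ν ρ ≠ ⊤) :
    (divergence P I Dbar π (mixWorld ν x s) ρ).toReal =
      (1 - s) * (divergence P I Dbar π ν ρ).toReal + s * pointDivergence Dbar φs π x.1 ρ -
        s * (surprise P I (mixWorld ν x s) π x.1 φs).toReal -
        (1 - s) * (posteriorGap P I ν π x s).toReal := by
  have h := divergence_mixWorld (P := P) (I := I) hD h0 hν hx hρ hρs hs0 hs1 hev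
  have hR : ENNReal.ofReal (1 - s) * divergence P I Dbar π ν ρ +
      ENNReal.ofReal s * ENNReal.ofReal (pointDivergence Dbar φs π x.1 ρ) ≠ ⊤ :=
    ENNReal.add_ne_top.2 ⟨ENNReal.mul_ne_top ENNReal.ofReal_ne_top hfin,
      ENNReal.mul_ne_top ENNReal.ofReal_ne_top ENNReal.ofReal_ne_top⟩
  have hL := h ▸ hR
  obtain ⟨hL1, hL3⟩ := ENNReal.add_ne_top.1 hL
  obtain ⟨hL1, hL2⟩ := ENNReal.add_ne_top.1 hL1
  have h' := congrArg ENNReal.toReal h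
  rw [ENNReal.toReal_add (ENNReal.add_ne_top.2 ⟨hL1, hL2⟩) hL3, ENNReal.toReal_add hL1 hL2,
    ENNReal.toReal_add (ENNReal.mul_ne_top ENNReal.ofReal_ne_top hfin)
      (ENNReal.mul_ne_top ENNReal.ofReal_ne_top ENNReal.ofReal_ne_top)] at h'
  simp only [ENNReal.toReal_mul, ENNReal.toReal_ofReal hs0,
    ENNReal.toReal_ofReal (sub_nonneg.2 hs1.le),
    ENNReal.toReal_ofReal (pointDivergence_nonneg h0 hρ _)] at h'
  linarith

/-- By the exact expansion, the difference quotient at `s` is `d - F`, minus the log loss at `s`,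
minus `1 - s` times the gap over `s`. The loss converges and the last term vanishes in the limit, so
the directional derivative is `d - F - A`; in the Bregman divergence `d` and `F` cancel. -/
lemma bregman_divergence (hD : ∀ π φ, Measurable (Dbar π φ)) (h0 : ∀ φ M, 0 ≤ Dbar π φ M)
    (hν : ν ∈ I.worlds) (hx : x ∈ I.set φs) (hρ : ρ ∈ stdSimplex ℝ Φ) (hρs : 0 < ρ φs)
    (hev : ∀ᵐ o ∂(P.law x.1 π), P.evidence ν π o ≠ 0)
    (hfin : divergence P I Dbar π ν ρ ≠ ⊤) (hsur : surprise P I ν π x.1 φs ≠ ⊤) :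
    bregman (fun ν => divergence P I Dbar π ν ρ) (Measure.dirac x) ν =
      (surprise P I ν π x.1 φs).toReal := by
  set d := pointDivergence Dbar φs π x.1 ρ
  set A := (surprise P I ν π x.1 φs).toReal
  set F := (divergence P I Dbar π ν ρ).toReal
  have hder : HasDerivWithinAt
      (fun s : ℝ => (divergence P I Dbar π (mixWorld ν x s) ρ).toReal) (d - F - A)
      (Set.Ici 0) 0 := by
    rw [hasDerivWithinAt_iff_tendsto_slope, Set.Ici_sdiff_left]
    have t1 := (ENNReal.tendsto_toReal hsur).comp (tendsto_surprise hν hx hev hsur)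
    have t2 := tendsto_posteriorGap_div hν hx hev hsur
    have t3 : Filter.Tendsto (fun s : ℝ => 1 - s) (nhdsWithin 0 (Set.Ioi 0)) (nhds 1) := by
      have : ContinuousAt (fun s : ℝ => 1 - s) 0 := by fun_prop
      simpa using this.tendsto.mono_left nhdsWithin_le_nhds
    have t4 := ((tendsto_const_nhds (x := d - F)).sub t1).sub (t3.mul t2)
    rw [mul_zero, sub_zero] at t4
    refine t4.congr' ?_
    filter_upwards [eventually_mem_Ioo] with s hs
    have hs1 : s < 1 := by linarith [hs.2]
    simp only [slope_def_field, mixWorld_zero, sub_zero, Function.comp]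
    rw [toReal_divergence_mixWorld hD h0 hν hx hρ hρs hs.1.le hs1 hev hfin]
    have := hs.1.ne'
    field_simp
    ring
  have hder' := hder.derivWithin (uniqueDiffWithinAt_Ici 0)
  unfold bregman
  simp only [mixWorld] at hder'
  rw [hder']
  beta_reduce
  rw [divergence_dirac hD h0 hx hρ hρs,
    ENNReal.toReal_ofReal (pointDivergence_nonneg h0 hρ _)]
  ring

lemma DMSO.measurable_gap (P : DMSO Mdl Pol Obs) (π : Pol) :
    Measurable fun x : Mdl × Pol => P.V x.1 x.2 - P.V x.1 π :=
  (P.measurable_V).sub (P.measurable_V.comp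
    (f := fun x : Mdl × Pol => (x.1, π)) (by fun_prop))

lemma DMSO.abs_gap_le (P : DMSO Mdl Pol Obs) (M : Mdl) (π π' : Pol) :
    |P.V M π - P.V M π'| ≤ 1 := by
  have h1 := P.V_mem M π
  have h2 := P.V_mem M π'
  rw [abs_le]
  constructor <;> linarith [h1.1, h1.2, h2.1, h2.2]

lemma DMSO.integrable_gap (P : DMSO Mdl Pol Obs) (ν : Measure (Mdl × Pol)) [IsFiniteMeasure ν]
    (π : Pol) : Integrable (fun x : Mdl × Pol => P.V x.1 x.2 - P.V x.1 π) ν :=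
  Integrable.of_bound (P.measurable_gap π).aestronglyMeasurable 1
    (Filter.Eventually.of_forall fun _ => P.abs_gap_le _ _ _)

variable [Fintype Pol]

/-- The expected divergence when the policy is drawn from `p`. -/
def meanDivergence (P : DMSO Mdl Pol Obs) (I : InfoSets Mdl Pol Φ) (Dbar : Pol → Φ → Mdl → ℝ)
    (p : Pol → ℝ) (ν : Measure (Mdl × Pol)) (ρ : Φ → ℝ) : ℝ≥0∞ :=
  ∑ π, ENNReal.ofReal (p π) * divergence P I Dbar π ν ρ

/-- The expected gap between the value of the world's policy and that of a policy drawn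
from `p`. -/
def meanGap (P : DMSO Mdl Pol Obs) (p : Pol → ℝ) (ν : Measure (Mdl × Pol)) : ℝ :=
  ∑ π, p π * ∫ x, (P.V x.1 x.2 - P.V x.1 π) ∂ν

variable {p : Pol → ℝ} {η : ℝ}

lemma air_eq_coe (hη : 0 < η) (h : meanDivergence P I Dbar p ν ρ ≠ ⊤) :
    air P I Dbar η p ν ρ =
      ((meanGap P p ν - 1 / η * (meanDivergence P I Dbar p ν ρ).toReal : ℝ) : EReal) := by
  rw [air]
  change ((meanGap P p ν : ℝ) : EReal) -
    ((ENNReal.ofReal (1 / η) * meanDivergence P I Dbar p ν ρ : ℝ≥0∞) : EReal) = _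
  rw [← EReal.coe_ennreal_toReal (ENNReal.mul_ne_top ENNReal.ofReal_ne_top h), ← EReal.coe_sub,
    ENNReal.toReal_mul, ENNReal.toReal_ofReal (by positivity)]

lemma air_eq_bot (hη : 0 < η) (h : meanDivergence P I Dbar p ν ρ = ⊤) :
    air P I Dbar η p ν ρ = ⊥ := by
  rw [air]
  change ((meanGap P p ν : ℝ) : EReal) -
    ((ENNReal.ofReal (1 / η) * meanDivergence P I Dbar p ν ρ : ℝ≥0∞) : EReal) = _
  rw [h, ENNReal.mul_top (by simpa using hη)]
  simp

lemma meanGap_dirac (x : Mdl × Pol) :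
    meanGap P p (Measure.dirac x) = ∑ π, p π * (P.V x.1 x.2 - P.V x.1 π) := by
  refine Finset.sum_congr rfl fun π _ => ?_
  rw [integral_dirac' _ _ (P.measurable_gap π).stronglyMeasurable]

lemma meanGap_mixWorld [IsProbabilityMeasure ν] (hs0 : 0 ≤ s) (hs1 : s ≤ 1) :
    meanGap P p (mixWorld ν x s) =
      (1 - s) * meanGap P p ν + s * meanGap P p (Measure.dirac x) := by
  simp only [meanGap, Finset.mul_sum, ← Finset.sum_add_distrib]
  refine Finset.sum_congr rfl fun π _ => ?_
  rw [mixWorld, integral_add_measure, integral_smul_measure, integral_smul_measure,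
    ENNReal.toReal_ofReal (sub_nonneg.2 hs1), ENNReal.toReal_ofReal hs0]
  · simp only [smul_eq_mul]; ring
  · exact (P.integrable_gap ν π).smul_measure ENNReal.ofReal_ne_top
  · exact (P.integrable_gap _ π).smul_measure ENNReal.ofReal_ne_top

lemma abs_meanGap_le [IsProbabilityMeasure ν] (hp : p ∈ stdSimplex ℝ Pol) :
    |meanGap P p ν| ≤ 1 := by
  have h : ∀ π, |∫ x, (P.V x.1 x.2 - P.V x.1 π) ∂ν| ≤ 1 := fun π => by
    have := norm_integral_le_of_norm_le_const (μ := ν) (C := 1)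
      (f := fun x : Mdl × Pol => P.V x.1 x.2 - P.V x.1 π)
      (Filter.Eventually.of_forall fun x : Mdl × Pol => P.abs_gap_le x.1 x.2 π)
    simpa using this
  calc |meanGap P p ν| ≤ ∑ π, |p π * ∫ x, (P.V x.1 x.2 - P.V x.1 π) ∂ν| :=
        Finset.abs_sum_le_sum_abs _ _
    _ ≤ ∑ π, p π := Finset.sum_le_sum fun π _ => by
        rw [abs_mul, abs_of_nonneg (hp.1 π)]
        exact mul_le_of_le_one_right (hp.1 π) (h π)
    _ = 1 := hp.2

lemma meanDivergence_dirac (hD : ∀ π φ, Measurable (Dbar π φ)) (h0 : ∀ π φ M, 0 ≤ Dbar π φ M)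
    (hp : ∀ π, 0 ≤ p π) (hx : x ∈ I.set φs) (hρ : ρ ∈ stdSimplex ℝ Φ) (hρs : 0 < ρ φs) :
    meanDivergence P I Dbar p (Measure.dirac x) ρ =
      ENNReal.ofReal (∑ π, p π * pointDivergence Dbar φs π x.1 ρ) := by
  rw [ENNReal.ofReal_sum_of_nonneg fun π _ =>
    mul_nonneg (hp π) (pointDivergence_nonneg (h0 π) hρ _)]
  refine Finset.sum_congr rfl fun π _ => ?_
  rw [divergence_dirac hD (h0 π) hx hρ hρs, ENNReal.ofReal_mul (hp π)]

/-- No exchange of minimum and maximum is involved: `p` attains the minimum over policies of the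
worst case, and dig-dec takes the worst `ρ`. -/
lemma IsMinimaxSolution.air_le_digDec (h : IsMinimaxSolution P I Dbar η p ν ρ)
    (hρ : ρ ∈ stdSimplex ℝ Φ) : air P I Dbar η p ν ρ ≤ digDec P I Dbar η := by
  refine le_trans ?_ (le_iSup₂ (f := fun ρ (_ : ρ ∈ stdSimplex ℝ Φ) =>
    ⨅ p ∈ stdSimplex ℝ Pol, ⨆ ν ∈ I.worlds, air P I Dbar η p ν ρ) ρ hρ)
  refine le_iInf₂ fun p' hp' => le_trans ?_ (h.minimal p' hp')
  exact le_iSup₂ (f := fun ν' (_ : ν' ∈ I.worlds) => air P I Dbar η p ν' ρ) ν h.ν_mem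

/-- The first-order condition for the best response, in terms of the log loss of the posterior. -/
theorem IsMinimaxSolution.surprise_le (h : IsMinimaxSolution P I Dbar η p ν ρ) (hη : 0 < η)
    (hD : ∀ π φ, Measurable (Dbar π φ)) (h0 : ∀ π φ M, 0 ≤ Dbar π φ M)
    (hx : x ∈ I.set φs) (hρ : ρ ∈ stdSimplex ℝ Φ) (hρs : 0 < ρ φs)
    (hev : ∀ π, 0 < p π → ∀ᵐ o ∂(P.law x.1 π), P.evidence ν π o ≠ 0) :
    meanDivergence P I Dbar p ν ρ ≠ ⊤ ∧
    (∀ π, 0 < p π → surprise P I ν π x.1 φs ≠ ⊤) ∧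
    ∑ π, p π * (surprise P I ν π x.1 φs).toReal ≤
      ∑ π, p π * pointDivergence Dbar φs π x.1 ρ - (meanDivergence P I Dbar p ν ρ).toReal +
        η * (meanGap P p ν - meanGap P p (Measure.dirac x)) := by
  have hν := h.ν_mem
  have := hν.1
  have hp := h.p_mem
  have hdir := meanDivergence_dirac (P := P) hD h0 hp.1 hx hρ hρs
  set d := ∑ π, p π * pointDivergence Dbar φs π x.1 ρ with hd
  have hd0 : 0 ≤ d := Finset.sum_nonneg fun π _ =>
    mul_nonneg (hp.1 π) (pointDivergence_nonneg (h0 π) hρ _)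
  -- An infinite divergence would make the objective `⊥`, while the point mass at `x` attains a
  -- finite value.
  have hfin : meanDivergence P I Dbar p ν ρ ≠ ⊤ := by
    intro htop
    have h1 := h.best_response _ (dirac_mem_worlds hx)
    rw [air_eq_bot hη htop, air_eq_coe hη (by rw [hdir]; exact ENNReal.ofReal_ne_top),
      le_bot_iff] at h1
    exact EReal.coe_ne_bot _ h1
  set Dν := meanDivergence P I Dbar p ν ρ with hDν
  have hfinπ : ∀ π, 0 < p π → divergence P I Dbar π ν ρ ≠ ⊤ := by
    intro π hπ htop
    refine hfin (ENNReal.sum_eq_top.2 ⟨π, Finset.mem_univ _, ?_⟩)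
    rw [htop, ENNReal.mul_top (by simpa using hπ)]
  set b := d - Dν.toReal + η * (meanGap P p ν - meanGap P p (Measure.dirac x)) with hb
  -- The mixture does not beat `ν`. Combining this with the expansion of the divergence, dropping
  -- the nonnegative `posteriorGap`, leaves `s` on both sides, and it cancels. The bound `b` does
  -- not depend on `s`.
  have hkey : ∀ s ∈ Set.Ioo (0 : ℝ) 1,
      ∑ π, ENNReal.ofReal (p π) * surprise P I (mixWorld ν x s) π x.1 φs ≠ ⊤ ∧
      (∑ π, ENNReal.ofReal (p π) * surprise P I (mixWorld ν x s) π x.1 φs).toReal ≤ b := by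
    intro s hs
    have hle : meanDivergence P I Dbar p (mixWorld ν x s) ρ + ENNReal.ofReal s *
        ∑ π, ENNReal.ofReal (p π) * surprise P I (mixWorld ν x s) π x.1 φs ≤
        ENNReal.ofReal (1 - s) * Dν + ENNReal.ofReal s * ENNReal.ofReal d := by
      rw [← hdir, hDν]
      simp only [meanDivergence, Finset.mul_sum, ← Finset.sum_add_distrib]
      refine Finset.sum_le_sum fun π _ => ?_
      rcases (hp.1 π).eq_or_lt with hπ | hπ
      · simp [← hπ]
      · have h1 := divergence_mixWorld (P := P) (I := I) hD (h0 π) hν hx hρ hρs hs.1.le hs.2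
          (hev π hπ)
        have h2 := (le_self_add.trans_eq h1)
        rw [divergence_dirac hD (h0 π) hx hρ hρs]
        calc _ = ENNReal.ofReal (p π) * (divergence P I Dbar π (mixWorld ν x s) ρ +
              ENNReal.ofReal s * surprise P I (mixWorld ν x s) π x.1 φs) := by ring
          _ ≤ _ := mul_le_mul_right h2 _
          _ = _ := by ring
    have hR : ENNReal.ofReal (1 - s) * Dν + ENNReal.ofReal s * ENNReal.ofReal d ≠ ⊤ :=
      ENNReal.add_ne_top.2 ⟨ENNReal.mul_ne_top ENNReal.ofReal_ne_top hfin,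
        ENNReal.mul_ne_top ENNReal.ofReal_ne_top ENNReal.ofReal_ne_top⟩
    obtain ⟨f1, f2⟩ := ENNReal.add_ne_top.1 (ne_top_of_le_ne_top hR hle)
    have hopt := h.best_response _ (mixWorld_mem hν hx hs.1.le hs.2.le)
    rw [air_eq_coe hη hfin, air_eq_coe hη f1, EReal.coe_le_coe_iff,
      meanGap_mixWorld hs.1.le hs.2.le] at hopt
    have hle' := ENNReal.toReal_mono hR hle
    have f3 : ∑ π, ENNReal.ofReal (p π) * surprise P I (mixWorld ν x s) π x.1 φs ≠ ⊤ := by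
      intro htop
      rw [htop, ENNReal.mul_top (by simpa using hs.1)] at f2
      exact f2 rfl
    rw [ENNReal.toReal_add f1 f2, ENNReal.toReal_add (ENNReal.mul_ne_top ENNReal.ofReal_ne_top hfin)
      (ENNReal.mul_ne_top ENNReal.ofReal_ne_top ENNReal.ofReal_ne_top), ENNReal.toReal_mul,
      ENNReal.toReal_mul, ENNReal.toReal_mul, ENNReal.toReal_ofReal hs.1.le,
      ENNReal.toReal_ofReal (sub_nonneg.2 hs.2.le), ENNReal.toReal_ofReal hd0] at hle'
    rw [← hDν] at hopt
    set S := ∑ π, ENNReal.ofReal (p π) * surprise P I (mixWorld ν x s) π x.1 φs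
    set Ds := (meanDivergence P I Dbar p (mixWorld ν x s) ρ).toReal
    have h3 : s * (meanGap P p (Measure.dirac x) - meanGap P p ν) ≤ 1 / η * (Ds - Dν.toReal) := by
      linarith
    have h4 : η * (s * (meanGap P p (Measure.dirac x) - meanGap P p ν)) ≤ Ds - Dν.toReal := by
      calc _ ≤ η * (1 / η * (Ds - Dν.toReal)) := by gcongr
        _ = _ := by field_simp
    have h5 : s * S.toReal ≤ s * b := by
      rw [hb]
      linarith
    exact ⟨f3, le_of_mul_le_mul_left h5 hs.1⟩
  have hb0 : 0 ≤ b := ENNReal.toReal_nonneg.trans (hkey (1 / 2) ⟨by norm_num, by norm_num⟩).2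
  have key : ∀ s ∈ Set.Ioo (0 : ℝ) 1,
      ∑ π, ENNReal.ofReal (p π) * surprise P I (mixWorld ν x s) π x.1 φs ≤ ENNReal.ofReal b :=
    fun s hs => (ENNReal.le_ofReal_iff_toReal_le (hkey s hs).1 hb0).2 (hkey s hs).2
  -- Finiteness at `s = 0` comes from Fatou's lemma; only then is dominated convergence available
  -- for the exact limit below.
  have hsur : ∀ π, 0 < p π → surprise P I ν π x.1 φs ≠ ⊤ := by
    intro π hπ
    have hπ' : ENNReal.ofReal (p π) ≠ 0 := by simpa using hπ
    have : surprise P I ν π x.1 φs ≤ (ENNReal.ofReal (p π))⁻¹ * ENNReal.ofReal b := by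
      refine surprise_le_of_forall hν hx (hev π hπ) fun s hs => ?_
      rw [mul_comm, ← div_eq_mul_inv, ENNReal.le_div_iff_mul_le (Or.inl hπ')
        (Or.inl ENNReal.ofReal_ne_top), mul_comm]
      exact (Finset.single_le_sum (f := fun π => ENNReal.ofReal (p π) *
        surprise P I (mixWorld ν x s) π x.1 φs) (fun _ _ => zero_le) (Finset.mem_univ π)).trans
        (key s hs)
    exact ne_top_of_le_ne_top (ENNReal.mul_ne_top (ENNReal.inv_ne_top.2 hπ')
      ENNReal.ofReal_ne_top) this
  refine ⟨hfin, hsur, ?_⟩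
  have hlim : Filter.Tendsto
      (fun s => ∑ π, ENNReal.ofReal (p π) * surprise P I (mixWorld ν x s) π x.1 φs)
      (nhdsWithin 0 (Set.Ioi 0))
      (nhds (∑ π, ENNReal.ofReal (p π) * surprise P I ν π x.1 φs)) := by
    refine tendsto_finsetSum _ fun π _ => ?_
    rcases (hp.1 π).eq_or_lt with hπ | hπ
    · simp [← hπ]
    · exact ENNReal.Tendsto.const_mul (tendsto_surprise hν hx (hev π hπ) (hsur π hπ))
        (Or.inr ENNReal.ofReal_ne_top)
  have hle := le_of_tendsto hlim (eventually_mem_Ioo.mono fun s hs =>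
    key s ⟨hs.1, by linarith [hs.2]⟩)
  have hterm : ∀ π ∈ Finset.univ, ENNReal.ofReal (p π) * surprise P I ν π x.1 φs ≠ ⊤ := by
    intro π _
    rcases (hp.1 π).eq_or_lt with hπ | hπ
    · simp [← hπ]
    · exact ENNReal.mul_ne_top ENNReal.ofReal_ne_top (hsur π hπ)
  have e : (∑ π, ENNReal.ofReal (p π) * surprise P I ν π x.1 φs).toReal =
      ∑ π, p π * (surprise P I ν π x.1 φs).toReal := by
    rw [ENNReal.toReal_sum hterm]
    refine Finset.sum_congr rfl fun π _ => ?_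
    rw [ENNReal.toReal_mul, ENNReal.toReal_ofReal (hp.1 π)]
  rw [← e]
  exact ENNReal.toReal_le_of_le_ofReal hb0 hle

/-- The summand of the estimation term for the policy `π`. -/
lemma IsMinimaxSolution.divergence_sub_bregman (h : IsMinimaxSolution P I Dbar η p ν ρ)
    (hη : 0 < η) (hD : ∀ π φ, Measurable (Dbar π φ)) (h0 : ∀ π φ M, 0 ≤ Dbar π φ M)
    (hx : x ∈ I.set φs) (hρ : ρ ∈ stdSimplex ℝ Φ) (hρs : 0 < ρ φs)
    (hev : ∀ π, 0 < p π → ∀ᵐ o ∂(P.law x.1 π), P.evidence ν π o ≠ 0) :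
    ∑ π, p π * ((divergence P I Dbar π (Measure.dirac x) ρ).toReal -
        bregman (fun ν => divergence P I Dbar π ν ρ) (Measure.dirac x) ν) =
      ∑ π, p π * (pointDivergence Dbar φs π x.1 ρ - (surprise P I ν π x.1 φs).toReal) := by
  obtain ⟨hfin, hsur, -⟩ := h.surprise_le hη hD h0 hx hρ hρs hev
  refine Finset.sum_congr rfl fun π _ => ?_
  rcases (h.p_mem.1 π).eq_or_lt with hπ | hπ
  · simp [← hπ]
  · have hfinπ : divergence P I Dbar π ν ρ ≠ ⊤ := by
      intro htop
      refine hfin (ENNReal.sum_eq_top.2 ⟨π, Finset.mem_univ _, ?_⟩)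
      rw [htop, ENNReal.mul_top (by simpa using hπ)]
    rw [bregman_divergence hD (h0 π) h.ν_mem hx hρ hρs (hev π hπ) hfinπ (hsur π hπ),
      divergence_dirac hD (h0 π) hx hρ hρs,
      ENNReal.toReal_ofReal (pointDivergence_nonneg (h0 π) hρ _)]

/-- The first-order condition divided by `η` and rearranged: the linearization of AIR at `ν`,
evaluated at the point mass, is at most AIR at the maximizer `ν`. -/
lemma IsMinimaxSolution.meanGap_le_digDec (h : IsMinimaxSolution P I Dbar η p ν ρ)
    (hη : 0 < η) (hD : ∀ π φ, Measurable (Dbar π φ)) (h0 : ∀ π φ M, 0 ≤ Dbar π φ M)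
    (hx : x ∈ I.set φs) (hρ : ρ ∈ stdSimplex ℝ Φ) (hρs : 0 < ρ φs)
    (hev : ∀ π, 0 < p π → ∀ᵐ o ∂(P.law x.1 π), P.evidence ν π o ≠ 0) :
    ((∑ π, p π * (P.V x.1 x.2 - P.V x.1 π) -
      (∑ π, p π * (pointDivergence Dbar φs π x.1 ρ - (surprise P I ν π x.1 φs).toReal)) / η : ℝ) :
      EReal) ≤ digDec P I Dbar η := by
  obtain ⟨hfin, -, hle⟩ := h.surprise_le hη hD h0 hx hρ hρs hev
  refine le_trans ?_ (h.air_le_digDec hρ)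
  rw [air_eq_coe hη hfin, EReal.coe_le_coe_iff, ← meanGap_dirac]
  simp only [mul_sub, Finset.sum_sub_distrib]
  have h1 : 1 / η * (∑ π, p π * (surprise P I ν π x.1 φs).toReal) ≤ 1 / η *
      (∑ π, p π * pointDivergence Dbar φs π x.1 ρ - (meanDivergence P I Dbar p ν ρ).toReal +
        η * (meanGap P p ν - meanGap P p (Measure.dirac x))) := by gcongr
  have h2 : 1 / η * (∑ π, p π * pointDivergence Dbar φs π x.1 ρ -
      (meanDivergence P I Dbar p ν ρ).toReal +
        η * (meanGap P p ν - meanGap P p (Measure.dirac x))) =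
      1 / η * ∑ π, p π * pointDivergence Dbar φs π x.1 ρ -
      1 / η * (meanDivergence P I Dbar p ν ρ).toReal +
        (meanGap P p ν - meanGap P p (Measure.dirac x)) := by
    field_simp
  rw [sub_div, div_eq_mul_one_div, div_eq_mul_one_div (∑ π, p π * (surprise P I ν π x.1 φs).toReal),
    mul_comm _ (1 / η), mul_comm _ (1 / η)]
  linarith

/-- A crude form of the first-order condition, used only for integrability: errors are at most `1`,
each mean gap is at most `1` in absolute value, and the divergence of `ν` is nonnegative. -/
lemma IsMinimaxSolution.sum_surprise_le (h : IsMinimaxSolution P I Dbar η p ν ρ)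
    (hη : 0 < η) (hD : ∀ π φ, Measurable (Dbar π φ)) (h0 : ∀ π φ M, 0 ≤ Dbar π φ M)
    (h1 : ∀ π φ M, Dbar π φ M ≤ 1)
    (hx : x ∈ I.set φs) (hρ : ρ ∈ stdSimplex ℝ Φ) (hρs : 0 < ρ φs)
    (hev : ∀ π, 0 < p π → ∀ᵐ o ∂(P.law x.1 π), P.evidence ν π o ≠ 0) :
    ∑ π, ENNReal.ofReal (p π) * surprise P I ν π x.1 φs ≤
      ENNReal.ofReal (-Real.log (ρ φs) + 1 + 2 * η) := by
  obtain ⟨-, hsur, hle⟩ := h.surprise_le hη hD h0 hx hρ hρs hev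
  have := h.ν_mem.1
  have e : ∀ π ∈ Finset.univ, ENNReal.ofReal (p π) * surprise P I ν π x.1 φs =
      ENNReal.ofReal (p π * (surprise P I ν π x.1 φs).toReal) := by
    intro π _
    rcases (h.p_mem.1 π).eq_or_lt with hπ | hπ
    · simp [← hπ]
    · rw [ENNReal.ofReal_mul hπ.le, ENNReal.ofReal_toReal (hsur π hπ)]
  rw [Finset.sum_congr rfl e, ← ENNReal.ofReal_sum_of_nonneg fun π _ =>
    mul_nonneg (h.p_mem.1 π) ENNReal.toReal_nonneg]
  refine ENNReal.ofReal_le_ofReal (hle.trans ?_)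
  have b1 : ∑ π, p π * pointDivergence Dbar φs π x.1 ρ ≤ -Real.log (ρ φs) + 1 := by
    calc _ ≤ ∑ π, p π * (-Real.log (ρ φs) + 1) := Finset.sum_le_sum fun π _ =>
          mul_le_mul_of_nonneg_left (add_le_add le_rfl (sum_mul_le_one (h1 π) hρ _)) (h.p_mem.1 π)
      _ = _ := by rw [← Finset.sum_mul, h.p_mem.2, one_mul]
  have b2 := abs_le.1 (abs_meanGap_le (P := P) (ν := ν) h.p_mem)
  have b3 := abs_le.1 (abs_meanGap_le (P := P) (ν := Measure.dirac x) h.p_mem)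
  have b4 : (0 : ℝ) ≤ (meanDivergence P I Dbar p ν ρ).toReal := ENNReal.toReal_nonneg
  nlinarith [b2.2, b3.1]

end Minimax

/-! ### The mirror-descent step -/

section MirrorDescent

variable {Φ : Type*} [Fintype Φ]

/-- The corrected loss `L + (4γ + 2/β) L²` of the mirror-descent step. -/
def correctedLoss (β γ : ℝ) (L : Φ → ℝ) (φ : Φ) : ℝ := L φ + (4 * γ + 2 * β⁻¹) * L φ ^ 2

/-- For `u = L/β` and `y = (u + 4u²)/2`, the corrected loss is `2βy`. The difference of the two
sides is `u² (2 - (1 + 4u)²/4)`, so the quadratic correction absorbs the term `y²` of the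
exponential. -/
lemma sub_sq_ge_of_abs_le {u : ℝ} (hu : |u| ≤ 1 / 7) :
    |(u + 4 * u ^ 2) / 2| ≤ 1 ∧ u / 2 ≤ (u + 4 * u ^ 2) / 2 - ((u + 4 * u ^ 2) / 2) ^ 2 := by
  obtain ⟨h1, h2⟩ := abs_le.1 hu
  constructor
  · rw [abs_le]; constructor <;> nlinarith
  · have h3 : 0 ≤ 2 - (1 + 4 * u) ^ 2 / 4 := by nlinarith
    have h4 := mul_nonneg (sq_nonneg u) h3
    nlinarith

lemma exp_neg_le {x : ℝ} (hx : |x| ≤ 1) : Real.exp (-x) ≤ 1 - x + x ^ 2 := by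
  have := (abs_le.1 (Real.abs_exp_sub_one_sub_id_le (x := -x) (by rwa [abs_neg]))).2
  nlinarith

/-- Gibbs' inequality relative to `r exp (-y)`, whose total mass is at most `1 - ⟨r, L⟩ / (2β)`
since `exp (-y) ≤ 1 - y + y² ≤ 1 - u/2`. Multiplication by `2β = 1/γ` gives the claim, for every
`r'` and not only for a minimizer. -/
lemma stability {β γ : ℝ} (hβ : 0 < β) (hγ : γ = 1 / (2 * β)) {L r r' : Φ → ℝ}
    (hL : ∀ φ, |L φ| ≤ β / 7) (hr : r ∈ stdSimplex ℝ Φ) (hr' : r' ∈ stdSimplex ℝ Φ)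
    (hac : ∀ φ, r φ = 0 → r' φ = 0) :
    ∑ φ, r φ * L φ ≤ ∑ φ, r' φ * correctedLoss β γ L φ + 1 / γ * klSum r' r := by
  set u : Φ → ℝ := fun φ => L φ / β with hu
  set y : Φ → ℝ := fun φ => (u φ + 4 * u φ ^ 2) / 2 with hy
  have hu7 : ∀ φ, |u φ| ≤ 1 / 7 := fun φ => by
    rw [hu]
    simp only [abs_div, abs_of_pos hβ]
    rw [div_le_iff₀ hβ]
    linarith [hL φ]
  have e1 : ∀ φ, correctedLoss β γ L φ = 2 * β * y φ := fun φ => by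
    simp only [correctedLoss, hy, hu, hγ]
    field_simp
    ring
  have e2 : ∀ φ, L φ = 2 * β * (u φ / 2) := fun φ => by
    simp only [hu]
    field_simp
  have e3 : 1 / γ = 2 * β := by rw [hγ, one_div_one_div]
  have e4 : klSum r' (fun φ => r φ * Real.exp (-y φ)) = ∑ φ, r' φ * y φ + klSum r' r := by
    simp only [klSum, ← Finset.sum_add_distrib]
    refine Finset.sum_congr rfl fun φ _ => ?_
    rcases (hr'.1 φ).eq_or_lt with h | h
    · simp [← h]
    · have hrp : r φ ≠ 0 := fun h' => h.ne' (hac φ h')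
      rw [← div_div, Real.log_div (div_pos h (lt_of_le_of_ne (hr.1 φ) hrp.symm)).ne'
        (Real.exp_pos _).ne', Real.log_exp]
      ring
  have h1 := sum_sub_sum_le_klSum (a := r') (b := fun φ => r φ * Real.exp (-y φ)) hr'.1
    (fun φ => mul_nonneg (hr.1 φ) (Real.exp_pos _).le)
    (fun φ h => hac φ ((mul_eq_zero.1 h).resolve_right (Real.exp_pos _).ne'))
  rw [e4, hr'.2] at h1
  have h2 : ∑ φ, r φ * Real.exp (-y φ) ≤ ∑ φ, (r φ - r φ * (u φ / 2)) := by
    refine Finset.sum_le_sum fun φ _ => ?_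
    have h3 := sub_sq_ge_of_abs_le (hu7 φ)
    have h4 := exp_neg_le h3.1
    have h5 := mul_le_mul_of_nonneg_left (h4.trans
      (by linarith [h3.2] : _ ≤ 1 - u φ / 2)) (hr.1 φ)
    simp only [hy]
    linarith
  rw [Finset.sum_sub_distrib, hr.2] at h2
  have h3 : ∑ φ, r φ * (u φ / 2) ≤ ∑ φ, r' φ * y φ + klSum r' r := by linarith
  have h4 := mul_le_mul_of_nonneg_left h3 (by positivity : 0 ≤ 2 * β)
  rw [e3]
  calc ∑ φ, r φ * L φ = 2 * β * ∑ φ, r φ * (u φ / 2) := by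
        rw [Finset.mul_sum]
        exact Finset.sum_congr rfl fun φ _ => by rw [e2 φ]; ring
    _ ≤ _ := h4
    _ = _ := by
        rw [mul_add, Finset.mul_sum]
        congr 1
        exact Finset.sum_congr rfl fun φ _ => by rw [e1 φ]; ring

/-- A minimizer `r'` of a linear function plus a sum of relative entropies has
`c log (1 / r' φs) ≤ G(δ_φs) - G(r')`, where `c` is the total weight of the entropies. -/
lemma neg_log_le_of_isMinOn {ι : Type*} {s : Finset ι} {w : ι → ℝ} (hw : ∀ i ∈ s, 0 ≤ w i)
    (hws : 0 < ∑ i ∈ s, w i) {v : ι → Φ → ℝ} (hv : ∀ i ∈ s, v i ∈ stdSimplex ℝ Φ) {φs : Φ}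
    (hvs : ∀ i ∈ s, 0 < v i φs) {l r' : Φ → ℝ} (hr' : r' ∈ stdSimplex ℝ Φ)
    (hmin : IsMinOn (fun ρ : Φ → ℝ => ((∑ φ, ρ φ * l φ : ℝ) : EReal) +
      ((∑ i ∈ s, ENNReal.ofReal (w i) * kl ρ (v i) : ℝ≥0∞) : EReal)) (stdSimplex ℝ Φ) r') :
    0 < r' φs ∧ ∑ i ∈ s, ENNReal.ofReal (w i) * kl r' (v i) ≠ ⊤ ∧
      (∑ i ∈ s, w i) * -Real.log (r' φs) ≤ l φs + ∑ i ∈ s, w i * -Real.log (v i φs) -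
        (∑ φ, r' φ * l φ + (∑ i ∈ s, ENNReal.ofReal (w i) * kl r' (v i)).toReal) := by
  set E : (Φ → ℝ) → ℝ≥0∞ := fun ρ => ∑ i ∈ s, ENNReal.ofReal (w i) * kl ρ (v i) with hE
  set c := ∑ i ∈ s, w i with hc
  have hvlog : ∀ i ∈ s, 0 ≤ w i * -Real.log (v i φs) := fun i hi =>
    mul_nonneg (hw i hi) (neg_nonneg.2 (Real.log_nonpos (hvs i hi).le
      (le_one_of_mem_stdSimplex (hv i hi) φs)))
  have hδ : E (pointMass φs) = ENNReal.ofReal (∑ i ∈ s, w i * -Real.log (v i φs)) := by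
    rw [ENNReal.ofReal_sum_of_nonneg hvlog]
    refine Finset.sum_congr rfl fun i hi => ?_
    rw [kl_pointMass (hvs i hi).le, negLog_of_pos (hvs i hi), ENNReal.ofReal_mul (hw i hi)]
  set d := ∑ i ∈ s, w i * -Real.log (v i φs) with hd
  have hd0 : 0 ≤ d := Finset.sum_nonneg hvlog
  have hfin : E r' ≠ ⊤ := by
    intro htop
    have h1 := isMinOn_iff.1 hmin _ (pointMass_mem φs)
    change ((∑ φ, r' φ * l φ : ℝ) : EReal) + ((E r' : ℝ≥0∞) : EReal) ≤
      ((∑ φ, pointMass φs φ * l φ : ℝ) : EReal) + ((E (pointMass φs) : ℝ≥0∞) : EReal) at h1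
    rw [htop, hδ, EReal.coe_ennreal_top, EReal.coe_add_top, top_le_iff,
      ← EReal.coe_ennreal_toReal ENNReal.ofReal_ne_top, ← EReal.coe_add] at h1
    exact EReal.coe_ne_top _ h1
  set B := l φs + d - (∑ φ, r' φ * l φ + (E r').toReal) with hB
  -- Moving from `r'` towards `δ_φs` does not decrease the objective. By the compensation identity
  -- each entropy gains strong convexity in the form of `t` times the log loss of the mixture;
  -- division by `t` yields a bound uniform in `t`.
  have key : ∀ t ∈ Set.Ioo (0 : ℝ) 1, c * -Real.log (mix φs t r' φs) ≤ B := by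
    intro t ht
    have hm := mix_mem (φs := φs) hr' ht.1.le ht.2.le
    have hmp : 0 < mix φs t r' φs := by
      rw [mix_self]
      have := mul_nonneg (sub_nonneg.2 ht.2.le) (hr'.1 φs)
      linarith [ht.1]
    have hlog : 0 ≤ -Real.log (mix φs t r' φs) :=
      neg_nonneg.2 (Real.log_nonpos hmp.le (le_one_of_mem_stdSimplex hm φs))
    have hle : E (mix φs t r') + ENNReal.ofReal (t * (c * -Real.log (mix φs t r' φs))) ≤
        ENNReal.ofReal (1 - t) * E r' + ENNReal.ofReal (t * d) := by
      have e1 : ENNReal.ofReal (t * (c * -Real.log (mix φs t r' φs))) =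
          ∑ i ∈ s, ENNReal.ofReal (w i) * (ENNReal.ofReal t * negLog (mix φs t r' φs)) := by
        rw [← Finset.sum_mul, ← ENNReal.ofReal_sum_of_nonneg hw, negLog_of_pos hmp,
          ← ENNReal.ofReal_mul ht.1.le, ← ENNReal.ofReal_mul hws.le]
        congr 1; ring
      have e2 : ENNReal.ofReal (t * d) =
          ∑ i ∈ s, ENNReal.ofReal (w i) * (ENNReal.ofReal t * negLog (v i φs)) := by
        rw [hd, Finset.mul_sum, ENNReal.ofReal_sum_of_nonneg fun i hi =>
          mul_nonneg ht.1.le (hvlog i hi)]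
        refine Finset.sum_congr rfl fun i hi => ?_
        rw [negLog_of_pos (hvs i hi), ← ENNReal.ofReal_mul ht.1.le, ← ENNReal.ofReal_mul (hw i hi)]
        congr 1; ring
      rw [e1, e2, hE]
      simp only [Finset.mul_sum, ← Finset.sum_add_distrib]
      refine Finset.sum_le_sum fun i hi => ?_
      have h1 := kl_mix hr' (hv i hi) (hvs i hi) ht.1.le ht.2
      rw [mul_left_comm (ENNReal.ofReal (1 - t)), ← mul_add, ← mul_add, ← h1]
      exact mul_le_mul_right le_self_add _
    have hR : ENNReal.ofReal (1 - t) * E r' + ENNReal.ofReal (t * d) ≠ ⊤ :=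
      ENNReal.add_ne_top.2 ⟨ENNReal.mul_ne_top ENNReal.ofReal_ne_top hfin, ENNReal.ofReal_ne_top⟩
    obtain ⟨f1, f2⟩ := ENNReal.add_ne_top.1 (ne_top_of_le_ne_top hR hle)
    have h1 := isMinOn_iff.1 hmin _ hm
    change ((∑ φ, r' φ * l φ : ℝ) : EReal) + ((E r' : ℝ≥0∞) : EReal) ≤
      ((∑ φ, mix φs t r' φ * l φ : ℝ) : EReal) + ((E (mix φs t r') : ℝ≥0∞) : EReal) at h1
    rw [← EReal.coe_ennreal_toReal hfin, ← EReal.coe_ennreal_toReal f1, ← EReal.coe_add,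
      ← EReal.coe_add, EReal.coe_le_coe_iff] at h1
    have h2 := ENNReal.toReal_mono hR hle
    rw [ENNReal.toReal_add f1 f2, ENNReal.toReal_add
      (ENNReal.mul_ne_top ENNReal.ofReal_ne_top hfin) ENNReal.ofReal_ne_top, ENNReal.toReal_mul,
      ENNReal.toReal_ofReal (sub_nonneg.2 ht.2.le),
      ENNReal.toReal_ofReal (mul_nonneg ht.1.le (mul_nonneg hws.le hlog)),
      ENNReal.toReal_ofReal (mul_nonneg ht.1.le hd0)] at h2
    have h3 : ∑ φ, mix φs t r' φ * l φ = (1 - t) * ∑ φ, r' φ * l φ + t * l φs := by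
      classical
      simp only [mix, add_mul, Finset.sum_add_distrib, ite_mul, zero_mul, Finset.sum_ite_eq',
        Finset.mem_univ, if_true, Finset.mul_sum, mul_assoc]
    rw [h3] at h1
    refine le_of_mul_le_mul_left (a := t) ?_ ht.1
    rw [hB]
    linarith
  -- The limit `t → 0` is taken in exponential form, because positivity of `r' φs` is itself part of
  -- the conclusion and `Real.log 0 = 0` carries no information.
  have hexp : Real.exp (-(B / c)) ≤ r' φs := by
    have hlim : Filter.Tendsto (fun t => mix φs t r' φs) (nhdsWithin 0 (Set.Ioi 0))
        (nhds (r' φs)) := by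
      simp only [mix_self]
      have : ContinuousAt (fun t : ℝ => (1 - t) * r' φs + t) 0 := by fun_prop
      simpa using this.tendsto.mono_left nhdsWithin_le_nhds
    refine ge_of_tendsto hlim ?_
    filter_upwards [eventually_mem_Ioo] with t ht
    have h1 := key t ⟨ht.1, by linarith [ht.2]⟩
    have hmp : 0 < mix φs t r' φs := by
      rw [mix_self]
      have := mul_nonneg (by linarith [ht.2] : 0 ≤ 1 - t) (hr'.1 φs)
      linarith [ht.1]
    rw [← Real.le_log_iff_exp_le hmp, neg_le, le_div_iff₀ hws]
    linarith
  have hpos := (Real.exp_pos _).trans_le hexp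
  refine ⟨hpos, hfin, ?_⟩
  rw [← Real.le_log_iff_exp_le hpos, neg_le, le_div_iff₀ hws] at hexp
  linarith

/-- Optimality tested against `δ_φs` leaves minus the objective at `r'` on the right. Its corrected
loss together with `KL(r', r) / γ` is at least `⟨r, L⟩` by `stability`; the entropies of `r'`
relative to the posteriors are dropped. -/
theorem mirrorDescent_step {β γ : ℝ} (hβ : 0 < β) (hγ : γ = 1 / (2 * β)) {L r r' : Φ → ℝ}
    (hL : ∀ φ, |L φ| ≤ β / 7) (hr : r ∈ stdSimplex ℝ Φ) (hr' : r' ∈ stdSimplex ℝ Φ)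
    {φs : Φ} (hrs : 0 < r φs) {s : Finset ℕ} {v : ℕ → Φ → ℝ}
    (hv : ∀ i ∈ s, v i ∈ stdSimplex ℝ Φ) (hvs : ∀ i ∈ s, 0 < v i φs)
    (hmin : IsMinOn (mdObjective β γ L (fun ρ => ∑ t ∈ s, kl ρ (v t)) r) (stdSimplex ℝ Φ) r') :
    0 < r' φs ∧ (s.card + 1 / γ) * -Real.log (r' φs) ≤
      L φs + 4 / β * L φs ^ 2 + ∑ t ∈ s, -Real.log (v t φs) + 1 / γ * -Real.log (r φs) -
        ∑ φ, r φ * L φ := by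
  have hγ0 : 0 < 1 / γ := by rw [hγ, one_div_one_div]; positivity
  -- The index `none` stands for the proximal entropy relative to `r`, with weight `1/γ`; `some t`
  -- stands for the posterior of round `t`, with weight `1`.
  set w : Option ℕ → ℝ := fun i => i.elim (1 / γ) fun _ => 1 with hw
  set v' : Option ℕ → Φ → ℝ := fun i => i.elim r v with hv'
  have hsum : ∀ f : Option ℕ → ℝ, ∑ i ∈ Finset.insertNone s, f i = f none + ∑ t ∈ s, f (some t) :=
    fun f => Finset.sum_insertNone f s
  have hsum' : ∀ f : Option ℕ → ℝ≥0∞,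
      ∑ i ∈ Finset.insertNone s, f i = f none + ∑ t ∈ s, f (some t) :=
    fun f => Finset.sum_insertNone f s
  have hforall : ∀ {q : Option ℕ → Prop}, q none → (∀ t ∈ s, q (some t)) →
      ∀ i ∈ Finset.insertNone s, q i := by
    intro q h1 h2 i hi
    rcases i with _ | t
    · exact h1
    · exact h2 t (by simpa using hi)
  have hwsum : ∑ i ∈ Finset.insertNone s, w i = s.card + 1 / γ := by
    rw [hsum]; simp [hw, add_comm]
  have hmin' : IsMinOn (fun ρ : Φ → ℝ => ((∑ φ, ρ φ * correctedLoss β γ L φ : ℝ) : EReal) +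
      ((∑ i ∈ Finset.insertNone s, ENNReal.ofReal (w i) * kl ρ (v' i) : ℝ≥0∞) : EReal))
      (stdSimplex ℝ Φ) r' := by
    have e : mdObjective β γ L (fun ρ => ∑ t ∈ s, kl ρ (v t)) r =
        fun ρ : Φ → ℝ => ((∑ φ, ρ φ * correctedLoss β γ L φ : ℝ) : EReal) +
      ((∑ i ∈ Finset.insertNone s, ENNReal.ofReal (w i) * kl ρ (v' i) : ℝ≥0∞) : EReal) := by
      ext ρ
      rw [mdObjective, hsum']
      simp only [hw, hv', Option.elim, ENNReal.ofReal_one, one_mul, correctedLoss]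
      rw [add_comm (∑ t ∈ s, kl ρ (v t))]
    rwa [e] at hmin
  obtain ⟨h1, h2, h3⟩ := neg_log_le_of_isMinOn (w := w) (v := v') (φs := φs)
    (hforall hγ0.le fun _ _ => zero_le_one) (by rw [hwsum]; positivity)
    (hforall hr hv) (hforall hrs hvs) hr' hmin'
  refine ⟨h1, ?_⟩
  rw [hwsum, hsum] at h3
  simp only [hw, hv', Option.elim, one_mul] at h3
  have hkl : kl r' r ≠ ⊤ := by
    rw [hsum'] at h2
    have h4 := (ENNReal.add_ne_top.1 h2).1
    intro htop
    simp only [hw, hv', Option.elim, htop] at h4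
    rw [ENNReal.mul_top (by simpa using hγ0)] at h4
    exact h4 rfl
  have hac := kl_ne_top_iff.1 hkl
  have h5 : 1 / γ * klSum r' r ≤
      (∑ i ∈ Finset.insertNone s, ENNReal.ofReal (w i) * kl r' (v' i)).toReal := by
    have h6 : ENNReal.ofReal (1 / γ) * kl r' r ≤
        ∑ i ∈ Finset.insertNone s, ENNReal.ofReal (w i) * kl r' (v' i) := by
      rw [hsum']
      exact le_self_add
    have h7 := ENNReal.toReal_mono h2 h6
    rwa [ENNReal.toReal_mul, ENNReal.toReal_ofReal hγ0.le, toReal_kl hr' hr hac] at h7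
  have h8 := stability hβ hγ hL hr hr' hac
  have h9 : correctedLoss β γ L φs = L φs + 4 / β * L φs ^ 2 := by
    rw [correctedLoss, hγ]
    field_simp
    ring
  simp only [hw, hv', Option.elim] at h5
  linarith

end MirrorDescent

/-! ### Conditional laws -/

section Conditional

variable {Ω Ω' 𝒴 : Type*} {m mΩ : MeasurableSpace Ω} [MeasurableSpace Ω'] [MeasurableSpace 𝒴]
  {μ : Measure Ω} [IsProbabilityMeasure μ]

lemma measure_inter_eq_lintegral (hm : m ≤ mΩ) {A B : Set Ω} (hA : MeasurableSet[m] A)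
    (hB : MeasurableSet B) {f : Ω → ℝ} (hf : μ⟦B | m⟧ =ᵐ[μ] f) :
    μ (A ∩ B) = ∫⁻ ω in A, ENNReal.ofReal (f ω) ∂μ := by
  have h1 : Integrable (B.indicator fun _ => (1 : ℝ)) μ := (integrable_const 1).indicator hB
  have h2 := setIntegral_condExp hm h1 hA
  have hfi : Integrable f μ := integrable_condExp.congr hf
  have hf0 : 0 ≤ᵐ[μ] f := by
    have := condExp_nonneg (μ := μ) (m := m) (f := B.indicator fun _ => (1 : ℝ))
      (Filter.Eventually.of_forall fun ω => Set.indicator_nonneg (fun _ _ => zero_le_one) ω)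
    filter_upwards [this, hf] with ω h1 h2
    rwa [← h2]
  rw [setIntegral_congr_ae (hm _ hA) (hf.mono fun ω h _ => h), integral_indicator hB,
    setIntegral_const, smul_eq_mul, mul_one] at h2
  rw [← ofReal_integral_eq_lintegral_ofReal hfi.integrableOn (ae_restrict_of_ae hf0), h2,
    ofReal_measureReal, Measure.restrict_apply hB, Set.inter_comm]

/-- The joint law of `X` and `Y`, when `Y` has the conditional law `κ (X)` given `m`. -/
lemma map_prodMk_eq_compProd (hm : m ≤ mΩ) {X : Ω → Ω'} {Y : Ω → 𝒴} (hX : Measurable[m] X)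
    (hY : Measurable Y) (κ : Kernel Ω' 𝒴) [IsMarkovKernel κ]
    (h : ∀ S, MeasurableSet S → μ⟦Y ⁻¹' S | m⟧ =ᵐ[μ] fun ω => (κ (X ω)).real S) :
    μ.map (fun ω => (X ω, Y ω)) = μ.map X ⊗ₘ κ := by
  have hX' : Measurable X := hX.mono hm le_rfl
  have := Measure.isProbabilityMeasure_map (μ := μ) (hX'.prodMk hY).aemeasurable
  have := Measure.isProbabilityMeasure_map (μ := μ) hX'.aemeasurable
  refine Measure.ext_prod fun {A S} hA hS => ?_
  rw [Measure.compProd_apply_prod hA hS, Measure.map_apply (hX'.prodMk hY) (hA.prod hS),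
    setLIntegral_map hA (κ.measurable_coe hS) hX']
  have h1 := measure_inter_eq_lintegral hm (hX hA) (hY hS) (h S hS)
  have e : ∀ ω, ENNReal.ofReal ((κ (X ω)).real S) = κ (X ω) S := fun ω => ofReal_measureReal
  simp only [e] at h1
  rw [← h1]
  rfl

lemma lintegral_prodMk_eq (hm : m ≤ mΩ) {X : Ω → Ω'} {Y : Ω → 𝒴} (hX : Measurable[m] X)
    (hY : Measurable Y) (κ : Kernel Ω' 𝒴) [IsMarkovKernel κ]
    (h : ∀ S, MeasurableSet S → μ⟦Y ⁻¹' S | m⟧ =ᵐ[μ] fun ω => (κ (X ω)).real S)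
    {f : Ω' × 𝒴 → ℝ≥0∞} (hf : Measurable f) :
    ∫⁻ ω, f (X ω, Y ω) ∂μ = ∫⁻ ω, ∫⁻ y, f (X ω, y) ∂(κ (X ω)) ∂μ := by
  have hX' : Measurable X := hX.mono hm le_rfl
  have := Measure.isProbabilityMeasure_map (μ := μ) hX'.aemeasurable
  rw [← lintegral_map hf (hX'.prodMk hY), map_prodMk_eq_compProd hm hX hY κ h,
    Measure.lintegral_compProd hf, lintegral_map hf.lintegral_kernel_prod_right' hX']

lemma integral_prodMk_eq (hm : m ≤ mΩ) {X : Ω → Ω'} {Y : Ω → 𝒴} (hX : Measurable[m] X)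
    (hY : Measurable Y) (κ : Kernel Ω' 𝒴) [IsMarkovKernel κ]
    (h : ∀ S, MeasurableSet S → μ⟦Y ⁻¹' S | m⟧ =ᵐ[μ] fun ω => (κ (X ω)).real S)
    {f : Ω' × 𝒴 → ℝ} (hf : Measurable f) (hfi : Integrable (fun ω => f (X ω, Y ω)) μ) :
    ∫ ω, f (X ω, Y ω) ∂μ = ∫ ω, ∫ y, f (X ω, y) ∂(κ (X ω)) ∂μ := by
  have hX' : Measurable X := hX.mono hm le_rfl
  have := Measure.isProbabilityMeasure_map (μ := μ) hX'.aemeasurable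
  have hi : Integrable f (μ.map X ⊗ₘ κ) := by
    rw [← map_prodMk_eq_compProd hm hX hY κ h]
    exact (integrable_map_measure hf.aestronglyMeasurable (hX'.prodMk hY).aemeasurable).2 hfi
  rw [← integral_map (hX'.prodMk hY).aemeasurable hf.aestronglyMeasurable,
    map_prodMk_eq_compProd hm hX hY κ h, Measure.integral_compProd hi,
    integral_map hX'.aemeasurable]
  exact hf.stronglyMeasurable.integral_kernel_prod_right'.aestronglyMeasurable

variable [Fintype 𝒴] [MeasurableSingletonClass 𝒴]

lemma lintegral_finite_eq (hm : m ≤ mΩ) {Y : Ω → 𝒴} (hY : Measurable Y) {p : Ω → 𝒴 → ℝ}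
    (hp : Measurable p) (h : ∀ y, μ⟦Y ⁻¹' {y} | m⟧ =ᵐ[μ] fun ω => p ω y)
    {G : 𝒴 → Ω → ℝ≥0∞} (hG : ∀ y, Measurable[m] (G y)) :
    ∫⁻ ω, G (Y ω) ω ∂μ = ∫⁻ ω, ∑ y, ENNReal.ofReal (p ω y) * G y ω ∂μ := by
  classical
  have hG' : ∀ y, Measurable (G y) := fun y => (hG y).mono hm le_rfl
  have hpm : ∀ y, Measurable fun ω => ENNReal.ofReal (p ω y) := fun y =>
    ((measurable_pi_apply y).comp hp).ennreal_ofReal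
  have hpG : ∀ y, Measurable fun ω => ENNReal.ofReal (p ω y) * G y ω := fun y =>
    (hpm y).mul (hG' y)
  rw [lintegral_finsetSum _ fun y _ => hpG y]
  have e : ∀ ω, G (Y ω) ω = ∑ y, (Y ⁻¹' {y}).indicator (G y) ω := by
    intro ω
    rw [Finset.sum_eq_single (Y ω)]
    · simp
    · intro y _ hy
      simp [hy.symm]
    · simp
  have hYs : ∀ y, MeasurableSet (Y ⁻¹' {y}) := fun y => hY (measurableSet_singleton y)
  simp_rw [e]
  rw [lintegral_finsetSum _ fun y _ => (hG' y).indicator (hYs y)]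
  refine Finset.sum_congr rfl fun y _ => ?_
  -- The event `Y = y` and the density `p y` define the same measure on `m`, which suffices for
  -- `m`-measurable `G`, bounded or not.
  have ht : (μ.restrict (Y ⁻¹' {y})).trim hm =
      (μ.withDensity fun ω => ENNReal.ofReal (p ω y)).trim hm := by
    refine @Measure.ext _ m _ _ fun A hA => ?_
    rw [trim_measurableSet_eq hm hA, trim_measurableSet_eq hm hA,
      withDensity_apply _ (hm _ hA), Measure.restrict_apply (hm _ hA),
      measure_inter_eq_lintegral hm hA (hYs y) (h y)]
  rw [lintegral_indicator (hYs y), ← lintegral_trim hm (hG y), ht, lintegral_trim hm (hG y),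
    lintegral_withDensity_eq_lintegral_mul _ (hpm y) (hG' y)]
  rfl

lemma integral_finite_eq (hm : m ≤ mΩ) {Y : Ω → 𝒴} (hY : Measurable Y) {p : Ω → 𝒴 → ℝ}
    (h : ∀ y, μ⟦Y ⁻¹' {y} | m⟧ =ᵐ[μ] fun ω => p ω y)
    {G : 𝒴 → Ω → ℝ} (hG : ∀ y, Measurable[m] (G y)) (hGi : ∀ y, Integrable (G y) μ) :
    Integrable (fun ω => G (Y ω) ω) μ ∧ (∀ y, Integrable (fun ω => p ω y * G y ω) μ) ∧
    ∫ ω, G (Y ω) ω ∂μ = ∫ ω, ∑ y, p ω y * G y ω ∂μ := by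
  classical
  have hYs : ∀ y, MeasurableSet (Y ⁻¹' {y}) := fun y => hY (measurableSet_singleton y)
  have e : (fun ω => G (Y ω) ω) = fun ω => ∑ y, (Y ⁻¹' {y}).indicator (G y) ω := by
    ext ω
    rw [Finset.sum_eq_single (Y ω)]
    · simp
    · intro y _ hy
      simp [hy.symm]
    · simp
  have hi : ∀ y, Integrable ((Y ⁻¹' {y}).indicator (G y)) μ := fun y => (hGi y).indicator (hYs y)
  have hprod : ∀ y, (Y ⁻¹' {y}).indicator (G y) = G y * (Y ⁻¹' {y}).indicator fun _ => (1 : ℝ) := by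
    intro y
    ext ω
    by_cases hω : ω ∈ Y ⁻¹' {y} <;> simp [hω]
  have hcond : ∀ y, μ[(Y ⁻¹' {y}).indicator (G y) | m] =ᵐ[μ] fun ω => p ω y * G y ω := by
    intro y
    have h1 : Integrable ((Y ⁻¹' {y}).indicator fun _ => (1 : ℝ)) μ :=
      (integrable_const 1).indicator (hYs y)
    have h2 := condExp_mul_of_stronglyMeasurable_left (μ := μ) (m := m)
      (hG y).stronglyMeasurable (by rw [← hprod]; exact hi y) h1
    rw [hprod]
    filter_upwards [h2, h y] with ω h3 h4
    rw [h3, Pi.mul_apply, mul_comm, ← h4]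
  have hpi : ∀ y, Integrable (fun ω => p ω y * G y ω) μ := fun y =>
    integrable_condExp.congr (hcond y)
  refine ⟨e ▸ integrable_finsetSum _ fun y _ => hi y, hpi, ?_⟩
  rw [e, integral_finsetSum _ fun y _ => hi y, integral_finsetSum _ fun y _ => hpi y]
  refine Finset.sum_congr rfl fun y _ => ?_
  rw [← integral_condExp hm, integral_congr_ae (hcond y)]

end Conditional

/-! ### Joint measurability -/

section JointMeasurability

variable {Mdl Pol Obs Φ : Type*} [MeasurableSpace Mdl] [MeasurableSpace Pol] [MeasurableSpace Obs]
  (P : DMSO Mdl Pol Obs) (I : InfoSets Mdl Pol Φ)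

/-- The observation distributions as a kernel. -/
def DMSO.lawKernel : Kernel (Mdl × Pol) Obs :=
  have := P.sigmaFinite_ref
  Kernel.withDensity (Kernel.const _ P.ref) fun x => P.dens x.1 x.2

lemma DMSO.lawKernel_apply (x : Mdl × Pol) : P.lawKernel x = P.law x.1 x.2 := by
  have := P.sigmaFinite_ref
  rw [DMSO.lawKernel, Kernel.withDensity_apply _ P.measurable_dens, Kernel.const_apply]
  rfl

instance DMSO.isMarkovKernel_lawKernel : IsMarkovKernel P.lawKernel :=
  ⟨fun x => by rw [P.lawKernel_apply]; exact P.isProbabilityMeasure_law _ _⟩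

lemma DMSO.measurable_lintegral_law {α : Type*} [MeasurableSpace α] {f : α × Obs → ℝ≥0∞}
    (hf : Measurable f) {g : α → Mdl × Pol} (hg : Measurable g) :
    Measurable fun a => ∫⁻ o, f (a, o) ∂(P.law (g a).1 (g a).2) := by
  have := hf.lintegral_kernel_prod_right' (κ := P.lawKernel.comap g hg)
  simpa only [Kernel.comap_apply, P.lawKernel_apply] using this

lemma DMSO.measurable_integral_law {f : Obs → ℝ} (hf : Measurable f) :
    Measurable fun x : Mdl × Pol => ∫ o, f o ∂(P.law x.1 x.2) := by
  have h : StronglyMeasurable fun x : (Mdl × Pol) × Obs => f x.2 :=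
    (hf.comp measurable_snd).stronglyMeasurable
  have := (h.integral_kernel_prod_right' (κ := P.lawKernel)).measurable
  simpa only [P.lawKernel_apply] using this

/-- The kernel that returns its argument if it is a probability measure, and `0` if not. -/
def probKernel (X : Type*) [MeasurableSpace X] : Kernel (Measure X) X where
  toFun ν := open Classical in if ν Set.univ = 1 then ν else 0
  measurable' := by
    classical
    exact Measurable.ite (measurableSet_eq_fun (Measure.measurable_coe MeasurableSet.univ)
      measurable_const) measurable_id measurable_const

lemma probKernel_apply {X : Type*} [MeasurableSpace X] (ν : Measure X) [IsProbabilityMeasure ν] :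
    probKernel X ν = ν := by
  change (if ν Set.univ = 1 then ν else 0) = ν
  rw [if_pos measure_univ]

instance (X : Type*) [MeasurableSpace X] : IsFiniteKernel (probKernel X) := by
  classical
  refine ⟨1, ENNReal.one_lt_top, fun ν => ?_⟩
  change (if ν Set.univ = 1 then ν else 0) Set.univ ≤ 1
  split_ifs with h
  · exact h.le
  · simp

/-- The log loss of the posterior probability of `φs` as a function of the world distribution, the
model, the policy and the observation. -/
def logLoss (φs : Φ) (w : (Measure (Mdl × Pol) × (Mdl × Pol)) × Obs) : ℝ≥0∞ :=
  negLog (posterior P I (probKernel _ w.1.1) w.1.2.2 w.2 φs)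

lemma measurable_lintegral_dens {f : (Mdl × Pol) × (Pol × Obs) → ℝ≥0∞} (hf : Measurable f) :
    Measurable fun w : (Measure (Mdl × Pol) × (Mdl × Pol)) × Obs =>
      ∫⁻ x, f (x, (w.1.2.2, w.2)) ∂(probKernel _ w.1.1) := by
  have h : Measurable fun y : ((Measure (Mdl × Pol) × (Mdl × Pol)) × Obs) × (Mdl × Pol) =>
      f (y.2, (y.1.1.2.2, y.1.2)) := hf.comp (by fun_prop)
  exact h.lintegral_kernel_prod_right' (κ := (probKernel (Mdl × Pol)).comap
    (fun w : (Measure (Mdl × Pol) × (Mdl × Pol)) × Obs => w.1.1) (by fun_prop))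

/-- The world distribution `ν_k` is random, so conditioning needs measurability jointly in the
measure. `probKernel` makes evaluation at a measure a finite kernel, to which measurability of
parametric integrals applies. -/
lemma measurable_logLoss (φs : Φ) : Measurable (logLoss P I φs) := by
  have hd : Measurable fun y : (Mdl × Pol) × (Pol × Obs) => P.dens y.1.1 y.2.1 y.2.2 :=
    P.measurable_dens.comp (f := fun y : (Mdl × Pol) × (Pol × Obs) => ((y.1.1, y.2.1), y.2.2))
      (by fun_prop)
  have h1 := measurable_lintegral_dens hd
  have h2 := measurable_lintegral_dens (hd.indicator ((I.measurableSet_set φs).preimage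
    measurable_fst))
  have e : logLoss P I φs = fun w => negLog ((∫⁻ x, ((fun y : (Mdl × Pol) × (Pol × Obs) => y.1) ⁻¹'
      I.set φs).indicator (fun y => P.dens y.1.1 y.2.1 y.2.2) (x, (w.1.2.2, w.2))
      ∂(probKernel _ w.1.1)) / P.evidence (probKernel _ w.1.1) w.1.2.2 w.2).toReal := by
    ext w
    rw [logLoss, posterior_eq, jointDensity_eq_indicator]
    rfl
  rw [e]
  exact measurable_negLog.comp (h2.div h1).ennreal_toReal

lemma logLoss_eq (φs : Φ) (ν : Measure (Mdl × Pol)) [IsProbabilityMeasure ν] (M : Mdl) (π : Pol)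
    (o : Obs) : logLoss P I φs ((ν, (M, π)), o) = negLog (posterior P I ν π o φs) := by
  rw [logLoss, probKernel_apply]

lemma measurable_lintegral_logLoss (φs : Φ) :
    Measurable fun w : Measure (Mdl × Pol) × (Mdl × Pol) =>
      ∫⁻ o, logLoss P I φs (w, o) ∂(P.law w.2.1 w.2.2) :=
  P.measurable_lintegral_law (measurable_logLoss P I φs) measurable_snd

lemma lintegral_logLoss_eq (φs : Φ) (ν : Measure (Mdl × Pol)) [IsProbabilityMeasure ν] (M : Mdl)
    (π : Pol) : ∫⁻ o, logLoss P I φs ((ν, (M, π)), o) ∂(P.law M π) = surprise P I ν π M φs := by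
  simp only [logLoss_eq, surprise]

end JointMeasurability

/-! ### Sample means -/

section SampleMean

variable {Obs Φ : Type*} {H N : ℕ} {ℓ : Fin H → Φ → Obs → Fin N → ℝ} {B : ℝ} {τ k : ℕ}

/-- The mean of `ℓ_h(φ; o_t)_j` over the rounds in `s`. -/
def sampleMean (ℓ : Fin H → Φ → Obs → Fin N → ℝ) (s : Finset ℕ) (h : Fin H) (φ : Φ) (j : Fin N)
    (o : ℕ → Obs) : ℝ := (1 / (s.card : ℝ)) * ∑ t ∈ s, ℓ h φ (o t) j

lemma lossEst_eq (o : ℕ → Obs) (φ : Φ) : lossEst ℓ B τ k o φ =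
    ∑ j, (τ : ℝ) / (B ^ 2 * H) * ∑ h, sampleMean ℓ (epochFst τ k) h φ j o *
      sampleMean ℓ (epochSnd τ k) h φ j o := rfl

end SampleMean

/-! ### Bounds for the estimation functions -/

section EstimationFunction

variable {Mdl Pol Obs Φ : Type*} [MeasurableSpace Mdl] [MeasurableSpace Pol] [MeasurableSpace Obs]
  {P : DMSO Mdl Pol Obs} {I : InfoSets Mdl Pol Φ} {H N : ℕ} {ℓ : Fin H → Φ → Obs → Fin N → ℝ}
  {B : ℝ}

/-- The mean of the `j`-th component of `ℓ_h(φ; ·)`. -/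
def meanEst (P : DMSO Mdl Pol Obs) (ℓ : Fin H → Φ → Obs → Fin N → ℝ) (h : Fin H) (φ : Φ)
    (j : Fin N) (x : Mdl × Pol) : ℝ := ∫ o, ℓ h φ o j ∂(P.law x.1 x.2)

lemma IsEstimationFunction.abs_le (hℓ : IsEstimationFunction P I ℓ B) (h : Fin H) (φ : Φ) (o : Obs)
    (j : Fin N) : |ℓ h φ o j| ≤ B := _root_.abs_le.2 (hℓ.mem_Icc h φ o j)

lemma IsEstimationFunction.measurable_meanEst (hℓ : IsEstimationFunction P I ℓ B) (h : Fin H)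
    (φ : Φ) (j : Fin N) : Measurable (meanEst P ℓ h φ j) :=
  P.measurable_integral_law (hℓ.measurable h φ j)

lemma IsEstimationFunction.abs_meanEst_le (hℓ : IsEstimationFunction P I ℓ B) (h : Fin H)
    (φ : Φ) (j : Fin N) (x : Mdl × Pol) : |meanEst P ℓ h φ j x| ≤ B := by
  have := P.isProbabilityMeasure_law x.1 x.2
  have h := norm_integral_le_of_norm_le_const (μ := P.law x.1 x.2) (C := B)
    (f := fun o => ℓ h φ o j) (Filter.Eventually.of_forall fun o => hℓ.abs_le h φ o j)
  simpa [meanEst] using h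

lemma avgError_nonneg (π : Pol) (φ : Φ) (M : Mdl) : 0 ≤ avgError P ℓ B π φ M :=
  Real.iSup_nonneg fun j => mul_nonneg (by positivity) (Finset.sum_nonneg fun h _ => sq_nonneg _)

lemma one_div_mul_sum_le {f : Fin H → ℝ} (hf : ∀ h, |f h| ≤ B ^ 2) :
    1 / (B ^ 2 * H) * |∑ h, f h| ≤ 1 := by
  have h1 : |∑ h, f h| ≤ B ^ 2 * H := by
    refine (Finset.abs_sum_le_sum_abs _ _).trans ((Finset.sum_le_sum fun h _ => hf h).trans_eq ?_)
    simp [mul_comm]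
  rw [one_div, inv_mul_eq_div]
  exact div_le_one_of_le₀ h1 (by positivity)

lemma IsEstimationFunction.avgError_le_one (hℓ : IsEstimationFunction P I ℓ B) (π : Pol) (φ : Φ)
    (M : Mdl) : avgError P ℓ B π φ M ≤ 1 := by
  refine Real.iSup_le (fun j => ?_) zero_le_one
  refine (mul_le_mul_of_nonneg_left (le_abs_self _) (by positivity)).trans
    (one_div_mul_sum_le fun h => ?_)
  rw [abs_of_nonneg (sq_nonneg _)]
  have h1 := _root_.abs_le.1 (hℓ.abs_meanEst_le h φ j (M, π))
  exact sq_le_sq' h1.1 h1.2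

lemma IsEstimationFunction.measurable_avgError (hℓ : IsEstimationFunction P I ℓ B) (π : Pol)
    (φ : Φ) : Measurable (avgError P ℓ B π φ) := by
  refine Measurable.iSup fun j => Measurable.const_mul (Finset.measurable_sum _ fun h _ => ?_) _
  exact ((hℓ.measurable_meanEst h φ j).comp (f := fun M : Mdl => (M, π))
    measurable_prodMk_right).pow_const 2

/-- The divergence uses a maximum over `j`, while the estimator has an unbiased mean only for the
sum. Passing to the sum is one source of the factor `N` in the rate. -/
lemma avgError_le_sum (π : Pol) (φ : Φ) (M : Mdl) :
    avgError P ℓ B π φ M ≤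
      ∑ j, 1 / (B ^ 2 * H) * ∑ h, meanEst P ℓ h φ j (M, π) ^ 2 := by
  have hnn : ∀ j, 0 ≤ 1 / (B ^ 2 * (H : ℝ)) * ∑ h, meanEst P ℓ h φ j (M, π) ^ 2 := fun j =>
    mul_nonneg (by positivity) (Finset.sum_nonneg fun h _ => sq_nonneg _)
  refine Real.iSup_le (fun j => ?_) (Finset.sum_nonneg fun j _ => hnn j)
  exact Finset.single_le_sum (f := fun j =>
    1 / (B ^ 2 * (H : ℝ)) * ∑ h, meanEst P ℓ h φ j (M, π) ^ 2) (fun j _ => hnn j)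
    (Finset.mem_univ j)

lemma IsEstimationFunction.meanEst_eq_zero (hℓ : IsEstimationFunction P I ℓ B) {φ : Φ} {M : Mdl}
    (hM : (M, I.policy φ) ∈ I.set φ) (h : Fin H) (j : Fin N) (π : Pol) :
    meanEst P ℓ h φ j (M, π) = 0 := hℓ.mean_zero φ _ hM π h j

lemma IsEstimationFunction.avgError_eq_zero (hℓ : IsEstimationFunction P I ℓ B) {φ : Φ} {M : Mdl}
    (hM : (M, I.policy φ) ∈ I.set φ) (π : Pol) : avgError P ℓ B π φ M = 0 := by
  refine le_antisymm ((avgError_le_sum π φ M).trans_eq ?_) (avgError_nonneg _ _ _)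
  simp [hℓ.meanEst_eq_zero hM]

variable {τ k : ℕ}

lemma card_epoch : (epoch τ k).card = τ := by
  simp [epoch, add_mul]

lemma card_epochFst : (epochFst τ k).card = τ / 2 := by simp [epochFst]

lemma card_epochSnd (hτ : Even τ) : (epochSnd τ k).card = τ / 2 := by
  obtain ⟨n, rfl⟩ := hτ
  simp only [epochSnd, Nat.card_Ico, add_mul]
  omega

lemma epochFst_subset : epochFst τ k ⊆ epoch τ k := by
  intro t
  simp only [epochFst, epoch, Finset.mem_Ico, add_mul]
  omega

lemma epochSnd_subset : epochSnd τ k ⊆ epoch τ k := by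
  intro t
  simp only [epochSnd, epoch, Finset.mem_Ico, add_mul]
  omega

lemma lt_of_mem_epoch {t : ℕ} (ht : t ∈ epoch τ k) : t < (k + 1) * τ := (Finset.mem_Ico.1 ht).2

lemma lt_of_mem_epoch_of_lt {t K : ℕ} (hk : k < K) (ht : t ∈ epoch τ k) : t < K * τ :=
  (lt_of_mem_epoch ht).trans_le (Nat.mul_le_mul_right τ hk)

lemma IsEstimationFunction.abs_sampleMean_le (hℓ : IsEstimationFunction P I ℓ B) (hB : 0 ≤ B)
    (s : Finset ℕ) (h : Fin H) (φ : Φ) (j : Fin N) (o : ℕ → Obs) :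
    |sampleMean ℓ s h φ j o| ≤ B := by
  have h1 : |∑ t ∈ s, ℓ h φ (o t) j| ≤ s.card * B := by
    refine (Finset.abs_sum_le_sum_abs _ _).trans
      ((Finset.sum_le_sum fun t _ => hℓ.abs_le h φ (o t) j).trans_eq ?_)
    simp
  rw [sampleMean, abs_mul, abs_of_nonneg (by positivity), one_div, inv_mul_eq_div]
  exact div_le_of_le_mul₀ (by positivity) hB (by linarith)

lemma IsEstimationFunction.abs_lossEst_le (hℓ : IsEstimationFunction P I ℓ B) (hB : 0 ≤ B)
    (o : ℕ → Obs) (φ : Φ) : |lossEst ℓ B τ k o φ| ≤ N * τ := by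
  rw [lossEst_eq]
  refine (Finset.abs_sum_le_sum_abs _ _).trans
    ((Finset.sum_le_sum (g := fun _ => (τ : ℝ)) fun j _ => ?_).trans_eq ?_)
  · rw [abs_mul, abs_of_nonneg (by positivity), div_eq_mul_one_div, mul_assoc]
    refine mul_le_of_le_one_right (by positivity) (one_div_mul_sum_le fun h => ?_)
    rw [abs_mul, sq]
    exact mul_le_mul (hℓ.abs_sampleMean_le hB _ _ _ _ _) (hℓ.abs_sampleMean_le hB _ _ _ _ _)
      (abs_nonneg _) hB
  · simp

end EstimationFunction

/-! ### The run -/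

section RunMeasurability

variable {Mdl Pol Obs Φ Ω : Type*} [MeasurableSpace Mdl] [MeasurableSpace Pol]
  [MeasurableSpace Obs] {R : Run Ω Mdl Pol Obs Φ} {τ k t : ℕ}
  {P : DMSO Mdl Pol Obs} {H N : ℕ} {ℓ : Fin H → Φ → Obs → Fin N → ℝ}

lemma Run.learnerHist_le_envHist : R.learnerHist τ k ≤ R.envHist τ k := le_sup_left

lemma Run.envHist_le_roundHist : R.envHist τ k ≤ R.roundHist τ k t :=
  le_sup_left.trans le_sup_left

lemma Run.measurable_model_envHist (ht : t < (k + 1) * τ) :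
    Measurable[R.envHist τ k] (R.model t) :=
  measurable_iff_comap_le.2 (le_sup_of_le_right (le_iSup₂ (f := fun t
    (_ : t ∈ Set.Iio ((k + 1) * τ)) => MeasurableSpace.comap (R.model t) inferInstance) t ht))

lemma Run.measurable_policy_roundHist : Measurable[R.roundHist τ k t] (R.policy k) :=
  measurable_iff_comap_le.2 (le_sup_of_le_left le_sup_right)

lemma Run.measurable_obs_roundHist {s : ℕ} (hs : s < t) :
    Measurable[R.roundHist τ k t] (R.obs s) :=
  measurable_iff_comap_le.2 (le_sup_of_le_right (le_iSup₂ (f := fun s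
    (_ : s ∈ Set.Iio t) => MeasurableSpace.comap (R.obs s) inferInstance) s hs))

lemma Run.roundHist_mono {s : ℕ} (hs : s ≤ t) : R.roundHist τ k s ≤ R.roundHist τ k t :=
  sup_le_sup_left (iSup₂_le fun r hr => le_iSup₂ (f := fun s
    (_ : s ∈ Set.Iio t) => MeasurableSpace.comap (R.obs s) inferInstance) r
    (lt_of_lt_of_le hr hs)) _

lemma Run.measurable_world_roundHist (ht : t ∈ epoch τ k) :
    Measurable[R.roundHist τ k t] fun ω => (R.model t ω, R.policy k ω) :=
  Measurable.prodMk ((R.measurable_model_envHist (lt_of_mem_epoch ht)).mono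
    R.envHist_le_roundHist le_rfl) R.measurable_policy_roundHist

/-- The mean of `ℓ_h(φ; ·)_j` in round `t` of epoch `k`. -/
def Run.roundMean (R : Run Ω Mdl Pol Obs Φ) (P : DMSO Mdl Pol Obs)
    (ℓ : Fin H → Φ → Obs → Fin N → ℝ) (k t : ℕ) (h : Fin H) (φ : Φ) (j : Fin N) (ω : Ω) : ℝ :=
  meanEst P ℓ h φ j (R.model t ω, R.policy k ω)

lemma IsEstimationFunction.measurable_roundMean {I : InfoSets Mdl Pol Φ} {B : ℝ}
    (hℓ : IsEstimationFunction P I ℓ B)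
    (ht : t ∈ epoch τ k) (h : Fin H) (φ : Φ) (j : Fin N) :
    Measurable[R.roundHist τ k t] (R.roundMean P ℓ k t h φ j) :=
  (hℓ.measurable_meanEst h φ j).comp (R.measurable_world_roundHist ht)

variable [MeasurableSpace Ω]

lemma Run.roundHist_le (h1 : ∀ k, Measurable (R.policy k)) (h2 : ∀ t, Measurable (R.obs t))
    (h3 : ∀ t, Measurable (R.model t)) : R.roundHist τ k t ≤ ‹MeasurableSpace Ω› :=
  sup_le (sup_le (sup_le (sup_le (iSup₂_le fun j _ => (h1 j).comap_le)
    (iSup₂_le fun j _ => (h2 j).comap_le)) (iSup₂_le fun j _ => (h3 j).comap_le))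
    (h1 k).comap_le) (iSup₂_le fun j _ => (h2 j).comap_le)

end RunMeasurability

/-! ### Moments of the loss estimator -/

section Moments

variable {Mdl Pol Obs Φ Ω : Type*} [MeasurableSpace Mdl] [MeasurableSpace Pol]
  [MeasurableSpace Obs] [MeasurableSpace Ω] {μ : Measure Ω}
  {P : DMSO Mdl Pol Obs} {I : InfoSets Mdl Pol Φ} {H N : ℕ} {ℓ : Fin H → Φ → Obs → Fin N → ℝ}
  {B : ℝ} {τ K k t : ℕ} {φs : Φ} {R : Run Ω Mdl Pol Obs Φ}

lemma integrable_of_ae_abs_le [IsFiniteMeasure μ] {f : Ω → ℝ} (hf : Measurable f) {c : ℝ}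
    (hc : ∀ᵐ ω ∂μ, |f ω| ≤ c) : Integrable f μ :=
  Integrable.of_bound hf.aestronglyMeasurable c hc

lemma IsEnvironment.roundHist_le (hE : IsEnvironment μ P I ℓ τ K φs R)
    (hpol : ∀ k, Measurable (R.policy k)) : R.roundHist τ k t ≤ ‹MeasurableSpace Ω› :=
  R.roundHist_le hpol hE.measurable_obs hE.measurable_model

lemma IsEnvironment.obs_law_lawKernel (hE : IsEnvironment μ P I ℓ τ K φs R) (hk : k < K)
    (ht : t ∈ epoch τ k) (S : Set Obs) (hS : MeasurableSet S) :
    μ⟦R.obs t ⁻¹' S | R.roundHist τ k t⟧ =ᵐ[μ]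
      fun ω => (P.lawKernel (R.model t ω, R.policy k ω)).real S := by
  simpa only [P.lawKernel_apply] using hE.obs_law k hk t ht S hS

lemma IsEnvironment.roundMean_eq (hE : IsEnvironment μ P I ℓ τ K φs R) (hk : k < K) :
    ∀ᵐ ω ∂μ, ∀ s ∈ epoch τ k, ∀ t ∈ epoch τ k, ∀ h φ j,
      R.roundMean P ℓ k s h φ j ω = R.roundMean P ℓ k t h φ j ω := by
  filter_upwards [hE.mean_eq] with ω hω s hs t ht h φ j
  exact hω s (lt_of_mem_epoch_of_lt hk hs) t (lt_of_mem_epoch_of_lt hk ht) _ φ h j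

lemma IsEnvironment.roundMean_eq_zero (hE : IsEnvironment μ P I ℓ τ K φs R)
    (hℓ : IsEstimationFunction P I ℓ B) (hk : k < K) : ∀ᵐ ω ∂μ, ∀ t ∈ epoch τ k, ∀ h j,
    R.roundMean P ℓ k t h φs j ω = 0 := by
  filter_upwards [hE.model_mem] with ω hω t ht h j
  exact hℓ.meanEst_eq_zero (hω t (lt_of_mem_epoch_of_lt hk ht)) h j _

lemma IsEstimationFunction.measurable_sampleMean (hℓ : IsEstimationFunction P I ℓ B)
    (hobs : ∀ t, Measurable (R.obs t)) (s : Finset ℕ) (h : Fin H) (φ : Φ) (j : Fin N) :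
    Measurable fun ω => sampleMean ℓ s h φ j (fun t => R.obs t ω) :=
  (Finset.measurable_sum _ fun t _ => (hℓ.measurable h φ j).comp (hobs t)).const_mul _

lemma IsEstimationFunction.measurable_lossEst (hℓ : IsEstimationFunction P I ℓ B)
    (hobs : ∀ t, Measurable (R.obs t)) (φ : Φ) :
    Measurable fun ω => lossEst ℓ B τ k (fun t => R.obs t ω) φ := by
  simp only [lossEst_eq]
  exact Finset.measurable_sum _ fun j _ => (Finset.measurable_sum _ fun h _ =>
    (hℓ.measurable_sampleMean hobs _ h φ j).mul
      (hℓ.measurable_sampleMean hobs _ h φ j)).const_mul _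

lemma abs_mul_le_mul {a b c d : ℝ} (h1 : |a| ≤ c) (h2 : |b| ≤ d) : |a * b| ≤ c * d := by
  rw [abs_mul]
  exact mul_le_mul h1 h2 (abs_nonneg _) ((abs_nonneg _).trans h1)

variable [IsProbabilityMeasure μ]

lemma IsEnvironment.integral_mul_obs (hE : IsEnvironment μ P I ℓ τ K φs R)
    (hpol : ∀ k, Measurable (R.policy k)) (hk : k < K) (ht : t ∈ epoch τ k) {W : Ω → ℝ}
    (hW : Measurable[R.roundHist τ k t] W) {c : ℝ} (hc : ∀ᵐ ω ∂μ, |W ω| ≤ c) {g : Obs → ℝ}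
    (hg : Measurable g) {b : ℝ} (hb : ∀ o, |g o| ≤ b) :
    ∫ ω, W ω * g (R.obs t ω) ∂μ =
      ∫ ω, W ω * ∫ o, g o ∂(P.law (R.model t ω) (R.policy k ω)) ∂μ := by
  have hle := hE.roundHist_le hpol (k := k) (t := t)
  have hX : Measurable[R.roundHist τ k t] fun ω => (W ω, (R.model t ω, R.policy k ω)) :=
    Measurable.prodMk hW (R.measurable_world_roundHist ht)
  have hf : Measurable fun z : (ℝ × (Mdl × Pol)) × Obs => z.1.1 * g z.2 :=
    (measurable_fst.comp measurable_fst).mul (hg.comp measurable_snd)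
  have hfi : Integrable (fun ω => W ω * g (R.obs t ω)) μ :=
    integrable_of_ae_abs_le ((hW.mono hle le_rfl).mul (hg.comp (hE.measurable_obs t)))
      (hc.mono fun ω h => abs_mul_le_mul h (hb _))
  have h := integral_prodMk_eq hle hX (hE.measurable_obs t)
    (P.lawKernel.comap (fun x : ℝ × (Mdl × Pol) => x.2) measurable_snd)
    (fun S hS => hE.obs_law_lawKernel hk ht S hS) hf hfi
  simpa only [Kernel.comap_apply, P.lawKernel_apply, integral_const_mul] using h

section

variable (hℓ : IsEstimationFunction P I ℓ B) (hE : IsEnvironment μ P I ℓ τ K φs R)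
  (hpol : ∀ k, Measurable (R.policy k)) (hk : k < K)
include hℓ hE hpol hk

/-- The later observation is integrated first. Constancy of the means replaces its mean by that of
round `s`, which is settled before `o_s` is drawn; then `o_s` is integrated. As the rounds differ,
no variance term appears. -/
lemma integral_mul_obs_mul_obs {s : ℕ} (hs : s ∈ epoch τ k) (ht : t ∈ epoch τ k) (hst : s < t)
    {W : Ω → ℝ} (hW : Measurable[R.roundHist τ k s] W) {c : ℝ} (hc : ∀ᵐ ω ∂μ, |W ω| ≤ c)
    (h : Fin H) (φ : Φ) (j : Fin N) :
    ∫ ω, W ω * (ℓ h φ (R.obs s ω) j * ℓ h φ (R.obs t ω) j) ∂μ =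
      ∫ ω, W ω * R.roundMean P ℓ k s h φ j ω ^ 2 ∂μ := by
  have hℓb := fun o => hℓ.abs_le h φ o j
  have hℓm := hℓ.measurable h φ j
  have hmono := R.roundHist_mono (τ := τ) (k := k) hst.le
  have hWZ : Measurable[R.roundHist τ k t] fun ω => W ω * ℓ h φ (R.obs s ω) j :=
    (hW.mono hmono le_rfl).mul (hℓm.comp (R.measurable_obs_roundHist hst))
  have hWm : Measurable[R.roundHist τ k s] fun ω => W ω * R.roundMean P ℓ k s h φ j ω :=
    hW.mul (hℓ.measurable_roundMean hs h φ j)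
  calc ∫ ω, W ω * (ℓ h φ (R.obs s ω) j * ℓ h φ (R.obs t ω) j) ∂μ
      = ∫ ω, W ω * ℓ h φ (R.obs s ω) j * ℓ h φ (R.obs t ω) j ∂μ := by
        simp only [mul_assoc]
    _ = ∫ ω, W ω * ℓ h φ (R.obs s ω) j * R.roundMean P ℓ k t h φ j ω ∂μ :=
        hE.integral_mul_obs hpol hk ht hWZ (c := c * B)
          (hc.mono fun ω h => abs_mul_le_mul h (hℓb _)) hℓm hℓb
    _ = ∫ ω, W ω * R.roundMean P ℓ k s h φ j ω * ℓ h φ (R.obs s ω) j ∂μ := by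
        refine integral_congr_ae ?_
        filter_upwards [hE.roundMean_eq hk] with ω hω
        rw [hω t ht s hs]
        ring
    _ = ∫ ω, W ω * R.roundMean P ℓ k s h φ j ω * R.roundMean P ℓ k s h φ j ω ∂μ :=
        hE.integral_mul_obs hpol hk hs hWm (c := c * B)
          (hc.mono fun ω h' => abs_mul_le_mul h' (hℓ.abs_meanEst_le h φ j _)) hℓm hℓb
    _ = _ := by simp only [mul_assoc, sq]

lemma integral_mul_sampleMean_mul (hτ : Even τ) (hτ0 : 0 < τ) {t₀ : ℕ} (ht₀ : t₀ ∈ epoch τ k)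
    {W : Ω → ℝ} (hW : Measurable[R.envHist τ k] W) {c : ℝ} (hc : ∀ᵐ ω ∂μ, |W ω| ≤ c)
    (h : Fin H) (φ : Φ) (j : Fin N) :
    ∫ ω, W ω * (sampleMean ℓ (epochFst τ k) h φ j (fun t => R.obs t ω) *
        sampleMean ℓ (epochSnd τ k) h φ j (fun t => R.obs t ω)) ∂μ =
      ∫ ω, W ω * R.roundMean P ℓ k t₀ h φ j ω ^ 2 ∂μ := by
  have hle := fun t => hE.roundHist_le hpol (k := k) (t := t)
  have hWm : Measurable W := hW.mono (R.envHist_le_roundHist.trans (hle 0)) le_rfl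
  have hZ : ∀ t, Measurable fun ω => ℓ h φ (R.obs t ω) j := fun t =>
    (hℓ.measurable h φ j).comp (hE.measurable_obs t)
  have hcard : ((τ / 2 : ℕ) : ℝ) ≠ 0 := by
    obtain ⟨n, rfl⟩ := hτ
    have : (n + n) / 2 ≠ 0 := by omega
    exact_mod_cast this
  have e1 : ∀ ω, W ω * (sampleMean ℓ (epochFst τ k) h φ j (fun t => R.obs t ω) *
        sampleMean ℓ (epochSnd τ k) h φ j (fun t => R.obs t ω)) =
      1 / ((τ / 2 : ℕ) : ℝ) * (1 / ((τ / 2 : ℕ) : ℝ)) * ∑ s ∈ epochFst τ k, ∑ t ∈ epochSnd τ k,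
        W ω * (ℓ h φ (R.obs s ω) j * ℓ h φ (R.obs t ω) j) := by
    intro ω
    simp only [sampleMean, card_epochFst, card_epochSnd hτ, ← Finset.mul_sum,
      ← Finset.sum_mul]
    ring
  have hint : ∀ s t, Integrable (fun ω => W ω * (ℓ h φ (R.obs s ω) j * ℓ h φ (R.obs t ω) j)) μ :=
    fun s t => integrable_of_ae_abs_le (hWm.mul ((hZ s).mul (hZ t)))
      (hc.mono fun ω h' => abs_mul_le_mul h' (abs_mul_le_mul (hℓ.abs_le h φ _ j)
        (hℓ.abs_le h φ _ j)))
  simp_rw [e1]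
  rw [integral_const_mul,
    integral_finsetSum _ fun s _ => integrable_finsetSum _ fun t _ => hint s t]
  have e2 : ∀ s ∈ epochFst τ k, ∫ ω, ∑ t ∈ epochSnd τ k,
      W ω * (ℓ h φ (R.obs s ω) j * ℓ h φ (R.obs t ω) j) ∂μ =
      ((τ / 2 : ℕ) : ℝ) * ∫ ω, W ω * R.roundMean P ℓ k t₀ h φ j ω ^ 2 ∂μ := by
    intro s hs
    rw [integral_finsetSum _ fun t _ => hint s t, ← card_epochSnd (k := k) hτ, ← nsmul_eq_mul]
    refine Finset.sum_eq_card_nsmul fun t ht => ?_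
    have hst : s < t := by
      have h1 := (Finset.mem_Ico.1 hs).2
      have h2 := (Finset.mem_Ico.1 ht).1
      omega
    rw [integral_mul_obs_mul_obs hℓ hE hpol hk (epochFst_subset hs) (epochSnd_subset ht) hst
      (hW.mono R.envHist_le_roundHist le_rfl) hc]
    refine integral_congr_ae ?_
    filter_upwards [hE.roundMean_eq hk] with ω hω
    rw [hω s (epochFst_subset hs) t₀ ht₀]
  rw [Finset.sum_congr rfl e2, Finset.sum_const, card_epochFst, nsmul_eq_mul]
  field_simp

/-- The conditional mean of the loss estimator. -/
lemma integral_mul_lossEst (hB : 0 < B) (hτ : Even τ) (hτ0 : 0 < τ) {t₀ : ℕ}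
    (ht₀ : t₀ ∈ epoch τ k)
    {W : Ω → ℝ} (hW : Measurable[R.envHist τ k] W) {c : ℝ} (hc : ∀ᵐ ω ∂μ, |W ω| ≤ c) (φ : Φ) :
    ∫ ω, W ω * lossEst ℓ B τ k (fun t => R.obs t ω) φ ∂μ =
      ∫ ω, W ω * (τ * ∑ j, 1 / (B ^ 2 * H) * ∑ h, R.roundMean P ℓ k t₀ h φ j ω ^ 2) ∂μ := by
  have hle := fun t => hE.roundHist_le hpol (k := k) (t := t)
  have hWm : Measurable W := hW.mono (R.envHist_le_roundHist.trans (hle 0)) le_rfl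
  have hm1 := fun s h j => hℓ.measurable_sampleMean hE.measurable_obs s h φ j
  have hi1 : ∀ h j, Integrable (fun ω => W ω *
      (sampleMean ℓ (epochFst τ k) h φ j (fun t => R.obs t ω) *
        sampleMean ℓ (epochSnd τ k) h φ j (fun t => R.obs t ω))) μ := fun h j =>
    integrable_of_ae_abs_le (hWm.mul ((hm1 _ h j).mul (hm1 _ h j)))
      (hc.mono fun ω h' => abs_mul_le_mul h' (abs_mul_le_mul
        (hℓ.abs_sampleMean_le hB.le _ _ _ _ _) (hℓ.abs_sampleMean_le hB.le _ _ _ _ _)))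
  have hi2 : ∀ h j, Integrable (fun ω => W ω * R.roundMean P ℓ k t₀ h φ j ω ^ 2) μ := fun h j =>
    integrable_of_ae_abs_le (c := c * B ^ 2) (hWm.mul
      (((hℓ.measurable_roundMean ht₀ h φ j).mono (hle t₀) le_rfl).pow_const 2))
      (hc.mono fun ω h' => abs_mul_le_mul h' (by
        rw [abs_pow]
        exact pow_le_pow_left₀ (abs_nonneg _) (hℓ.abs_meanEst_le h φ j _) 2))
  have e1 : ∀ ω, W ω * lossEst ℓ B τ k (fun t => R.obs t ω) φ =
      ∑ j, ∑ h, (τ : ℝ) / (B ^ 2 * H) *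
        (W ω * (sampleMean ℓ (epochFst τ k) h φ j (fun t => R.obs t ω) *
          sampleMean ℓ (epochSnd τ k) h φ j (fun t => R.obs t ω))) := by
    intro ω
    rw [lossEst_eq]
    simp only [Finset.mul_sum]
    exact Finset.sum_congr rfl fun j _ => Finset.sum_congr rfl fun h _ => by ring
  have e2 : ∀ ω, W ω * (τ * ∑ j, 1 / (B ^ 2 * H) * ∑ h, R.roundMean P ℓ k t₀ h φ j ω ^ 2) =
      ∑ j, ∑ h, (τ : ℝ) / (B ^ 2 * H) * (W ω * R.roundMean P ℓ k t₀ h φ j ω ^ 2) := by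
    intro ω
    simp only [Finset.mul_sum]
    exact Finset.sum_congr rfl fun j _ => Finset.sum_congr rfl fun h _ => by ring
  simp_rw [e1, e2]
  rw [integral_finsetSum _ fun j _ => integrable_finsetSum _ fun h _ => (hi1 h j).const_mul _,
    integral_finsetSum _ fun j _ => integrable_finsetSum _ fun h _ => (hi2 h j).const_mul _]
  refine Finset.sum_congr rfl fun j _ => ?_
  rw [integral_finsetSum _ fun h _ => (hi1 h j).const_mul _,
    integral_finsetSum _ fun h _ => (hi2 h j).const_mul _]
  refine Finset.sum_congr rfl fun h _ => ?_
  rw [integral_const_mul, integral_const_mul,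
    integral_mul_sampleMean_mul hℓ hE hpol hk hτ hτ0 ht₀ hW hc]

/-- Orthogonality of the martingale differences `ℓ_h(φs; o_t)_j`. -/
lemma integral_sq_mul_sum_sq_le {a b : ℕ} (hab : a ≤ b)
    (hsub : Finset.Ico a b ⊆ epoch τ k)
    {W : Ω → ℝ} (hW : Measurable[R.roundHist τ k a] W) {c : ℝ} (hc : ∀ ω, |W ω| ≤ c)
    (h : Fin H) (j : Fin N) :
    ∫ ω, W ω ^ 2 * (∑ t ∈ Finset.Ico a b, ℓ h φs (R.obs t ω) j) ^ 2 ∂μ ≤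
      (b - a) * B ^ 2 * ∫ ω, W ω ^ 2 ∂μ := by
  have hle := fun t => hE.roundHist_le hpol (k := k) (t := t)
  have hℓb := fun o => hℓ.abs_le h φs o j
  have hℓm := hℓ.measurable h φs j
  have hWm : Measurable W := hW.mono (hle a) le_rfl
  have hZ : ∀ t, Measurable fun ω => ℓ h φs (R.obs t ω) j := fun t =>
    hℓm.comp (hE.measurable_obs t)
  have hW2 : ∀ ω, |W ω ^ 2| ≤ c ^ 2 := fun ω => by
    rw [abs_pow]; exact pow_le_pow_left₀ (abs_nonneg _) (hc ω) 2
  have hS : ∀ b ω, |∑ t ∈ Finset.Ico a b, ℓ h φs (R.obs t ω) j| ≤ (b - a : ℕ) * B := fun b ω => by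
    refine (Finset.abs_sum_le_sum_abs _ _).trans
      ((Finset.sum_le_sum fun t _ => hℓb (R.obs t ω)).trans_eq ?_)
    simp
  have hSm : ∀ b, Measurable fun ω => ∑ t ∈ Finset.Ico a b, ℓ h φs (R.obs t ω) j := fun b =>
    Finset.measurable_sum _ fun t _ => hZ t
  induction b, hab using Nat.le_induction with
  | base => simp
  | succ b hab ih =>
    have hb : b ∈ epoch τ k := hsub (Finset.mem_Ico.2 ⟨hab, by omega⟩)
    have ih' := ih ((Finset.Ico_subset_Ico_right (by omega)).trans hsub)
    have hV : Measurable[R.roundHist τ k b] fun ω =>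
        W ω ^ 2 * ∑ t ∈ Finset.Ico a b, ℓ h φs (R.obs t ω) j :=
      ((hW.mono (R.roundHist_mono hab) le_rfl).pow_const 2).mul
        (Finset.measurable_sum _ fun t ht =>
          hℓm.comp (R.measurable_obs_roundHist (Finset.mem_Ico.1 ht).2))
    -- Given the past, `ℓ_h(φs; o_b)` has mean zero because the model of round `b` belongs to `φs`.
    have hcross : ∫ ω, (W ω ^ 2 * ∑ t ∈ Finset.Ico a b, ℓ h φs (R.obs t ω) j) *
        ℓ h φs (R.obs b ω) j ∂μ = 0 := by
      rw [hE.integral_mul_obs hpol hk hb hV (c := c ^ 2 * ((b - a : ℕ) * B))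
        (Filter.Eventually.of_forall fun ω => abs_mul_le_mul (hW2 ω) (hS b ω)) hℓm hℓb]
      rw [← integral_zero Ω ℝ]
      refine integral_congr_ae ?_
      filter_upwards [hE.roundMean_eq_zero hℓ hk] with ω hω
      have := hω b hb h j
      rw [Run.roundMean, meanEst] at this
      rw [this, mul_zero]
    have i1 : Integrable (fun ω => W ω ^ 2 *
        (∑ t ∈ Finset.Ico a b, ℓ h φs (R.obs t ω) j) ^ 2) μ :=
      integrable_of_ae_abs_le (c := c ^ 2 * ((b - a : ℕ) * B) ^ 2)
        ((hWm.pow_const 2).mul ((hSm b).pow_const 2))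
        (Filter.Eventually.of_forall fun ω => abs_mul_le_mul (hW2 ω) (by
          rw [abs_pow]; exact pow_le_pow_left₀ (abs_nonneg _) (hS b ω) 2))
    have i2 : Integrable (fun ω => (W ω ^ 2 * ∑ t ∈ Finset.Ico a b, ℓ h φs (R.obs t ω) j) *
        ℓ h φs (R.obs b ω) j) μ :=
      integrable_of_ae_abs_le (((hWm.pow_const 2).mul (hSm b)).mul (hZ b))
        (Filter.Eventually.of_forall fun ω => abs_mul_le_mul (abs_mul_le_mul (hW2 ω) (hS b ω))
          (hℓb _))
    have hZ2 : ∀ o, |ℓ h φs o j ^ 2| ≤ B ^ 2 := fun o => by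
      rw [abs_pow]; exact pow_le_pow_left₀ (abs_nonneg _) (hℓb o) 2
    have i3 : Integrable (fun ω => W ω ^ 2 * ℓ h φs (R.obs b ω) j ^ 2) μ :=
      integrable_of_ae_abs_le ((hWm.pow_const 2).mul ((hZ b).pow_const 2))
        (Filter.Eventually.of_forall fun ω => abs_mul_le_mul (hW2 ω) (hZ2 _))
    have i4 : Integrable (fun ω => W ω ^ 2) μ :=
      integrable_of_ae_abs_le (hWm.pow_const 2) (Filter.Eventually.of_forall hW2)
    have e : ∀ ω, W ω ^ 2 * (∑ t ∈ Finset.Ico a (b + 1), ℓ h φs (R.obs t ω) j) ^ 2 =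
        W ω ^ 2 * (∑ t ∈ Finset.Ico a b, ℓ h φs (R.obs t ω) j) ^ 2 +
        2 * ((W ω ^ 2 * ∑ t ∈ Finset.Ico a b, ℓ h φs (R.obs t ω) j) * ℓ h φs (R.obs b ω) j) +
        W ω ^ 2 * ℓ h φs (R.obs b ω) j ^ 2 := fun ω => by
      rw [Finset.sum_Ico_succ_top hab]; ring
    have i5 : Integrable (fun ω => W ω ^ 2 * (∑ t ∈ Finset.Ico a b, ℓ h φs (R.obs t ω) j) ^ 2 +
        2 * ((W ω ^ 2 * ∑ t ∈ Finset.Ico a b, ℓ h φs (R.obs t ω) j) * ℓ h φs (R.obs b ω) j)) μ :=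
      i1.add (i2.const_mul 2)
    simp_rw [e]
    rw [integral_add i5 i3, integral_add i1 (i2.const_mul 2),
      integral_const_mul, hcross]
    have h3 : ∫ ω, W ω ^ 2 * ℓ h φs (R.obs b ω) j ^ 2 ∂μ ≤ B ^ 2 * ∫ ω, W ω ^ 2 ∂μ := by
      rw [← integral_const_mul]
      refine integral_mono i3 (i4.const_mul _) fun ω => ?_
      have := mul_le_mul_of_nonneg_left ((le_abs_self _).trans (hZ2 (R.obs b ω)))
        (sq_nonneg (W ω))
      simp only
      linarith
    push_cast
    linarith

/-- Orthogonality is used twice: over the second half with the first sample mean as weight, then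
over the first half with weight `1`. Each half has `τ/2` rounds and contributes a factor `2B²/τ`. -/
lemma integral_sq_mul_sq_le (hB : 0 < B) (hτ : Even τ) (hτ0 : 0 < τ) (h : Fin H) (j : Fin N) :
    ∫ ω, (sampleMean ℓ (epochFst τ k) h φs j (fun t => R.obs t ω) *
        sampleMean ℓ (epochSnd τ k) h φs j (fun t => R.obs t ω)) ^ 2 ∂μ ≤
      4 * B ^ 4 / τ ^ 2 := by
  obtain ⟨n, rfl⟩ := hτ
  have hn : 0 < n := by omega
  have hn2 : (n + n) / 2 = n := by omega
  have hnr : (0 : ℝ) < n := by exact_mod_cast hn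
  have hadd : (k + 1) * (n + n) = k * (n + n) + n + n := by ring
  have s1 : epochFst (n + n) k = Finset.Ico (k * (n + n)) (k * (n + n) + n) := by
    rw [epochFst, hn2]
  have s2 : epochSnd (n + n) k = Finset.Ico (k * (n + n) + n) (k * (n + n) + n + n) := by
    rw [epochSnd, hn2, hadd]
  have c1 : ((epochFst (n + n) k).card : ℝ) = n := by rw [card_epochFst, hn2]
  have c2 : ((epochSnd (n + n) k).card : ℝ) = n := by rw [card_epochSnd ⟨n, rfl⟩, hn2]
  have hX : Measurable[R.roundHist (n + n) k (k * (n + n) + n)] fun ω =>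
      sampleMean ℓ (epochFst (n + n) k) h φs j (fun t => R.obs t ω) :=
    (Finset.measurable_sum _ fun t ht => (hℓ.measurable h φs j).comp
      (R.measurable_obs_roundHist (by rw [s1] at ht; exact (Finset.mem_Ico.1 ht).2))).const_mul _
  have hXb : ∀ ω, |sampleMean ℓ (epochFst (n + n) k) h φs j (fun t => R.obs t ω)| ≤ B := fun ω =>
    hℓ.abs_sampleMean_le hB.le _ _ _ _ _
  have b1 := integral_sq_mul_sum_sq_le hℓ hE hpol hk (Nat.le_add_right _ n)
    (s1 ▸ epochFst_subset) (W := fun _ => 1) measurable_const (c := 1) (by simp) h j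
  have b2 := integral_sq_mul_sum_sq_le hℓ hE hpol hk (Nat.le_add_right _ n)
    (s2 ▸ epochSnd_subset) hX hXb h j
  have e1 : ∫ ω, sampleMean ℓ (epochFst (n + n) k) h φs j (fun t => R.obs t ω) ^ 2 ∂μ ≤
      B ^ 2 / n := by
    simp only [sampleMean, c1, mul_pow, integral_const_mul]
    rw [s1]
    simp only [one_pow, one_mul, integral_const, probReal_univ, smul_eq_mul, mul_one] at b1
    push_cast at b1
    rw [add_sub_cancel_left] at b1
    calc _ ≤ (1 / (n : ℝ)) ^ 2 * (n * B ^ 2) := by gcongr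
      _ = _ := by field_simp
  have e2 : ∀ ω, (sampleMean ℓ (epochFst (n + n) k) h φs j (fun t => R.obs t ω) *
        sampleMean ℓ (epochSnd (n + n) k) h φs j (fun t => R.obs t ω)) ^ 2 =
      (1 / (n : ℝ)) ^ 2 * (sampleMean ℓ (epochFst (n + n) k) h φs j (fun t => R.obs t ω) ^ 2 *
        (∑ t ∈ Finset.Ico (k * (n + n) + n) (k * (n + n) + n + n), ℓ h φs (R.obs t ω) j) ^ 2) := by
    intro ω
    rw [mul_pow, ← s2]
    conv_lhs => rw [sampleMean.eq_def ℓ (epochSnd (n + n) k), c2]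
    ring
  simp_rw [e2]
  rw [integral_const_mul]
  push_cast at b2 ⊢
  rw [add_sub_cancel_left] at b2
  calc _ ≤ (1 / (n : ℝ)) ^ 2 * (n * B ^ 2 * (B ^ 2 / n)) := by
        refine mul_le_mul_of_nonneg_left (b2.trans ?_) (by positivity)
        gcongr
    _ = _ := by field_simp; ring

/-- The second moment of the loss estimator at `φs`. -/
lemma integral_lossEst_sq_le (hH : 0 < H) (hB : 0 < B) (hτ : Even τ) (hτ0 : 0 < τ) :
    ∫ ω, lossEst ℓ B τ k (fun t => R.obs t ω) φs ^ 2 ∂μ ≤ 4 * N ^ 2 := by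
  have hm1 := fun s h j => hℓ.measurable_sampleMean hE.measurable_obs s h φs j
  set U : Fin N → Fin H → Ω → ℝ := fun j h ω =>
    sampleMean ℓ (epochFst τ k) h φs j (fun t => R.obs t ω) *
      sampleMean ℓ (epochSnd τ k) h φs j (fun t => R.obs t ω) with hU
  have hUb : ∀ j h ω, |U j h ω ^ 2| ≤ (B * B) ^ 2 := fun j h ω => by
    rw [abs_pow]
    exact pow_le_pow_left₀ (abs_nonneg _) (abs_mul_le_mul (hℓ.abs_sampleMean_le hB.le _ _ _ _ _)
      (hℓ.abs_sampleMean_le hB.le _ _ _ _ _)) 2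
  have hUi : ∀ j h, Integrable (fun ω => U j h ω ^ 2) μ := fun j h =>
    integrable_of_ae_abs_le (((hm1 _ h j).mul (hm1 _ h j)).pow_const 2)
      (Filter.Eventually.of_forall (hUb j h))
  -- Cauchy-Schwarz over `j` and over `h`; the resulting `N² H²` and the bound `4B⁴/τ²` for each
  -- term combine with the prefactor to `4N²`.
  have hpt : ∀ ω, lossEst ℓ B τ k (fun t => R.obs t ω) φs ^ 2 ≤
      ((τ : ℝ) / (B ^ 2 * H)) ^ 2 * (N * ∑ j, H * ∑ h, U j h ω ^ 2) := by
    intro ω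
    rw [lossEst_eq, ← Finset.mul_sum, mul_pow]
    refine mul_le_mul_of_nonneg_left ?_ (sq_nonneg _)
    refine sq_sum_le_card_mul_sum_sq.trans ?_
    rw [Finset.card_univ, Fintype.card_fin]
    refine mul_le_mul_of_nonneg_left (Finset.sum_le_sum fun j _ => ?_) (Nat.cast_nonneg _)
    refine sq_sum_le_card_mul_sum_sq.trans ?_
    rw [Finset.card_univ, Fintype.card_fin]
  have hi : Integrable (fun ω => ((τ : ℝ) / (B ^ 2 * H)) ^ 2 *
      (N * ∑ j, H * ∑ h, U j h ω ^ 2)) μ :=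
    ((integrable_finsetSum _ fun j _ => (integrable_finsetSum _ fun h _ =>
      hUi j h).const_mul _).const_mul _).const_mul _
  refine (integral_mono_of_nonneg (Filter.Eventually.of_forall fun ω => sq_nonneg _) hi
    (Filter.Eventually.of_forall hpt)).trans ?_
  rw [integral_const_mul, integral_const_mul, integral_finsetSum _ fun j _ =>
    (integrable_finsetSum _ fun h _ => hUi j h).const_mul _]
  have hj : ∀ j ∈ Finset.univ, ∫ ω, H * ∑ h, U j h ω ^ 2 ∂μ ≤ H * (H * (4 * B ^ 4 / τ ^ 2)) := by
    intro j _
    rw [integral_const_mul, integral_finsetSum _ fun h _ => hUi j h]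
    refine mul_le_mul_of_nonneg_left ?_ (Nat.cast_nonneg _)
    refine (Finset.sum_le_sum fun h _ =>
      integral_sq_mul_sq_le hℓ hE hpol hk hB hτ hτ0 h j).trans_eq ?_
    simp
  have hτr : (0 : ℝ) < τ := by exact_mod_cast hτ0
  have hHr : (0 : ℝ) < H := by exact_mod_cast hH
  calc _ ≤ ((τ : ℝ) / (B ^ 2 * H)) ^ 2 * (N * ∑ _j : Fin N, H * (H * (4 * B ^ 4 / τ ^ 2))) := by
        gcongr with j hjm
        exact hj j hjm
    _ = _ := by
        simp only [Finset.sum_const, Finset.card_univ, Fintype.card_fin, nsmul_eq_mul]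
        field_simp

end

end Moments

/-! ### The estimation error of an epoch -/

section Epoch

variable {Mdl Pol Obs Φ Ω : Type*} [MeasurableSpace Mdl] [MeasurableSpace Pol]
  [MeasurableSpace Obs] [MeasurableSpace Ω] [Fintype Pol] [Fintype Φ]
  {P : DMSO Mdl Pol Obs} {I : InfoSets Mdl Pol Φ} {H N : ℕ} {ℓ : Fin H → Φ → Obs → Fin N → ℝ}
  {B η δ : ℝ} {τ K k t : ℕ} {φs : Φ} {R : Run Ω Mdl Pol Obs Φ} {μ : Measure Ω}

/-- A run of the algorithm against the environment, with admissible parameters. -/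
structure IsValidRun (μ : Measure Ω) (P : DMSO Mdl Pol Obs) (I : InfoSets Mdl Pol Φ)
    (ℓ : Fin H → Φ → Obs → Fin N → ℝ) (B η δ : ℝ) (τ K : ℕ) (φs : Φ)
    (R : Run Ω Mdl Pol Obs Φ) : Prop where
  H_pos : 0 < H
  N_pos : 0 < N
  B_pos : 0 < B
  η_pos : 0 < η
  δ_pos : 0 < δ
  δ_le : δ ≤ 1
  τ_pos : 0 < τ
  τ_even : Even τ
  estimation : IsEstimationFunction P I ℓ B
  env : IsEnvironment μ P I ℓ τ K φs R
  learner : IsLearner μ P I ℓ B η δ τ K R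
  post : PosteriorDefined μ P τ K R

lemma one_le_iota (hN : 0 < N) (hK : 0 < K) (hH : 0 < H) (hδ : 0 < δ) (hδ1 : δ ≤ 1) :
    1 ≤ iota N K H δ := by
  have hN' : (1 : ℝ) ≤ N := by exact_mod_cast hN
  have hK' : (1 : ℝ) ≤ K := by exact_mod_cast hK
  have hH' : (1 : ℝ) ≤ H := by exact_mod_cast hH
  have h1 : (1 : ℝ) ≤ N * K * H := one_le_mul_of_one_le_of_one_le
    (one_le_mul_of_one_le_of_one_le hN' hK') hH'
  have h2 : (12 : ℝ) ≤ 12 * N * K * H / δ := by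
    rw [le_div_iff₀ hδ]
    nlinarith
  rw [iota, Real.le_log_iff_exp_le (by linarith)]
  linarith [Real.exp_one_lt_d9]

namespace IsValidRun

variable (h : IsValidRun μ P I ℓ B η δ τ K φs R)
include h

lemma one_le_iota (hk : k < K) : 1 ≤ iota N K H δ :=
  DigDec.one_le_iota h.N_pos (by omega) h.H_pos h.δ_pos h.δ_le

lemma beta_pos (hk : k < K) : 0 < beta τ N (iota N K H δ) := by
  have h1 : (0 : ℝ) < τ := by exact_mod_cast h.τ_pos
  have h2 : (0 : ℝ) < N := by exact_mod_cast h.N_pos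
  have h3 := h.one_le_iota hk
  unfold beta
  positivity

/-- The reason for the factor `7` in `beta`: the estimator is at most `Nτ`, and `ι ≥ 1`, so the
range `|L/β| ≤ 1/7` required for stability is guaranteed surely. -/
lemma abs_lossEst_le (hk : k < K) (o : ℕ → Obs) (φ : Φ) :
    |lossEst ℓ B τ k o φ| ≤ beta τ N (iota N K H δ) / 7 := by
  refine (h.estimation.abs_lossEst_le h.B_pos.le o φ).trans ?_
  have h3 := h.one_le_iota hk
  have h4 : (0 : ℝ) ≤ N * τ := by positivity
  unfold beta
  nlinarith

lemma ae_world_mem (hk : k < K) :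
    ∀ᵐ ω ∂μ, ∀ t ∈ epoch τ k, (R.model t ω, I.policy φs) ∈ I.set φs := by
  filter_upwards [h.env.model_mem] with ω hω t ht using hω t (lt_of_mem_epoch_of_lt hk ht)

lemma ae_isProbabilityMeasure (hk : k < K) : ∀ᵐ ω ∂μ, IsProbabilityMeasure (R.ν k ω) := by
  filter_upwards [h.learner.minimax] with ω hω using (hω k hk).ν_mem.1

lemma roundHist_le : R.roundHist τ k t ≤ ‹MeasurableSpace Ω› :=
  h.env.roundHist_le h.learner.measurable_policy

lemma envHist_le : R.envHist τ k ≤ ‹MeasurableSpace Ω› :=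
  R.envHist_le_roundHist.trans (h.roundHist_le (t := 0))

lemma learnerHist_le : R.learnerHist τ k ≤ ‹MeasurableSpace Ω› :=
  R.learnerHist_le_envHist.trans h.envHist_le

lemma measurable_ρ (hk : k ≤ K) (φ : Φ) : Measurable[R.learnerHist τ k] fun ω => R.ρ k ω φ :=
  (measurable_pi_apply φ).comp (h.learner.measurable_ρ k hk)

lemma measurable_neg_log_ρ (hk : k ≤ K) : Measurable fun ω => -Real.log (R.ρ k ω φs) :=
  (Real.measurable_log.comp ((h.measurable_ρ hk φs).mono h.learnerHist_le le_rfl)).neg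

lemma measurable_avgError_roundHist (ht : t ∈ epoch τ k) (φ : Φ) (π : Pol) :
    Measurable[R.envHist τ k] fun ω => avgError P ℓ B π φ (R.model t ω) :=
  (h.estimation.measurable_avgError π φ).comp (R.measurable_model_envHist (lt_of_mem_epoch ht))

omit h in
/-- The log loss of the posterior in round `t` when the policy `π` is played. -/
def lossAt (P : DMSO Mdl Pol Obs) (I : InfoSets Mdl Pol Φ) (φs : Φ) (R : Run Ω Mdl Pol Obs Φ)
    (k t : ℕ) (π : Pol) (ω : Ω) : ℝ≥0∞ :=
  ∫⁻ o, logLoss P I φs ((R.ν k ω, (R.model t ω, π)), o) ∂(P.law (R.model t ω) π)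

lemma measurable_lossAt (hk : k < K) (ht : t ∈ epoch τ k) (π : Pol) :
    Measurable[R.envHist τ k] (lossAt P I φs R k t π) := by
  have hX : Measurable[R.envHist τ k] fun ω => (R.ν k ω, (R.model t ω, π)) :=
    ((h.learner.measurable_ν k hk).mono R.learnerHist_le_envHist le_rfl).prodMk
      ((R.measurable_model_envHist (lt_of_mem_epoch ht)).prodMk measurable_const)
  have := (measurable_lintegral_logLoss P I φs).comp hX
  exact fun S hS => this hS

lemma ae_lossAt_eq (hk : k < K) : ∀ᵐ ω ∂μ, ∀ t π,
    lossAt P I φs R k t π ω = surprise P I (R.ν k ω) π (R.model t ω) φs := by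
  filter_upwards [h.ae_isProbabilityMeasure hk] with ω hω t π
  exact lintegral_logLoss_eq P I φs _ _ _

lemma measurable_logLoss_obs (hk : k < K) (t : ℕ) :
    Measurable fun ω => logLoss P I φs ((R.ν k ω, (R.model t ω, R.policy k ω)), R.obs t ω) :=
  (measurable_logLoss P I φs).comp
    ((((h.learner.measurable_ν k hk).mono h.learnerHist_le le_rfl).prodMk
      ((h.env.measurable_model t).prodMk (h.learner.measurable_policy k))).prodMk
      (h.env.measurable_obs t))

lemma measurable_p (hk : k < K) : Measurable (R.p k) :=
  (h.learner.measurable_p k hk).mono h.learnerHist_le le_rfl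

variable [MeasurableSingletonClass Pol] [IsProbabilityMeasure μ]

/-- The observation is integrated given the round history, then the policy given the environment's
history. This links the losses on the run, seen by mirror descent, with the average over `p_k` in
Est. -/
lemma lintegral_logLoss_obs (hk : k < K) (ht : t ∈ epoch τ k) :
    ∫⁻ ω, logLoss P I φs ((R.ν k ω, (R.model t ω, R.policy k ω)), R.obs t ω) ∂μ =
      ∫⁻ ω, ∑ π, ENNReal.ofReal (R.p k ω π) * lossAt P I φs R k t π ω ∂μ := by
  have hX : Measurable[R.roundHist τ k t] fun ω => (R.ν k ω, (R.model t ω, R.policy k ω)) :=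
    ((h.learner.measurable_ν k hk).mono (R.learnerHist_le_envHist.trans R.envHist_le_roundHist)
      le_rfl).prodMk (R.measurable_world_roundHist ht)
  have h1 := lintegral_prodMk_eq h.roundHist_le hX (h.env.measurable_obs t)
    (P.lawKernel.comap (fun x : Measure (Mdl × Pol) × (Mdl × Pol) => x.2) measurable_snd)
    (fun S hS => h.env.obs_law_lawKernel hk ht S hS) (measurable_logLoss P I φs)
  rw [h1]
  simp only [Kernel.comap_apply, P.lawKernel_apply]
  exact lintegral_finite_eq h.envHist_le (h.learner.measurable_policy k) (h.measurable_p hk)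
    (h.learner.policy_law k hk) (h.measurable_lossAt hk ht)

/-- The learner's distribution at epoch `k` has full support on `φs`, with finite expected log
loss. -/
def HasFiniteLoss (μ : Measure Ω) (φs : Φ) (R : Run Ω Mdl Pol Obs Φ) (k : ℕ) : Prop :=
  (∀ᵐ ω ∂μ, R.ρ k ω ∈ stdSimplex ℝ Φ ∧ 0 < R.ρ k ω φs) ∧
    Integrable (fun ω => -Real.log (R.ρ k ω φs)) μ

omit [MeasurableSingletonClass Pol] [IsProbabilityMeasure μ] in
lemma hasFiniteLoss_zero [IsFiniteMeasure μ] : HasFiniteLoss μ φs R 0 := by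
  have hn : (0 : ℝ) < Fintype.card Φ := by
    have : Nonempty Φ := ⟨φs⟩
    exact_mod_cast Fintype.card_pos
  refine ⟨?_, ?_⟩
  · filter_upwards [h.learner.ρ_zero] with ω hω
    refine ⟨⟨fun φ => ?_, ?_⟩, ?_⟩
    · rw [hω φ]; positivity
    · simp only [hω, Finset.sum_const, Finset.card_univ, nsmul_eq_mul]
      field_simp
    · rw [hω φs]; positivity
  · refine (integrable_const (-Real.log (1 / (Fintype.card Φ : ℝ)))).congr ?_
    filter_upwards [h.learner.ρ_zero] with ω hω
    rw [hω φs]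

omit [MeasurableSingletonClass Pol] [IsProbabilityMeasure μ] in
lemma ae_sum_lossAt_le (hk : k < K) (hf : HasFiniteLoss μ φs R k) : ∀ᵐ ω ∂μ, ∀ t ∈ epoch τ k,
    ∑ π, ENNReal.ofReal (R.p k ω π) * lossAt P I φs R k t π ω ≤
      ENNReal.ofReal (-Real.log (R.ρ k ω φs) + 1 + 2 * η) := by
  filter_upwards [h.learner.minimax, h.ae_world_mem hk, hf.1, h.post, h.ae_lossAt_eq hk]
    with ω h1 h2 h3 h4 h5 t ht
  have := (h1 k hk).sum_surprise_le (φs := φs) (x := (R.model t ω, I.policy φs)) h.η_pos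
    h.estimation.measurable_avgError avgError_nonneg h.estimation.avgError_le_one (h2 t ht) h3.1
    h3.2 (h4 k hk t ht)
  simp only [h5]
  exact this

omit [MeasurableSingletonClass Pol] in
lemma lintegral_sum_lossAt_lt_top (hk : k < K) (ht : t ∈ epoch τ k)
    (hf : HasFiniteLoss μ φs R k) :
    ∫⁻ ω, ∑ π, ENNReal.ofReal (R.p k ω π) * lossAt P I φs R k t π ω ∂μ < ⊤ := by
  refine (lintegral_mono_ae ((h.ae_sum_lossAt_le hk hf).mono fun ω hω => hω t ht)).trans_lt ?_
  have : Integrable (fun ω => -Real.log (R.ρ k ω φs) + 1 + 2 * η) μ :=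
    (hf.2.add (integrable_const 1)).add (integrable_const _)
  exact (lintegral_ofReal_le_lintegral_enorm _).trans_lt this.2

/-- A finite expected loss is finite almost surely, so the posterior of `φs` is positive. Positivity
excludes evidence `0` or `⊤`, where division would return `0`, and hence the posterior is a genuine
probability vector. -/
lemma ae_posterior_pos (hk : k < K) (hf : HasFiniteLoss μ φs R k) : ∀ᵐ ω ∂μ, ∀ t ∈ epoch τ k,
    0 < posterior P I (R.ν k ω) (R.policy k ω) (R.obs t ω) φs ∧
      posterior P I (R.ν k ω) (R.policy k ω) (R.obs t ω) ∈ stdSimplex ℝ Φ ∧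
      (logLoss P I φs ((R.ν k ω, (R.model t ω, R.policy k ω)), R.obs t ω)).toReal =
        -Real.log (posterior P I (R.ν k ω) (R.policy k ω) (R.obs t ω) φs) := by
  rw [Finset.eventually_all]
  intro t ht
  have h1 := h.lintegral_sum_lossAt_lt_top hk ht hf
  rw [← h.lintegral_logLoss_obs hk ht] at h1
  filter_upwards [ae_lt_top (h.measurable_logLoss_obs hk t) h1.ne, h.learner.minimax] with ω h2 h3
  have hν := (h3 k hk).ν_mem
  have := hν.1
  rw [logLoss_eq] at h2 ⊢
  have hpos := negLog_lt_top_iff.1 h2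
  have hev := evidence_of_posterior_pos hpos
  have hmem := posterior_mem hν hev.1 hev.2
  exact ⟨hpos, hmem, toReal_negLog hpos (le_one_of_mem_stdSimplex hmem φs)⟩

lemma integrable_neg_log_posterior (hk : k < K) (ht : t ∈ epoch τ k)
    (hf : HasFiniteLoss μ φs R k) : Integrable (fun ω =>
      -Real.log (posterior P I (R.ν k ω) (R.policy k ω) (R.obs t ω) φs)) μ := by
  have h1 := h.lintegral_sum_lossAt_lt_top hk ht hf
  rw [← h.lintegral_logLoss_obs hk ht] at h1
  refine (integrable_toReal_of_lintegral_ne_top (h.measurable_logLoss_obs hk t).aemeasurable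
    h1.ne).congr ?_
  filter_upwards [h.ae_posterior_pos hk hf] with ω hω using (hω t ht).2.2

omit [MeasurableSingletonClass Pol] [IsProbabilityMeasure μ] in
lemma ae_toReal_sum_lossAt (hk : k < K) (hf : HasFiniteLoss μ φs R k) :
    ∀ᵐ ω ∂μ, ∀ t ∈ epoch τ k,
      (∑ π, ENNReal.ofReal (R.p k ω π) * lossAt P I φs R k t π ω).toReal =
        ∑ π, R.p k ω π * (lossAt P I φs R k t π ω).toReal := by
  filter_upwards [h.ae_sum_lossAt_le hk hf, h.learner.minimax] with ω hω h2 t ht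
  have h3 := ENNReal.sum_ne_top.1 (ne_top_of_le_ne_top ENNReal.ofReal_ne_top (hω t ht))
  rw [ENNReal.toReal_sum h3]
  refine Finset.sum_congr rfl fun π _ => ?_
  rw [ENNReal.toReal_mul, ENNReal.toReal_ofReal ((h2 k hk).p_mem.1 π)]

omit [MeasurableSingletonClass Pol] [IsProbabilityMeasure μ] in
lemma measurable_sum_lossAt (hk : k < K) (ht : t ∈ epoch τ k) :
    Measurable fun ω => ∑ π, ENNReal.ofReal (R.p k ω π) * lossAt P I φs R k t π ω :=
  Finset.measurable_sum _ fun π _ =>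
    (((measurable_pi_apply π).comp (h.measurable_p hk)).ennreal_ofReal).mul
      ((h.measurable_lossAt hk ht π).mono h.envHist_le le_rfl)

omit [MeasurableSingletonClass Pol] in
lemma integrable_sum_lossAt (hk : k < K) (ht : t ∈ epoch τ k) (hf : HasFiniteLoss μ φs R k) :
    Integrable (fun ω => ∑ π, R.p k ω π * (lossAt P I φs R k t π ω).toReal) μ := by
  refine (integrable_toReal_of_lintegral_ne_top (h.measurable_sum_lossAt hk ht).aemeasurable
    (h.lintegral_sum_lossAt_lt_top hk ht hf).ne).congr ?_
  filter_upwards [h.ae_toReal_sum_lossAt hk hf] with ω hω using hω t ht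

lemma integral_sum_lossAt (hk : k < K) (ht : t ∈ epoch τ k) (hf : HasFiniteLoss μ φs R k) :
    ∫ ω, ∑ π, R.p k ω π * (lossAt P I φs R k t π ω).toReal ∂μ =
      ∫ ω, -Real.log (posterior P I (R.ν k ω) (R.policy k ω) (R.obs t ω) φs) ∂μ := by
  have h1 := h.lintegral_sum_lossAt_lt_top hk ht hf
  have h2 := h1
  rw [← h.lintegral_logLoss_obs hk ht] at h2
  have e1 : ∫ ω, ∑ π, R.p k ω π * (lossAt P I φs R k t π ω).toReal ∂μ =
      ∫ ω, (∑ π, ENNReal.ofReal (R.p k ω π) * lossAt P I φs R k t π ω).toReal ∂μ := by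
    refine integral_congr_ae ?_
    filter_upwards [h.ae_toReal_sum_lossAt hk hf] with ω hω using (hω t ht).symm
  have e2 : ∫ ω, -Real.log (posterior P I (R.ν k ω) (R.policy k ω) (R.obs t ω) φs) ∂μ =
      ∫ ω, (logLoss P I φs ((R.ν k ω, (R.model t ω, R.policy k ω)), R.obs t ω)).toReal ∂μ := by
    refine integral_congr_ae ?_
    filter_upwards [h.ae_posterior_pos hk hf] with ω hω using (hω t ht).2.2.symm
  rw [e1, e2, integral_toReal (h.measurable_sum_lossAt hk ht).aemeasurable
    (ae_lt_top (h.measurable_sum_lossAt hk ht) h1.ne),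
    integral_toReal (h.measurable_logLoss_obs hk t).aemeasurable
    (ae_lt_top (h.measurable_logLoss_obs hk t) h2.ne), h.lintegral_logLoss_obs hk ht]

/-- The mirror-descent inequality along the run. -/
lemma ae_mirrorDescent (hk : k < K) (hf : HasFiniteLoss μ φs R k) : ∀ᵐ ω ∂μ,
    0 < R.ρ (k + 1) ω φs ∧
    (τ + 2 * beta τ N (iota N K H δ)) * -Real.log (R.ρ (k + 1) ω φs) ≤
      lossEst ℓ B τ k (fun t => R.obs t ω) φs +
      4 / beta τ N (iota N K H δ) * lossEst ℓ B τ k (fun t => R.obs t ω) φs ^ 2 +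
      ∑ t ∈ epoch τ k, -Real.log (posterior P I (R.ν k ω) (R.policy k ω) (R.obs t ω) φs) +
      2 * beta τ N (iota N K H δ) * -Real.log (R.ρ k ω φs) -
      ∑ φ, R.ρ k ω φ * lossEst ℓ B τ k (fun t => R.obs t ω) φ := by
  filter_upwards [h.learner.ρ_succ, h.learner.ρ_succ_mem, hf.1, h.ae_posterior_pos hk hf]
    with ω h1 h2 h3 h4
  have := mirrorDescent_step (h.beta_pos hk) (γ := gamma τ N (iota N K H δ)) rfl
    (h.abs_lossEst_le hk _) h3.1 (h2 k hk) h3.2 (fun t ht => (h4 t ht).2.1)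
    (fun t ht => (h4 t ht).1) (h1 k hk)
  rwa [card_epoch, gamma, one_div_one_div] at this

omit [MeasurableSingletonClass Pol] in
lemma integrable_lossEst (φ : Φ) :
    Integrable (fun ω => lossEst ℓ B τ k (fun t => R.obs t ω) φ) μ :=
  integrable_of_ae_abs_le (h.estimation.measurable_lossEst h.env.measurable_obs φ)
    (Filter.Eventually.of_forall fun _ => h.estimation.abs_lossEst_le h.B_pos.le _ φ)

omit [MeasurableSingletonClass Pol] in
lemma integrable_lossEst_sq (φ : Φ) :
    Integrable (fun ω => lossEst ℓ B τ k (fun t => R.obs t ω) φ ^ 2) μ :=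
  integrable_of_ae_abs_le (c := (N * τ) ^ 2)
    ((h.estimation.measurable_lossEst h.env.measurable_obs φ).pow_const 2)
    (Filter.Eventually.of_forall fun _ => by
      rw [abs_pow]
      exact pow_le_pow_left₀ (abs_nonneg _) (h.estimation.abs_lossEst_le h.B_pos.le _ φ) 2)

omit [MeasurableSpace Obs] [Fintype Pol] h [MeasurableSingletonClass Pol]
  [IsProbabilityMeasure μ] in
lemma ae_abs_ρ_le (hf : HasFiniteLoss μ φs R k) (φ : Φ) : ∀ᵐ ω ∂μ, |R.ρ k ω φ| ≤ 1 := by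
  filter_upwards [hf.1] with ω hω
  rw [abs_of_nonneg (hω.1.1 φ)]
  exact le_one_of_mem_stdSimplex hω.1 φ

omit [MeasurableSingletonClass Pol] in
lemma integrable_ρ_mul_lossEst (hk : k ≤ K) (hf : HasFiniteLoss μ φs R k) (φ : Φ) :
    Integrable (fun ω => R.ρ k ω φ * lossEst ℓ B τ k (fun t => R.obs t ω) φ) μ :=
  integrable_of_ae_abs_le (((h.measurable_ρ hk φ).mono h.learnerHist_le le_rfl).mul
    (h.estimation.measurable_lossEst h.env.measurable_obs φ))
    ((ae_abs_ρ_le hf φ).mono fun _ hω => abs_mul_le_mul hω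
      (h.estimation.abs_lossEst_le h.B_pos.le _ φ))

lemma integrable_mirrorDescent_bound (hk : k < K) (hf : HasFiniteLoss μ φs R k) :
    Integrable (fun ω => lossEst ℓ B τ k (fun t => R.obs t ω) φs +
      4 / beta τ N (iota N K H δ) * lossEst ℓ B τ k (fun t => R.obs t ω) φs ^ 2 +
      ∑ t ∈ epoch τ k, -Real.log (posterior P I (R.ν k ω) (R.policy k ω) (R.obs t ω) φs) +
      2 * beta τ N (iota N K H δ) * -Real.log (R.ρ k ω φs) -
      ∑ φ, R.ρ k ω φ * lossEst ℓ B τ k (fun t => R.obs t ω) φ) μ :=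
  ((((h.integrable_lossEst φs).add ((h.integrable_lossEst_sq φs).const_mul _)).add
    (integrable_finsetSum _ fun _ ht => h.integrable_neg_log_posterior hk ht hf)).add
    (hf.2.const_mul _)).sub (integrable_finsetSum _ fun φ _ =>
      h.integrable_ρ_mul_lossEst hk.le hf φ)

/-- The mirror-descent inequality dominates the new log loss by an integrable function;
nonnegativity of the loss supplies the other side. -/
lemma hasFiniteLoss_succ (hk : k < K) (hf : HasFiniteLoss μ φs R k) :
    HasFiniteLoss μ φs R (k + 1) := by
  have hc : 0 < τ + 2 * beta τ N (iota N K H δ) := by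
    have := h.beta_pos hk
    positivity
  refine ⟨?_, ?_⟩
  · filter_upwards [h.ae_mirrorDescent hk hf, h.learner.ρ_succ_mem] with ω h1 h2
      using ⟨h2 k hk, h1.1⟩
  · refine ((h.integrable_mirrorDescent_bound hk hf).const_mul
      (τ + 2 * beta τ N (iota N K H δ))⁻¹).mono'
      (h.measurable_neg_log_ρ (by omega)).aestronglyMeasurable ?_
    filter_upwards [h.ae_mirrorDescent hk hf, h.learner.ρ_succ_mem] with ω h1 h2
    rw [Real.norm_of_nonneg (neg_log_nonneg_of_mem (h2 k hk) φs), inv_mul_eq_div,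
      le_div_iff₀ hc, mul_comm]
    exact h1.2

lemma hasFiniteLoss (hk : k ≤ K) : HasFiniteLoss μ φs R k := by
  induction k with
  | zero => exact h.hasFiniteLoss_zero
  | succ k ih => exact h.hasFiniteLoss_succ (by omega) (ih (by omega))

end IsValidRun

end Epoch

/-! ### The expected estimation term -/

section Estimation

variable {Mdl Pol Obs Φ Ω : Type*} [MeasurableSpace Mdl] [MeasurableSpace Pol]
  [MeasurableSpace Obs] [MeasurableSpace Ω] [Fintype Pol] [Fintype Φ]
  {P : DMSO Mdl Pol Obs} {I : InfoSets Mdl Pol Φ} {H N : ℕ} {ℓ : Fin H → Φ → Obs → Fin N → ℝ}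
  {B η δ : ℝ} {τ K k t : ℕ} {φs : Φ} {R : Run Ω Mdl Pol Obs Φ} {μ : Measure Ω}

/-- The estimation error of the learner's distribution in round `t` for the policy `π`. -/
def errorAt (P : DMSO Mdl Pol Obs) (ℓ : Fin H → Φ → Obs → Fin N → ℝ) (B : ℝ)
    (R : Run Ω Mdl Pol Obs Φ) (k t : ℕ) (π : Pol) (ω : Ω) : ℝ :=
  ∑ φ, R.ρ k ω φ * avgError P ℓ B π φ (R.model t ω)

/-- The contribution of round `t` of epoch `k` to the estimation term. -/
def roundEst (P : DMSO Mdl Pol Obs) (I : InfoSets Mdl Pol Φ) (ℓ : Fin H → Φ → Obs → Fin N → ℝ)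
    (B : ℝ) (φs : Φ) (R : Run Ω Mdl Pol Obs Φ) (k t : ℕ) (ω : Ω) : ℝ :=
  -Real.log (R.ρ k ω φs) + ∑ π, R.p k ω π * errorAt P ℓ B R k t π ω -
    ∑ π, R.p k ω π * (IsValidRun.lossAt P I φs R k t π ω).toReal

namespace IsValidRun

variable (h : IsValidRun μ P I ℓ B η δ τ K φs R)
include h

lemma measurable_errorAt (hk : k < K) (ht : t ∈ epoch τ k) (π : Pol) :
    Measurable[R.envHist τ k] (errorAt P ℓ B R k t π) :=
  Finset.measurable_sum _ fun φ _ =>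
    ((h.measurable_ρ hk.le φ).mono R.learnerHist_le_envHist le_rfl).mul
      (h.measurable_avgError_roundHist ht φ π)

lemma abs_errorAt_le (hf : HasFiniteLoss μ φs R k) (π : Pol) :
    ∀ᵐ ω ∂μ, |errorAt P ℓ B R k t π ω| ≤ 1 := by
  filter_upwards [hf.1] with ω hω
  rw [errorAt, abs_of_nonneg (sum_mul_nonneg (fun φ M => avgError_nonneg π φ M) hω.1 _)]
  exact sum_mul_le_one (fun φ M => h.estimation.avgError_le_one π φ M) hω.1 _

variable [IsProbabilityMeasure μ]

lemma integrable_errorAt (hk : k < K) (ht : t ∈ epoch τ k) (hf : HasFiniteLoss μ φs R k)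
    (π : Pol) : Integrable (errorAt P ℓ B R k t π) μ :=
  integrable_of_ae_abs_le ((h.measurable_errorAt hk ht π).mono h.envHist_le le_rfl)
    (h.abs_errorAt_le hf π)

variable [MeasurableSingletonClass Pol]

lemma errorAt_policy (hk : k < K) (ht : t ∈ epoch τ k) (hf : HasFiniteLoss μ φs R k) :
    Integrable (fun ω => errorAt P ℓ B R k t (R.policy k ω) ω) μ ∧
      Integrable (fun ω => ∑ π, R.p k ω π * errorAt P ℓ B R k t π ω) μ ∧
      ∫ ω, errorAt P ℓ B R k t (R.policy k ω) ω ∂μ =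
        ∫ ω, ∑ π, R.p k ω π * errorAt P ℓ B R k t π ω ∂μ := by
  obtain ⟨h1, h2, h3⟩ := integral_finite_eq h.envHist_le (h.learner.measurable_policy k)
    (h.learner.policy_law k hk) (h.measurable_errorAt hk ht) (h.integrable_errorAt hk ht hf)
  exact ⟨h1, integrable_finsetSum _ fun π _ => h2 π, h3⟩

/-- The weights `ρ_k` are settled before the epoch, so unbiasedness applies under the integral. The
policy is first averaged back from `p_k` to the one actually played, since the estimator sees only
that one. -/
lemma mul_integral_errorAt_le (hk : k < K) (ht : t ∈ epoch τ k) (hf : HasFiniteLoss μ φs R k) :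
    τ * ∫ ω, ∑ π, R.p k ω π * errorAt P ℓ B R k t π ω ∂μ ≤
      ∫ ω, ∑ φ, R.ρ k ω φ * lossEst ℓ B τ k (fun t => R.obs t ω) φ ∂μ := by
  obtain ⟨h1, -, h3⟩ := h.errorAt_policy hk ht hf
  rw [← h3, integral_finsetSum _ fun φ _ => h.integrable_ρ_mul_lossEst hk.le hf φ]
  have hm : ∀ φ, Measurable[R.envHist τ k] fun ω => R.ρ k ω φ := fun φ =>
    (h.measurable_ρ hk.le φ).mono R.learnerHist_le_envHist le_rfl
  have hr : ∀ φ j i, Measurable (R.roundMean P ℓ k t i φ j) := fun φ j i =>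
    (h.estimation.measurable_roundMean ht i φ j).mono h.roundHist_le le_rfl
  have hi : ∀ φ, Integrable (fun ω => R.ρ k ω φ *
      (τ * ∑ j, 1 / (B ^ 2 * H) * ∑ i, R.roundMean P ℓ k t i φ j ω ^ 2)) μ := by
    intro φ
    refine integrable_of_ae_abs_le (c := 1 * (τ * ∑ j : Fin N, 1 / (B ^ 2 * H) *
      ∑ i : Fin H, B ^ 2)) (((hm φ).mono h.envHist_le le_rfl).mul
        ((Finset.measurable_sum _ fun j _ => (Finset.measurable_sum _ fun i _ =>
          (hr φ j i).pow_const 2).const_mul _).const_mul _)) ?_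
    filter_upwards [ae_abs_ρ_le hf φ] with ω hω
    refine abs_mul_le_mul hω ?_
    rw [abs_of_nonneg (by positivity)]
    refine mul_le_mul_of_nonneg_left (Finset.sum_le_sum fun j _ => mul_le_mul_of_nonneg_left
      (Finset.sum_le_sum fun i _ => ?_) (by positivity)) (by positivity)
    exact sq_le_sq' (_root_.abs_le.1 (h.estimation.abs_meanEst_le i φ j _)).1
      (_root_.abs_le.1 (h.estimation.abs_meanEst_le i φ j _)).2
  have e : ∀ φ, ∫ ω, R.ρ k ω φ * lossEst ℓ B τ k (fun t => R.obs t ω) φ ∂μ =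
      ∫ ω, R.ρ k ω φ *
        (τ * ∑ j, 1 / (B ^ 2 * H) * ∑ i, R.roundMean P ℓ k t i φ j ω ^ 2) ∂μ := fun φ =>
    integral_mul_lossEst h.estimation h.env h.learner.measurable_policy hk h.B_pos h.τ_even h.τ_pos
      ht (hm φ) (ae_abs_ρ_le hf φ) φ
  simp only [e]
  rw [← integral_finsetSum _ fun φ _ => hi φ, ← integral_const_mul]
  refine integral_mono_ae (h1.const_mul _) (integrable_finsetSum _ fun φ _ => hi φ) ?_
  filter_upwards [hf.1] with ω hω
  simp only [errorAt, Finset.mul_sum (s := (Finset.univ : Finset Φ))]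
  refine Finset.sum_le_sum fun φ _ => ?_
  rw [mul_left_comm]
  exact mul_le_mul_of_nonneg_left (mul_le_mul_of_nonneg_left (avgError_le_sum _ _ _)
    (Nat.cast_nonneg _)) (hω.1.1 φ)

lemma sum_integral_errorAt_le (hk : k < K) (hf : HasFiniteLoss μ φs R k) :
    ∑ t ∈ epoch τ k, ∫ ω, ∑ π, R.p k ω π * errorAt P ℓ B R k t π ω ∂μ ≤
      ∫ ω, ∑ φ, R.ρ k ω φ * lossEst ℓ B τ k (fun t => R.obs t ω) φ ∂μ := by
  have hτ : (0 : ℝ) < τ := by exact_mod_cast h.τ_pos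
  refine (Finset.sum_le_card_nsmul _ _ ((∫ ω, ∑ φ, R.ρ k ω φ *
    lossEst ℓ B τ k (fun t => R.obs t ω) φ ∂μ) / τ) fun t ht => ?_).trans_eq ?_
  · rw [le_div_iff₀ hτ, mul_comm]
    exact h.mul_integral_errorAt_le hk ht hf
  · rw [card_epoch, nsmul_eq_mul]
    field_simp

omit [MeasurableSingletonClass Pol] in
lemma integral_lossEst_eq_zero (hk : k < K) :
    ∫ ω, lossEst ℓ B τ k (fun t => R.obs t ω) φs ∂μ = 0 := by
  have ht : k * τ ∈ epoch τ k := by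
    have := h.τ_pos
    simp only [epoch, Finset.mem_Ico, add_mul]
    omega
  have := integral_mul_lossEst h.estimation h.env h.learner.measurable_policy hk h.B_pos h.τ_even
    h.τ_pos ht (W := fun _ => 1) measurable_const (c := 1) (by simp) φs
  simp only [one_mul] at this
  rw [this]
  refine integral_eq_zero_of_ae ?_
  filter_upwards [h.env.roundMean_eq_zero h.estimation hk] with ω hω
  simp [hω _ ht]

lemma integrable_roundEst (hk : k < K) (ht : t ∈ epoch τ k) :
    Integrable (roundEst P I ℓ B φs R k t) μ := by
  have hf := h.hasFiniteLoss hk.le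
  exact (hf.2.add (h.errorAt_policy hk ht hf).2.1).sub (h.integrable_sum_lossAt hk ht hf)

lemma integral_roundEst (hk : k < K) (ht : t ∈ epoch τ k) :
    ∫ ω, roundEst P I ℓ B φs R k t ω ∂μ = ∫ ω, -Real.log (R.ρ k ω φs) ∂μ +
      ∫ ω, ∑ π, R.p k ω π * errorAt P ℓ B R k t π ω ∂μ -
      ∫ ω, -Real.log (posterior P I (R.ν k ω) (R.policy k ω) (R.obs t ω) φs) ∂μ := by
  have hf := h.hasFiniteLoss hk.le
  rw [← h.integral_sum_lossAt hk ht hf, ← integral_add hf.2 (h.errorAt_policy hk ht hf).2.1]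
  exact integral_sub (hf.2.add (h.errorAt_policy hk ht hf).2.1) (h.integrable_sum_lossAt hk ht hf)

/-- The expected estimation term of an epoch, up to a telescoping difference. -/
lemma sum_integral_roundEst_le (hk : k < K) :
    ∑ t ∈ epoch τ k, ∫ ω, roundEst P I ℓ B φs R k t ω ∂μ ≤
      (τ + 2 * beta τ N (iota N K H δ)) * (∫ ω, -Real.log (R.ρ k ω φs) ∂μ -
        ∫ ω, -Real.log (R.ρ (k + 1) ω φs) ∂μ) + 16 * N ^ 2 / beta τ N (iota N K H δ) := by
  have hf := h.hasFiniteLoss hk.le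
  have hf' := h.hasFiniteLoss (k := k + 1) hk
  have hβ := h.beta_pos hk
  have hP : ∀ t ∈ epoch τ k, Integrable (fun ω =>
      -Real.log (posterior P I (R.ν k ω) (R.policy k ω) (R.obs t ω) φs)) μ :=
    fun t ht => h.integrable_neg_log_posterior hk ht hf
  -- In the expected inequality the posterior losses cancel those in Est, and `⟨ρ_k, L_k⟩` covers
  -- the errors. The `τ` copies of `-log ρ_k(φs)` in Est join the `2β` copies here, so both ends of
  -- the telescoping difference carry the weight `τ + 2β`.
  have hmd : ∫ ω, (τ + 2 * beta τ N (iota N K H δ)) * -Real.log (R.ρ (k + 1) ω φs) ∂μ ≤ _ :=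
    integral_mono_ae (hf'.2.const_mul _) (h.integrable_mirrorDescent_bound hk hf)
      ((h.ae_mirrorDescent hk hf).mono fun ω hω => hω.2)
  have i1 := (h.integrable_lossEst (k := k) φs).add
    ((h.integrable_lossEst_sq (k := k) φs).const_mul (4 / beta τ N (iota N K H δ)))
  have i2 := i1.add (integrable_finsetSum _ hP)
  have i3 := i2.add (hf.2.const_mul (2 * beta τ N (iota N K H δ)))
  have i4 := integrable_finsetSum Finset.univ fun φ _ => h.integrable_ρ_mul_lossEst hk.le hf φ
  have e : ∫ ω, lossEst ℓ B τ k (fun t => R.obs t ω) φs +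
      4 / beta τ N (iota N K H δ) * lossEst ℓ B τ k (fun t => R.obs t ω) φs ^ 2 +
      ∑ t ∈ epoch τ k, -Real.log (posterior P I (R.ν k ω) (R.policy k ω) (R.obs t ω) φs) +
      2 * beta τ N (iota N K H δ) * -Real.log (R.ρ k ω φs) -
      ∑ φ, R.ρ k ω φ * lossEst ℓ B τ k (fun t => R.obs t ω) φ ∂μ =
      ∫ ω, lossEst ℓ B τ k (fun t => R.obs t ω) φs ∂μ +
      4 / beta τ N (iota N K H δ) * ∫ ω, lossEst ℓ B τ k (fun t => R.obs t ω) φs ^ 2 ∂μ +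
      ∑ t ∈ epoch τ k,
        ∫ ω, -Real.log (posterior P I (R.ν k ω) (R.policy k ω) (R.obs t ω) φs) ∂μ +
      2 * beta τ N (iota N K H δ) * ∫ ω, -Real.log (R.ρ k ω φs) ∂μ -
      ∫ ω, ∑ φ, R.ρ k ω φ * lossEst ℓ B τ k (fun t => R.obs t ω) φ ∂μ := by
    refine (integral_sub i3 i4).trans ?_
    refine congrArg₂ _ ((integral_add i2 (hf.2.const_mul _)).trans ?_) rfl
    refine congrArg₂ _ ((integral_add i1 (integrable_finsetSum _ hP)).trans ?_)
      (integral_const_mul _ _)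
    refine congrArg₂ _ ((integral_add (h.integrable_lossEst φs)
      ((h.integrable_lossEst_sq φs).const_mul _)).trans ?_) (integral_finsetSum _ hP)
    exact congrArg₂ _ rfl (integral_const_mul _ _)
  rw [e, integral_const_mul, h.integral_lossEst_eq_zero hk] at hmd
  have hsq := integral_lossEst_sq_le h.estimation h.env h.learner.measurable_policy hk h.H_pos
    h.B_pos h.τ_even h.τ_pos
  have hsq' := mul_le_mul_of_nonneg_left hsq (by positivity : 0 ≤ 4 / beta τ N (iota N K H δ))
  have hE := h.sum_integral_errorAt_le hk hf
  rw [Finset.sum_congr rfl fun t ht => h.integral_roundEst hk ht, Finset.sum_sub_distrib,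
    Finset.sum_add_distrib, Finset.sum_const, card_epoch, nsmul_eq_mul]
  have : 4 / beta τ N (iota N K H δ) * (4 * N ^ 2) = 16 * N ^ 2 / beta τ N (iota N K H δ) := by
    ring
  linarith

/-- The expected estimation term over all epochs. -/
lemma sum_sum_integral_roundEst_le (hK : 0 < K) :
    ∑ k ∈ Finset.range K, ∑ t ∈ epoch τ k, ∫ ω, roundEst P I ℓ B φs R k t ω ∂μ ≤
      (τ + 2 * beta τ N (iota N K H δ)) * Real.log (Fintype.card Φ) +
        K * (16 * N ^ 2 / beta τ N (iota N K H δ)) := by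
  refine (Finset.sum_le_sum fun k hk =>
    h.sum_integral_roundEst_le (Finset.mem_range.1 hk)).trans ?_
  rw [Finset.sum_add_distrib, ← Finset.mul_sum, Finset.sum_range_sub', Finset.sum_const,
    Finset.card_range, nsmul_eq_mul]
  have hβ := h.beta_pos hK
  have h0 : ∫ ω, -Real.log (R.ρ 0 ω φs) ∂μ = Real.log (Fintype.card Φ) := by
    rw [integral_congr_ae (g := fun _ => Real.log (Fintype.card Φ))]
    · simp
    · filter_upwards [h.learner.ρ_zero] with ω hω
      rw [hω φs, one_div, Real.log_inv, neg_neg]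
  have hKn : 0 ≤ ∫ ω, -Real.log (R.ρ K ω φs) ∂μ := integral_nonneg_of_ae <| by
    filter_upwards [(h.hasFiniteLoss le_rfl).1] with ω hω using neg_log_nonneg_of_mem hω.1 φs
  rw [h0]
  gcongr
  linarith

/-- The estimation term is the sum of the contributions of the rounds. -/
lemma ae_est_eq : ∀ᵐ ω ∂μ, est P I ℓ B τ K φs R ω =
    ∑ k ∈ Finset.range K, ∑ t ∈ epoch τ k, roundEst P I ℓ B φs R k t ω := by
  have hk : ∀ᵐ ω ∂μ, ∀ k ∈ Finset.range K, (∀ t ∈ epoch τ k,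
      (R.model t ω, I.policy φs) ∈ I.set φs) ∧ (R.ρ k ω ∈ stdSimplex ℝ Φ ∧ 0 < R.ρ k ω φs) ∧
      ∀ t π, lossAt P I φs R k t π ω = surprise P I (R.ν k ω) π (R.model t ω) φs := by
    rw [Finset.eventually_all]
    intro k hk
    have hk := Finset.mem_range.1 hk
    filter_upwards [h.ae_world_mem hk, (h.hasFiniteLoss hk.le).1, h.ae_lossAt_eq hk]
      with ω h1 h2 h3 using ⟨h1, h2, h3⟩
  filter_upwards [hk, h.learner.minimax, h.post] with ω h1 h2 h3
  refine Finset.sum_congr rfl fun k hk => Finset.sum_congr rfl fun t ht => ?_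
  obtain ⟨h4, h5, h6⟩ := h1 k hk
  have hk := Finset.mem_range.1 hk
  refine ((h2 k hk).divergence_sub_bregman h.η_pos h.estimation.measurable_avgError avgError_nonneg
    (h4 t ht) h5.1 h5.2 (h3 k hk t ht)).trans ?_
  simp only [roundEst, errorAt, pointDivergence, h6, mul_sub, mul_add, Finset.sum_sub_distrib,
    Finset.sum_add_distrib, ← Finset.sum_mul, (h2 k hk).p_mem.2, one_mul]

lemma integrable_est : Integrable (est P I ℓ B τ K φs R) μ :=
  (integrable_finsetSum _ fun _ hk => integrable_finsetSum _ fun _ ht =>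
    h.integrable_roundEst (Finset.mem_range.1 hk) ht).congr
      (h.ae_est_eq.mono fun _ hω => hω.symm)

lemma integral_est_eq : ∫ ω, est P I ℓ B τ K φs R ω ∂μ =
    ∑ k ∈ Finset.range K, ∑ t ∈ epoch τ k, ∫ ω, roundEst P I ℓ B φs R k t ω ∂μ := by
  rw [integral_congr_ae h.ae_est_eq, integral_finsetSum _ fun _ hk => integrable_finsetSum _
    fun _ ht => h.integrable_roundEst (Finset.mem_range.1 hk) ht]
  exact Finset.sum_congr rfl fun k hk => integral_finsetSum _ fun _ ht =>
    h.integrable_roundEst (Finset.mem_range.1 hk) ht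

lemma integral_est_le (hK : 0 < K) :
    ∫ ω, est P I ℓ B τ K φs R ω ∂μ ≤
      (τ + 2 * beta τ N (iota N K H δ)) * Real.log (Fintype.card Φ) +
        K * (16 * N ^ 2 / beta τ N (iota N K H δ)) :=
  h.integral_est_eq.trans_le (h.sum_sum_integral_roundEst_le hK)

/-- With a single information set there is nothing to estimate. -/
lemma integral_est_nonpos (hΦ : Fintype.card Φ = 1) : ∫ ω, est P I ℓ B τ K φs R ω ∂μ ≤ 0 := by
  have hu : ∀ φ, φ = φs := fun φ => Fintype.card_le_one_iff.1 hΦ.le φ φs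
  have huniv : (Finset.univ : Finset Φ) = {φs} := by
    ext φ
    simp [hu φ]
  refine integral_nonpos_of_ae ?_
  have hk : ∀ᵐ ω ∂μ, ∀ k ∈ Finset.range K, (∀ t ∈ epoch τ k,
      (R.model t ω, I.policy φs) ∈ I.set φs) ∧ R.ρ k ω ∈ stdSimplex ℝ Φ := by
    rw [Finset.eventually_all]
    intro k hk
    have hk := Finset.mem_range.1 hk
    filter_upwards [h.ae_world_mem hk, (h.hasFiniteLoss hk.le).1] with ω h1 h2 using ⟨h1, h2.1⟩
  filter_upwards [h.ae_est_eq, hk, h.learner.minimax] with ω h1 h2 h3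
  rw [h1]
  refine Finset.sum_nonpos fun k hk => Finset.sum_nonpos fun t ht => ?_
  obtain ⟨h4, h5⟩ := h2 k hk
  have hρ : R.ρ k ω φs = 1 := by simpa [huniv] using h5.2
  have hE : ∀ π, errorAt P ℓ B R k t π ω = 0 := fun π => by
    simp [errorAt, huniv, h.estimation.avgError_eq_zero (h4 t ht)]
  simp only [roundEst, hρ, hE, Real.log_one, mul_zero, Finset.sum_const_zero, neg_zero, zero_add,
    zero_sub, Left.neg_nonpos_iff]
  exact Finset.sum_nonneg fun π _ => mul_nonneg ((h3 k (Finset.mem_range.1 hk)).p_mem.1 π)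
    ENNReal.toReal_nonneg

end IsValidRun

end Estimation

/-! ### Regret and rates -/

section Regret

variable {Mdl Pol Obs Φ Ω : Type*} [MeasurableSpace Mdl] [MeasurableSpace Pol]
  [MeasurableSpace Obs] [MeasurableSpace Ω] [Fintype Pol] [Fintype Φ]
  {P : DMSO Mdl Pol Obs} {I : InfoSets Mdl Pol Φ} {H N : ℕ} {ℓ : Fin H → Φ → Obs → Fin N → ℝ}
  {B η δ : ℝ} {τ K k t : ℕ} {φs : Φ} {R : Run Ω Mdl Pol Obs Φ} {μ : Measure Ω}
  [IsProbabilityMeasure μ] [MeasurableSingletonClass Pol]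

namespace IsValidRun

variable (h : IsValidRun μ P I ℓ B η δ τ K φs R)
include h

lemma gap_policy (hk : k < K) (ht : t ∈ epoch τ k) :
    Integrable (fun ω => P.V (R.model t ω) (I.policy φs) - P.V (R.model t ω) (R.policy k ω)) μ ∧
      Integrable (fun ω => ∑ π, R.p k ω π *
        (P.V (R.model t ω) (I.policy φs) - P.V (R.model t ω) π)) μ ∧
      ∫ ω, (P.V (R.model t ω) (I.policy φs) - P.V (R.model t ω) (R.policy k ω)) ∂μ =
        ∫ ω, ∑ π, R.p k ω π *
          (P.V (R.model t ω) (I.policy φs) - P.V (R.model t ω) π) ∂μ := by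
  have hm : ∀ π, Measurable[R.envHist τ k]
      fun ω => P.V (R.model t ω) (I.policy φs) - P.V (R.model t ω) π := by
    intro π
    have hX : Measurable[R.envHist τ k] fun ω => (R.model t ω, I.policy φs) :=
      (R.measurable_model_envHist (lt_of_mem_epoch ht)).prodMk measurable_const
    exact (P.measurable_gap π).comp hX
  obtain ⟨h1, h2, h3⟩ := integral_finite_eq h.envHist_le (h.learner.measurable_policy k)
    (h.learner.policy_law k hk) hm fun π => integrable_of_ae_abs_le (c := 1)
      ((hm π).mono h.envHist_le le_rfl) (Filter.Eventually.of_forall fun ω => P.abs_gap_le _ _ _)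
  exact ⟨h1, integrable_finsetSum _ fun π _ => h2 π, h3⟩

lemma integrable_regret : Integrable (regret P I τ K φs R) μ :=
  integrable_finsetSum _ fun _ hk => integrable_finsetSum _ fun _ ht =>
    (h.gap_policy (Finset.mem_range.1 hk) ht).1

/-- In every round the expected gap is controlled by the decision-estimation coefficient. -/
lemma ae_gap_le_digDec (hk : k < K) : ∀ᵐ ω ∂μ, ∀ t ∈ epoch τ k,
    ((∑ π, R.p k ω π * (P.V (R.model t ω) (I.policy φs) - P.V (R.model t ω) π) -
      roundEst P I ℓ B φs R k t ω / η : ℝ) : EReal) ≤ digDec P I (avgError P ℓ B) η := by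
  filter_upwards [h.ae_world_mem hk, (h.hasFiniteLoss hk.le).1, h.ae_lossAt_eq hk,
    h.learner.minimax, h.post] with ω h1 h2 h3 h4 h5 t ht
  refine le_of_eq_of_le ?_ ((h4 k hk).meanGap_le_digDec h.η_pos h.estimation.measurable_avgError
    avgError_nonneg (h1 t ht) h2.1 h2.2 (h5 k hk t ht))
  simp only [roundEst, errorAt, pointDivergence, h3, mul_sub, mul_add, Finset.sum_sub_distrib,
    Finset.sum_add_distrib, ← Finset.sum_mul, (h4 k hk).p_mem.2, one_mul]

/-- The models of an epoch are settled before its policy is drawn, so the expected regret of a round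
is the average gap over `p_k`, to which the pointwise bound applies. -/
lemma integral_regret_sub_le {D : ℝ} (hD : digDec P I (avgError P ℓ B) η ≤ (D : EReal)) :
    ∫ ω, regret P I τ K φs R ω ∂μ - (∫ ω, est P I ℓ B τ K φs R ω ∂μ) / η ≤ K * τ * D := by
  rw [h.integral_est_eq, Finset.sum_div]
  unfold regret
  rw [integral_finsetSum _ fun _ hk => integrable_finsetSum _ fun _ ht =>
    (h.gap_policy (Finset.mem_range.1 hk) ht).1, ← Finset.sum_sub_distrib]
  refine (Finset.sum_le_card_nsmul _ _ (τ * D) fun k hk => ?_).trans_eq ?_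
  swap
  · rw [Finset.card_range, nsmul_eq_mul, mul_assoc]
  have hk := Finset.mem_range.1 hk
  rw [integral_finsetSum _ fun _ ht => (h.gap_policy hk ht).1, Finset.sum_div,
    ← Finset.sum_sub_distrib]
  refine (Finset.sum_le_card_nsmul _ _ D fun t ht => ?_).trans_eq ?_
  swap
  · rw [card_epoch, nsmul_eq_mul]
  obtain ⟨-, h2, h3⟩ := h.gap_policy hk ht
  have hi := (h.integrable_roundEst hk ht).div_const η
  rw [h3, ← integral_div, ← integral_sub h2 hi]
  refine (integral_mono_ae (h2.sub hi) (integrable_const D) ?_).trans_eq (by simp)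
  filter_upwards [h.ae_gap_le_digDec hk] with ω hω
  exact EReal.coe_le_coe_iff.1 ((hω t ht).trans hD)

lemma integral_regret_sub_le_digDec (hK : 0 < K) :
    ((∫ ω, regret P I τ K φs R ω ∂μ - (∫ ω, est P I ℓ B τ K φs R ω ∂μ) / η : ℝ) : EReal) ≤
      ((K * τ : ℕ) : EReal) * digDec P I (avgError P ℓ B) η := by
  have hT : 0 < K * τ := Nat.mul_pos hK h.τ_pos
  have hcast : ((K * τ : ℕ) : EReal) = (((K * τ : ℕ) : ℝ) : EReal) := rfl
  rw [hcast]
  induction hd : digDec P I (avgError P ℓ B) η with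
  -- The value `⊥` cannot occur, since some real number lies below the coefficient by the bound for
  -- the first round.
  | bot =>
    obtain ⟨ω, hω⟩ := (h.ae_gap_le_digDec hK).exists
    have ht : 0 ∈ epoch τ 0 := by simpa [epoch] using h.τ_pos
    have := hω 0 ht
    rw [hd, le_bot_iff] at this
    exact absurd this (EReal.coe_ne_bot _)
  | coe D =>
    rw [← EReal.coe_mul, EReal.coe_le_coe_iff, Nat.cast_mul]
    exact h.integral_regret_sub_le hd.le
  | top =>
    rw [EReal.coe_mul_top_of_pos (by exact_mod_cast hT)]
    exact le_top

end IsValidRun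

end Regret

/-! ### Tuning of the parameters -/

section Rates

/-- The tuning of the epoch length balances the two parts of the bound on the estimation term. -/
lemma estimation_rate {x t k N ι L : ℝ} (hx : 0 < x) (ht : 0 < t) (h1 : 1 / 2 * x ≤ t)
    (h2 : t ≤ 2 * x) (hk : k * t = x ^ 3) (hN : 1 ≤ N) (hι : 1 ≤ ι) (hL : 0.69 ≤ L) :
    (t + 2 * (7 * t * N * ι)) * L + k * (16 * N ^ 2 / (7 * t * N * ι)) ≤ 50 * N * L * x * ι := by
  have hNι : 1 ≤ N * ι := one_le_mul_of_one_le_of_one_le hN hι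
  -- The lower bound `t ≥ x/2` gives `k/t = x³/t² ≤ 4x`. The constant `50` is `30` from the entropy
  -- part plus `10` from the variance part, the latter doubled because `2L ≥ 1`.
  have hkx : k * (1 / t) ≤ 4 * x := by
    have : k = x ^ 3 / t := by field_simp; exact hk
    rw [this, div_mul_div_comm, mul_one, div_le_iff₀ (by positivity)]
    nlinarith [mul_le_mul h1 h1 (by positivity) ht.le]
  have e : k * (16 * N ^ 2 / (7 * t * N * ι)) = k * (1 / t) * (16 / 7 * N) / ι := by
    field_simp
  have p1 : (t + 2 * (7 * t * N * ι)) * L ≤ 30 * (N * ι * L * x) := by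
    have : t + 2 * (7 * t * N * ι) ≤ 30 * (N * ι * x) := by nlinarith
    nlinarith
  have p2 : k * (16 * N ^ 2 / (7 * t * N * ι)) ≤ 10 * (N * x) := by
    rw [e]
    refine (div_le_self (mul_nonneg ?_ (by positivity)) hι).trans ?_
    · have : k = x ^ 3 / t := by field_simp; exact hk
      rw [this]
      positivity
    · nlinarith [mul_le_mul_of_nonneg_right hkx (by positivity : 0 ≤ 16 / 7 * N),
        mul_pos (by linarith : 0 < N) hx]
  have p3 : N * x ≤ 2 * (N * ι * L * x) := by
    have : 1 ≤ 2 * (ι * L) := by nlinarith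
    nlinarith [mul_pos (by linarith : 0 < N) hx]
  nlinarith

/-- Tuning `η` when the coefficient is linear in `η`. -/
lemma linear_rate {T η D E L ι G : ℝ} (hT : 0 < T) (hη : 0 < η) (hD : 0 < D) (hL : 0 ≤ L)
    (hι : 1 ≤ ι) (hη' : η = (L / D) ^ (1 / 2 : ℝ) * T ^ (-(1 / 3) : ℝ))
    (hE : E ≤ 50 * L * T ^ (1 / 3 : ℝ) * ι) (hG : G - E / η ≤ T * (D * η)) :
    G ≤ 51 * (D * L) ^ (1 / 2 : ℝ) * T ^ (2 / 3 : ℝ) * ι := by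
  -- With `T = x³`, `L = s²`, `D = q²` the choice of `η` reads `s / (q x)`, and both parts of the
  -- bound become multiples of `q s x²`.
  obtain ⟨x, hx, rfl⟩ : ∃ x : ℝ, 0 < x ∧ T = x ^ 3 :=
    ⟨T ^ (1 / 3 : ℝ), by positivity, by rw [← Real.rpow_natCast, ← Real.rpow_mul hT.le]; norm_num⟩
  obtain ⟨s, hs, rfl⟩ : ∃ s : ℝ, 0 ≤ s ∧ L = s ^ 2 := ⟨√L, by positivity, (Real.sq_sqrt hL).symm⟩
  obtain ⟨q, hq, rfl⟩ : ∃ q : ℝ, 0 < q ∧ D = q ^ 2 := ⟨√D, by positivity, (Real.sq_sqrt hD.le).symm⟩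
  have hx3 : ∀ (a : ℝ), (x ^ 3) ^ a = x ^ (3 * a) := fun a => by
    rw [← Real.rpow_natCast, ← Real.rpow_mul hx.le]
    norm_num
  rw [← div_pow, ← Real.sqrt_eq_rpow, Real.sqrt_sq (by positivity), hx3,
    show (3 * -(1 / 3) : ℝ) = -1 by norm_num, Real.rpow_neg_one] at hη'
  rw [hx3, show (3 * (1 / 3) : ℝ) = 1 by norm_num, Real.rpow_one] at hE
  rw [hx3, show (3 * (2 / 3) : ℝ) = (2 : ℕ) by norm_num, Real.rpow_natCast, ← mul_pow,
    ← Real.sqrt_eq_rpow, Real.sqrt_sq (by positivity)]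
  have hs : 0 < s := by
    rcases hs.eq_or_lt with rfl | hs
    · simp [hη'] at hη
    · exact hs
  have h1 : E / η ≤ 50 * (q * s) * x ^ 2 * ι := by
    rw [div_le_iff₀ hη]
    refine hE.trans_eq ?_
    rw [hη']
    field_simp
  have h2 : x ^ 3 * (q ^ 2 * η) = q * s * x ^ 2 := by
    rw [hη']
    field_simp
  nlinarith [mul_le_mul_of_nonneg_left hι (by positivity : 0 ≤ q * s * x ^ 2)]

/-- Tuning `η` when the coefficient is of order `√η`. -/
lemma sqrt_rate {T η D E L ι G : ℝ} (hT : 0 < T) (hη : 0 < η) (hD : 0 < D) (hL : 0 ≤ L)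
    (hι : 1 ≤ ι) (hη' : η = L ^ (2 / 3 : ℝ) * D ^ (-(1 / 3) : ℝ) * T ^ (-(4 / 9) : ℝ))
    (hE : E ≤ 50 * L * T ^ (1 / 3 : ℝ) * ι) (hG : G - E / η ≤ T * √(D * η)) :
    G ≤ 51 * (D * L) ^ (1 / 3 : ℝ) * T ^ (7 / 9 : ℝ) * ι := by
  -- With `T = y⁹`, `L = a³`, `D = b³` the choice of `η` reads `a² / (b y⁴)`, so `Dη = (ab/y²)²` is
  -- a perfect square.
  obtain ⟨y, hy, rfl⟩ : ∃ y : ℝ, 0 < y ∧ T = y ^ 9 :=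
    ⟨T ^ (1 / 9 : ℝ), by positivity, by rw [← Real.rpow_natCast, ← Real.rpow_mul hT.le]; norm_num⟩
  obtain ⟨a, ha, rfl⟩ : ∃ a : ℝ, 0 ≤ a ∧ L = a ^ 3 :=
    ⟨L ^ (1 / 3 : ℝ), by positivity, by rw [← Real.rpow_natCast, ← Real.rpow_mul hL]; norm_num⟩
  obtain ⟨b, hb, rfl⟩ : ∃ b : ℝ, 0 < b ∧ D = b ^ 3 :=
    ⟨D ^ (1 / 3 : ℝ), by positivity, by rw [← Real.rpow_natCast, ← Real.rpow_mul hD.le]; norm_num⟩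
  have hpow : ∀ {z : ℝ} (_ : 0 ≤ z) (n : ℕ) (r : ℝ), (z ^ n) ^ r = z ^ (n * r) := fun hz n r => by
    rw [← Real.rpow_natCast, ← Real.rpow_mul hz]
  rw [hpow ha, hpow hb.le, hpow hy.le, show ((3 : ℕ) * (2 / 3) : ℝ) = (2 : ℕ) by norm_num,
    show ((3 : ℕ) * -(1 / 3) : ℝ) = -1 by norm_num,
    show ((9 : ℕ) * -(4 / 9) : ℝ) = -((4 : ℕ) : ℝ) by norm_num, Real.rpow_neg hy.le,
    Real.rpow_natCast, Real.rpow_natCast, Real.rpow_neg_one] at hη'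
  rw [hpow hy.le, show ((9 : ℕ) * (1 / 3) : ℝ) = (3 : ℕ) by norm_num, Real.rpow_natCast] at hE
  rw [hpow hy.le, show ((9 : ℕ) * (7 / 9) : ℝ) = (7 : ℕ) by norm_num, Real.rpow_natCast,
    ← mul_pow, hpow (by positivity), show ((3 : ℕ) * (1 / 3) : ℝ) = 1 by norm_num, Real.rpow_one]
  have ha : 0 < a := by
    rcases ha.eq_or_lt with rfl | ha
    · simp [hη'] at hη
    · exact ha
  have h1 : E / η ≤ 50 * (b * a) * y ^ 7 * ι := by
    rw [div_le_iff₀ hη]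
    refine hE.trans_eq ?_
    rw [hη']
    field_simp
  have h2 : y ^ 9 * √(b ^ 3 * η) = b * a * y ^ 7 := by
    have : b ^ 3 * η = (b * a / y ^ 2) ^ 2 := by
      rw [hη']
      field_simp
    rw [this, Real.sqrt_sq (by positivity)]
    field_simp
  nlinarith [mul_le_mul_of_nonneg_left hι (by positivity : 0 ≤ b * a * y ^ 7)]

end Rates

/-! ### The estimation bound at the chosen epoch length -/

section Main

variable {Mdl Pol Obs Φ Ω : Type*} [MeasurableSpace Mdl] [MeasurableSpace Pol]
  [MeasurableSpace Obs] [MeasurableSpace Ω] [Fintype Pol] [Fintype Φ]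
  {P : DMSO Mdl Pol Obs} {I : InfoSets Mdl Pol Φ} {H N : ℕ} {ℓ : Fin H → Φ → Obs → Fin N → ℝ}
  {B η δ : ℝ} {T τ K : ℕ} {φs : Φ} {R : Run Ω Mdl Pol Obs Φ} {μ : Measure Ω}
  [IsProbabilityMeasure μ] [MeasurableSingletonClass Pol]

/-- The expected estimation term for epochs of length of order `T ^ (1 / 3)`. -/
lemma IsValidRun.integral_est_le_rate (h : IsValidRun μ P I ℓ B η δ τ K φs R) (hK : 0 < K)
    (hT : T = K * τ) (h1 : (1 / 2 : ℝ) * (T : ℝ) ^ (1 / 3 : ℝ) ≤ τ)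
    (h2 : (τ : ℝ) ≤ 2 * (T : ℝ) ^ (1 / 3 : ℝ)) :
    ∫ ω, est P I ℓ B τ K φs R ω ∂μ ≤
      50 * N * Real.log (Fintype.card Φ) * (T : ℝ) ^ (1 / 3 : ℝ) * iota N K H δ := by
  have hτ : (0 : ℝ) < τ := by exact_mod_cast h.τ_pos
  have hK' : (0 : ℝ) < K := by exact_mod_cast hK
  have hT' : (T : ℝ) = K * τ := by exact_mod_cast hT
  have hcard : 0 < Fintype.card Φ := Fintype.card_pos_iff.2 ⟨φs⟩
  -- For a single information set the claimed bound is zero, which the term `16KN²/β` would violate;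
  -- for at least two, `log 2` serves as the lower bound `0.69`.
  rcases Nat.lt_or_ge 1 (Fintype.card Φ) with hc | hc
  · refine (h.integral_est_le hK).trans ?_
    have hx : (0 : ℝ) < (T : ℝ) ^ (1 / 3 : ℝ) := by rw [hT']; positivity
    refine estimation_rate hx hτ h1 h2 ?_ (by exact_mod_cast h.N_pos) (h.one_le_iota hK) ?_
    · rw [← Real.rpow_natCast, ← Real.rpow_mul (Nat.cast_nonneg _), hT']
      norm_num
    · refine (by linarith [Real.log_two_gt_d9] : (0.69 : ℝ) ≤ Real.log 2).trans ?_
      exact Real.log_le_log two_pos (by exact_mod_cast hc)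
  · have hc : Fintype.card Φ = 1 := by omega
    simpa [hc] using h.integral_est_nonpos hc

end Main

end DigDec

end

theorem mainTheorem2 :
    ∃ C : ℝ, 0 < C ∧
      ∀ (Mdl Pol Obs Φ Ω : Type*) [MeasurableSpace Mdl] [MeasurableSpace Pol]
        [MeasurableSingletonClass Pol] [MeasurableSpace Obs] [MeasurableSpace Ω]
        [Fintype Pol] [Fintype Φ]
        (P : DigDec.DMSO Mdl Pol Obs) (I : DigDec.InfoSets Mdl Pol Φ)
        (H N : ℕ) (B : ℝ) (ℓ : Fin H → Φ → Obs → Fin N → ℝ)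
        (T τ K : ℕ) (η δ : ℝ) (φs : Φ)
        (μ : MeasureTheory.Measure Ω) [MeasureTheory.IsProbabilityMeasure μ]
        (R : DigDec.Run Ω Mdl Pol Obs Φ),
        0 < H → 0 < N → 0 < B → 0 < η → 0 < δ → δ ≤ 1 →
        0 < τ → Even τ → T = K * τ →
        (1 / 2 : ℝ) * (T : ℝ) ^ (1 / 3 : ℝ) ≤ τ → (τ : ℝ) ≤ 2 * (T : ℝ) ^ (1 / 3 : ℝ) →
        DigDec.IsEstimationFunction P I ℓ B →
        DigDec.IsEnvironment μ P I ℓ τ K φs R →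
        DigDec.IsLearner μ P I ℓ B η δ τ K R →
        DigDec.PosteriorDefined μ P τ K R →
        -- the bound on the estimation term
        (MeasureTheory.Integrable (DigDec.est P I ℓ B τ K φs R) μ ∧
          ∫ ω, DigDec.est P I ℓ B τ K φs R ω ∂μ ≤
            C * N * Real.log (Fintype.card Φ) * (T : ℝ) ^ (1 / 3 : ℝ) * DigDec.iota N K H δ) ∧
        -- the regret in terms of the decision-estimation coefficient and the estimation term
        (MeasureTheory.Integrable (DigDec.regret P I τ K φs R) μ ∧
          ((∫ ω, DigDec.regret P I τ K φs R ω ∂μ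
              - (∫ ω, DigDec.est P I ℓ B τ K φs R ω ∂μ) / η : ℝ) : EReal) ≤
            (T : EReal) * DigDec.digDec P I (DigDec.avgError P ℓ B) η) ∧
        -- the rate for a coefficient that is linear in `η`
        (∀ D : ℝ, 0 < D →
          η = (N * Real.log (Fintype.card Φ) / D) ^ (1 / 2 : ℝ) * (T : ℝ) ^ (-(1 / 3) : ℝ) →
          DigDec.digDec P I (DigDec.avgError P ℓ B) η ≤ ((D * η : ℝ) : EReal) →
          ∫ ω, DigDec.regret P I τ K φs R ω ∂μ ≤
            C * (D * N * Real.log (Fintype.card Φ)) ^ (1 / 2 : ℝ) * (T : ℝ) ^ (2 / 3 : ℝ) *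
              DigDec.iota N K H δ) ∧
        -- the rate for a coefficient that is of order `√η`
        (∀ D : ℝ, 0 < D →
          η = (N * Real.log (Fintype.card Φ)) ^ (2 / 3 : ℝ) * D ^ (-(1 / 3) : ℝ) *
            (T : ℝ) ^ (-(4 / 9) : ℝ) →
          DigDec.digDec P I (DigDec.avgError P ℓ B) η ≤ ((Real.sqrt (D * η) : ℝ) : EReal) →
          ∫ ω, DigDec.regret P I τ K φs R ω ∂μ ≤
            C * (D * N * Real.log (Fintype.card Φ)) ^ (1 / 3 : ℝ) * (T : ℝ) ^ (7 / 9 : ℝ) *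
              DigDec.iota N K H δ) := by
  -- The estimation bound has constant `50`; the rates add `1` for the decision-estimation
  -- coefficient.
  refine ⟨51, by norm_num, ?_⟩
  intro Mdl Pol Obs Φ Ω _ _ _ _ _ _ _ P I H N B ℓ T τ K η δ φs μ _ R hH hN hB hη hδ hδ1 hτ hev
    hT h1 h2 hest henv hlearn hpost
  have h : DigDec.IsValidRun μ P I ℓ B η δ τ K φs R :=
    ⟨hH, hN, hB, hη, hδ, hδ1, hτ, hev, hest, henv, hlearn, hpost⟩
  -- With `K = 0` the upper bound on `τ` would be `2 * 0 ^ (1/3) = 0`.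
  have hK : 0 < K := by
    rcases K.eq_zero_or_pos with rfl | hK
    · have hτ' : (0 : ℝ) < τ := by exact_mod_cast hτ
      rw [hT, zero_mul, Nat.cast_zero, Real.zero_rpow (by norm_num)] at h2
      linarith
    · exact hK
  have hT0 : (0 : ℝ) < T := by
    rw [hT]
    exact_mod_cast Nat.mul_pos hK hτ
  have hTc : (T : ℝ) = K * τ := by exact_mod_cast hT
  have hι := h.one_le_iota hK
  have hL : 0 ≤ (N : ℝ) * Real.log (Fintype.card Φ) :=
    mul_nonneg (Nat.cast_nonneg _) (Real.log_natCast_nonneg _)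
  have hE := h.integral_est_le_rate hK hT h1 h2
  rw [mul_assoc 50] at hE
  refine ⟨⟨h.integrable_est, hE.trans ?_⟩, ⟨h.integrable_regret, ?_⟩, fun D hD hη' hd => ?_,
    fun D hD hη' hd => ?_⟩
  · rw [mul_assoc 51]
    gcongr
    norm_num
  · rw [hT]
    exact h.integral_regret_sub_le_digDec hK
  · rw [mul_assoc D]
    exact DigDec.linear_rate hT0 hη hD hL hι hη' hE (hTc ▸ h.integral_regret_sub_le hd)
  · rw [mul_assoc D]
    exact DigDec.sqrt_rate hT0 hη hD hL hι hη' hE (hTc ▸ h.integral_regret_sub_le hd)
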